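/- Let $k$ be a field with the discrete topology. **Tate spaces.** Let $\Pi=\{(i,j)\in\mathbb Z^2: i\le j\}$ with the order induced from $\mathbb Z\times\mathbb Z$. A functor $X:\Pi\to \mathbf{Vect}_0(k)$ to finite-dimensional vector spaces is *admissible* if $0\to X_{i,j}\to X_{i,l}\to X_{j,l}\to 0$ is exact for all $i\le j\le l$. The category $\mathcal T$ of Tate spaces is the localization of the category of admissible functors at all morphisms $(X_{\varphi_0(i),\varphi_0(j)})\to (X_{\varphi_1(i),\varphi_1(j)})$, where $X$ is admissible and $\varphi_0\le\varphi_1:\mathbb Z\to\mathbb Z$ are nondecreasing maps tending to $\pm\infty$ at $\pm\infty$. A sequence $X\to Y\to Z$ in $\mathcal T$ is an admissible short exact sequence if it becomes short exact in the abelian category $\mathrm{Ind}\,\mathrm{Pro}(\mathbf{Vect}_0(k))$ under $X\mapsto \text{``}\varinjlim_j\text{''}\text{``}\varprojlim_i\text{''}X_{i,j}$ (where $j\to\infty$ and $i\to-\infty$). **Locally linearly compact spaces.** A Hausdorff linearly topologized $k$-vector space is *linearly compact* if every family of closed affine subspaces with the finite intersection property has nonempty intersection. A Hausdorff linearly topologized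 space $V$ is *locally linearly compact* if it has a linearly compact open subspace $U$; it is *of countable type* if moreover $0$ has a countable base of neighbourhoods and $V/U$ has countable dimension for some such $U$. Let $\mathcal L$ be the category of locally linearly compact $k$-vector spaces of countable type and continuous linear maps. The functor $\Phi(X)=\varinjlim_j\varprojlim_i X_{i,j}$ (limits of topological vector spaces, the $X_{i,j}$ being discrete) is an equivalence of categories $\mathcal T\to\mathcal L$. Call a sequence in $\mathcal L$ an admissible short exact sequence if it is isomorphic to the image under $\Phi$ of an admissible short exact sequence of $\mathcal T$; its first map is then called an admissible monomorphism and its second map an admissible epimorphism. Then: (a) a morphism of $\mathcal L$ is an admissible monomorphism if and only if it is a closed embedding; (b) a morphism $p:B\to C$ of $\mathcal L$ is an admissible epimorphism if and only if it is a continuous surjection such that the canonical bijection $B/\ker p\to C$ is a homeomorphism. -/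

import Mathlib

open CategoryTheory CategoryTheory.Limits

universe u

namespace TateSpaces

noncomputable section

/-! ### The index set `Π = {(i, j) ∈ ℤ × ℤ | i ≤ j}` and bicofinal reindexings -/

/-- The ordered set of pairs of integers `i ≤ j`, with the order induced from `ℤ × ℤ`. -/
abbrev Pairs : Type := {p : ℤ × ℤ // p.1 ≤ p.2}

/-- The element `(i, j)` of `Pairs`. -/
abbrev pair (i j : ℤ) (h : i ≤ j) : Pairs := ⟨(i, j), h⟩

/-- A nondecreasing map `φ : ℤ → ℤ` with `φ → -∞` at `-∞` and `φ → ∞` at `∞`. -/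
structure Bicofinal where
  toFun : ℤ → ℤ
  mono : Monotone toFun
  tendsto_atBot : Filter.Tendsto toFun Filter.atBot Filter.atBot
  tendsto_atTop : Filter.Tendsto toFun Filter.atTop Filter.atTop

/-- The endofunctor `(i, j) ↦ (φ i, φ j)` of `Pairs`. -/
def Bicofinal.onPairs (φ : Bicofinal) : Pairs ⥤ Pairs :=
  Monotone.functor (f := fun p => pair (φ.toFun p.1.1) (φ.toFun p.1.2) (φ.mono p.2))
    fun _ _ h => ⟨φ.mono h.1, φ.mono h.2⟩

/-- For `φ₀ ≤ φ₁`, the natural transformation with components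
`(φ₀ i, φ₀ j) ⟶ (φ₁ i, φ₁ j)`. -/
def Bicofinal.compare {φ₀ φ₁ : Bicofinal} (h : ∀ i, φ₀.toFun i ≤ φ₁.toFun i) :
    φ₀.onPairs ⟶ φ₁.onPairs where
  app p := homOfLE ⟨h p.1.1, h p.1.2⟩

/-! ### Iterated limits of diagrams indexed by `Pairs` -/

/-- `j ↦ (i ↦ (min i j, j))`.  Pulling back along it extends a diagram `X` on `Pairs` to
`ℤ × ℤ`, the value at `(i, j)` being `X (i, j)` if `i ≤ j` and `X (j, j)` if `i > j`. -/
def clamp : ℤ ⥤ ℤ ⥤ Pairs where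
  obj j := Monotone.functor (f := fun i => pair (min i j) j (min_le_right i j))
    fun _ _ h => ⟨min_le_min_right j h, le_refl j⟩
  map {j j'} f := { app := fun i => homOfLE ⟨min_le_min_left i (leOfHom f), leOfHom f⟩ }

theorem map_comp_map_eq {A D : Type*} [Category* A] [Category* D] (F : A ⥤ D) (X : Pairs ⥤ A) {p q r s t : Pairs} (f : p ⟶ q) (g : q ⟶ r)
    (h : r ⟶ s) (f' : p ⟶ t) (g' : t ⟶ s) :
    F.map (X.map f) ≫ F.map (X.map g) ≫ F.map (X.map h) = F.map (X.map f') ≫ F.map (X.map g') := by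
  rw [← F.map_comp, ← F.map_comp, ← F.map_comp, ← X.map_comp, ← X.map_comp, ← X.map_comp]
  exact congrArg (fun t => F.map (X.map t)) (Subsingleton.elim _ _)

section Limits

universe v₁ v₂ v₃ u₁ u₂ u₃

variable {A : Type u₁} [Category.{v₁} A] {D : Type u₂} [Category.{v₂} D]
  {D' : Type u₃} [Category.{v₃} D'] [HasLimitsOfShape ℤ D] [HasColimitsOfShape ℤ D']

/-- `X ↦ (j ↦ lim_{i → -∞} F X_{i,j})`. -/
def innerLim (F : A ⥤ D) : (Pairs ⥤ A) ⥤ (ℤ ⥤ D) where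
  obj X := clamp ⋙ (Functor.whiskeringRight ℤ Pairs D).obj (X ⋙ F) ⋙ lim
  map f := Functor.whiskerLeft clamp
    (Functor.whiskerRight ((Functor.whiskeringRight ℤ Pairs D).map (Functor.whiskerRight f F)) lim)

/-- `X ↦ colim_{j → ∞} G (lim_{i → -∞} F X_{i,j})`. -/
def colimLim (F : A ⥤ D) (G : D ⥤ D') : (Pairs ⥤ A) ⥤ D' :=
  innerLim F ⋙ (Functor.whiskeringRight ℤ D D').obj G ⋙ colim

/-- The functor `ℤ ⥤ ℤ` given by a bicofinal map. -/
def Bicofinal.functor (φ : Bicofinal) : ℤ ⥤ ℤ := φ.mono.functor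

/-- For `φ₀ ≤ φ₁`, the natural transformation with components `φ₀ i ⟶ φ₁ i`. -/
def Bicofinal.functorLE {φ₀ φ₁ : Bicofinal} (h : ∀ i, φ₀.toFun i ≤ φ₁.toFun i) :
    φ₀.functor ⟶ φ₁.functor where
  app i := homOfLE (h i)

theorem Bicofinal.final_functor (φ : Bicofinal) : φ.functor.Final := by
  refine (Monotone.final_functor_iff φ.mono).2 fun j => ?_
  exact (φ.tendsto_atTop.eventually_ge_atTop j).exists

theorem Bicofinal.initial_functor (φ : Bicofinal) : φ.functor.Initial := by
  refine (Monotone.initial_functor_iff φ.mono).2 fun j => ?_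
  exact (φ.tendsto_atBot.eventually_le_atBot j).exists

/-- For monotone `φ`, clamping commutes with reindexing. -/
def clampIso (φ : Bicofinal) (j : ℤ) :
    φ.functor ⋙ clamp.obj (φ.toFun j) ≅ clamp.obj j ⋙ φ.onPairs :=
  NatIso.ofComponents (fun _ => eqToIso (Subtype.ext (Prod.ext (φ.mono.map_min).symm rfl)))
    (fun _ => Subsingleton.elim _ _)

/-- The map `lim_i F X_{i, φ j} ⟶ lim_i F X_{φ i, φ j}`. -/
def reindexApp (F : A ⥤ D) (X : Pairs ⥤ A) (φ : Bicofinal) (j : ℤ) :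
    limit (clamp.obj (φ.toFun j) ⋙ X ⋙ F) ⟶ limit (clamp.obj j ⋙ (φ.onPairs ⋙ X) ⋙ F) :=
  limit.pre (clamp.obj (φ.toFun j) ⋙ X ⋙ F) φ.functor ≫
    limMap (F := φ.functor ⋙ clamp.obj (φ.toFun j) ⋙ X ⋙ F)
      (G := clamp.obj j ⋙ (φ.onPairs ⋙ X) ⋙ F)
      (Functor.whiskerRight (clampIso φ j).hom (X ⋙ F))

theorem reindexApp_π (F : A ⥤ D) (X : Pairs ⥤ A) (φ : Bicofinal) (j i : ℤ) :
    reindexApp F X φ j ≫ limit.π (clamp.obj j ⋙ (φ.onPairs ⋙ X) ⋙ F) i =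
      limit.π (clamp.obj (φ.toFun j) ⋙ X ⋙ F) (φ.toFun i) ≫
        F.map (X.map ((clampIso φ j).hom.app i)) := by
  unfold reindexApp
  rw [Category.assoc, limMap_π, ← Category.assoc, limit.pre_π]
  rfl

theorem isIso_reindexApp (F : A ⥤ D) (X : Pairs ⥤ A) (φ : Bicofinal) (j : ℤ) :
    IsIso (reindexApp F X φ j) := by
  have := φ.initial_functor
  let e : φ.functor ⋙ clamp.obj (φ.toFun j) ⋙ X ⋙ F ≅ clamp.obj j ⋙ (φ.onPairs ⋙ X) ⋙ F :=
    Functor.isoWhiskerRight (clampIso φ j) (X ⋙ F)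
  have h1 : IsIso (limit.pre (clamp.obj (φ.toFun j) ⋙ X ⋙ F) φ.functor) := inferInstance
  have h2 : IsIso (limMap e.hom) := inferInstanceAs (IsIso (lim.map e.hom))
  exact IsIso.comp_isIso' h1 h2

theorem reindexApp_comp (F : A ⥤ D) (X : Pairs ⥤ A) {φ₀ φ₁ : Bicofinal} {j j' : ℤ}
    (a : clamp.obj (φ₀.toFun j) ⟶ clamp.obj (φ₁.toFun j'))
    (b : clamp.obj j ⋙ φ₀.onPairs ⟶ clamp.obj j' ⋙ φ₁.onPairs)
    (h : ∀ i, φ₀.toFun i ≤ φ₁.toFun i) :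
    limMap (Functor.whiskerRight a (X ⋙ F)) ≫ reindexApp F X φ₁ j' =
      reindexApp F X φ₀ j ≫ limMap (F := clamp.obj j ⋙ (φ₀.onPairs ⋙ X) ⋙ F)
        (G := clamp.obj j' ⋙ (φ₁.onPairs ⋙ X) ⋙ F) (Functor.whiskerRight b (X ⋙ F)) := by
  apply limit.hom_ext
  intro i
  have key : limit.π (clamp.obj (φ₀.toFun j) ⋙ X ⋙ F) (φ₁.toFun i) =
      limit.π (clamp.obj (φ₀.toFun j) ⋙ X ⋙ F) (φ₀.toFun i) ≫
        F.map (X.map ((clamp.obj (φ₀.toFun j)).map (homOfLE (h i)))) :=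
    (limit.w (clamp.obj (φ₀.toFun j) ⋙ X ⋙ F) (homOfLE (h i))).symm
  have e1 := (limMap (Functor.whiskerRight a (X ⋙ F))) ≫= reindexApp_π F X φ₁ j' i
  have e2 := reindexApp_π F X φ₀ j i =≫ F.map (X.map (b.app i))
  rw [limMap_π_assoc, key] at e1
  rw [Category.assoc, Category.assoc, limMap_π, e1]
  refine Eq.trans ?_ (e2.symm.trans (Category.assoc _ _ _))
  rw [Category.assoc, Category.assoc]
  congr 1
  exact map_comp_map_eq F X _ _ _ _ _

/-- The natural isomorphism `lim_i F X_{i, φ j} ≅ lim_i F X_{φ i, φ j}`. -/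
def reindex (F : A ⥤ D) (X : Pairs ⥤ A) (φ : Bicofinal) :
    φ.functor ⋙ (innerLim F).obj X ⟶ (innerLim F).obj (φ.onPairs ⋙ X) where
  app j := reindexApp F X φ j
  naturality _ _ f := reindexApp_comp F X (clamp.map (φ.functor.map f))
    (Functor.whiskerRight (clamp.map f) φ.onPairs) fun _ => le_refl _

theorem reindex_map (F : A ⥤ D) (X : Pairs ⥤ A) {φ₀ φ₁ : Bicofinal}
    (h : ∀ i, φ₀.toFun i ≤ φ₁.toFun i) :
    Functor.whiskerRight (Bicofinal.functorLE h) ((innerLim F).obj X) ≫ reindex F X φ₁ =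
      reindex F X φ₀ ≫
        (innerLim F).map (Functor.whiskerRight (Bicofinal.compare h) X) := by
  ext j
  exact reindexApp_comp F X (clamp.map ((Bicofinal.functorLE h).app j))
    (Functor.whiskerLeft (clamp.obj j) (Bicofinal.compare h)) h

theorem isIso_reindex (F : A ⥤ D) (X : Pairs ⥤ A) (φ : Bicofinal) : IsIso (reindex F X φ) := by
  have : ∀ j, IsIso ((reindex F X φ).app j) := fun j => isIso_reindexApp F X φ j
  exact NatIso.isIso_of_isIso_app _

theorem isIso_colimMap_functorLE (Z : ℤ ⥤ D') {φ₀ φ₁ : Bicofinal}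
    (h : ∀ i, φ₀.toFun i ≤ φ₁.toFun i) :
    IsIso (colim.map (Functor.whiskerRight (Bicofinal.functorLE h) Z)) := by
  have := φ₀.final_functor
  have := φ₁.final_functor
  have e : colim.map (Functor.whiskerRight (Bicofinal.functorLE h) Z) ≫
      colimit.pre Z φ₁.functor = colimit.pre Z φ₀.functor := by
    apply colimit.hom_ext
    intro j
    simp
  exact IsIso.of_isIso_fac_right e

theorem isIso_colimLim_compare (F : A ⥤ D) (G : D ⥤ D') (X : Pairs ⥤ A) {φ₀ φ₁ : Bicofinal}
    (h : ∀ i, φ₀.toFun i ≤ φ₁.toFun i) :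
    IsIso ((colimLim F G).map (Functor.whiskerRight (Bicofinal.compare h) X)) := by
  have e := congrArg (fun t => colim.map (Functor.whiskerRight t G)) (reindex_map F X h)
  simp only [Functor.whiskerRight_comp, Functor.map_comp] at e
  have h1 := isIso_colimMap_functorLE ((innerLim F).obj X ⋙ G) h
  have h2 : IsIso (colim.map (Functor.whiskerRight (Functor.whiskerRight
      (Bicofinal.functorLE h) ((innerLim F).obj X)) G)) := h1
  have h3 : ∀ φ, IsIso (colim.map (Functor.whiskerRight (reindex F X φ) G)) := fun φ => by
    have := isIso_reindex F X φ
    have : IsIso (Functor.whiskerRight (reindex F X φ) G) :=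
      inferInstanceAs (IsIso (((Functor.whiskeringRight ℤ D D').obj G).map (reindex F X φ)))
    exact inferInstance
  have h4 := h3 φ₀
  have h5 := h3 φ₁
  have h6 := IsIso.comp_isIso' h2 h5
  rw [e] at h6
  exact IsIso.of_isIso_comp_left (colim.map (Functor.whiskerRight (reindex F X φ₀) G)) (colim.map (Functor.whiskerRight
    ((innerLim F).map (Functor.whiskerRight (Bicofinal.compare h) X)) G))

end Limits

/-! ### The category of Tate spaces -/

variable (k : Type u) [Field k]

/-- A diagram `X` of finite-dimensional spaces on `Pairs` is admissible if
`0 → X_{i,j} → X_{i,l} → X_{j,l} → 0` is exact for all `i ≤ j ≤ l`. -/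
def IsAdmissible : ObjectProperty (Pairs ⥤ FGModuleCat.{u} k) := fun X =>
  ∀ (i j l : ℤ) (hij : i ≤ j) (hjl : j ≤ l),
    let f : X.obj (pair i j hij) ⟶ X.obj (pair i l (hij.trans hjl)) :=
      X.map (homOfLE ⟨le_refl i, hjl⟩)
    let g : X.obj (pair i l (hij.trans hjl)) ⟶ X.obj (pair j l hjl) :=
      X.map (homOfLE ⟨hij, le_refl l⟩)
    Function.Injective f ∧ Function.Exact f g ∧ Function.Surjective g

/-- The category of admissible diagrams of finite-dimensional spaces on `Pairs`. -/
abbrev AdmDiagram : Type (u + 1) := (IsAdmissible k).FullSubcategory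

variable {k}

/-- The reindexed diagram `X_{φ i, φ j}`. -/
def AdmDiagram.reindex (X : AdmDiagram k) (φ : Bicofinal) : AdmDiagram k :=
  ⟨φ.onPairs ⋙ X.obj, fun _ _ _ hij hjl => X.property _ _ _ (φ.mono hij) (φ.mono hjl)⟩

/-- For `φ₀ ≤ φ₁`, the morphism with components `X_{φ₀ i, φ₀ j} ⟶ X_{φ₁ i, φ₁ j}`. -/
def AdmDiagram.shift (X : AdmDiagram k) {φ₀ φ₁ : Bicofinal}
    (h : ∀ i, φ₀.toFun i ≤ φ₁.toFun i) : X.reindex φ₀ ⟶ X.reindex φ₁ :=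
  ObjectProperty.homMk (Functor.whiskerRight (Bicofinal.compare h) X.obj)

variable (k)

/-- The class of all morphisms `X_{φ₀ i, φ₀ j} ⟶ X_{φ₁ i, φ₁ j}`, for `X` an admissible diagram
and `φ₀ ≤ φ₁` bicofinal. -/
inductive shiftMaps : MorphismProperty (AdmDiagram k)
  | mk (X : AdmDiagram k) {φ₀ φ₁ : Bicofinal} (h : ∀ i, φ₀.toFun i ≤ φ₁.toFun i) :
      shiftMaps (X.shift h)

/-- The category of Tate spaces over `k`: the localization of the category of admissible
diagrams of finite-dimensional spaces at the class of morphisms `shiftMaps`. -/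
abbrev Tate : Type (u + 1) := (shiftMaps k).Localization

theorem shiftMaps_isInvertedBy {D : Type*} [Category* D] {D' : Type*} [Category* D']
    [HasLimitsOfShape ℤ D] [HasColimitsOfShape ℤ D'] (F : FGModuleCat.{u} k ⥤ D) (G : D ⥤ D') :
    (shiftMaps k).IsInvertedBy ((IsAdmissible k).ι ⋙ colimLim F G) := by
  rintro _ _ _ ⟨X, h⟩
  exact isIso_colimLim_compare F G X.obj h

/-! ### The exact structure on the category of Tate spaces -/

/-- The category of pro-objects of a category. -/
abbrev Pro (C : Type*) [Category* C] := (Ind Cᵒᵖ)ᵒᵖ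

/-- The category of ind-pro-objects in finite-dimensional vector spaces over `k`. -/
abbrev IndPro : Type (u + 1) := Ind (Pro (FGModuleCat.{u} k))

theorem hasColimitsOfShape_of_isFiltered {C : Type*} [Category.{u} C] (J : Type) [SmallCategory J]
    [IsFiltered J] : HasColimitsOfShape J (Ind C) := by
  have : IsFiltered (ULiftHom.{u} (ULift.{u} J)) :=
    IsFiltered.of_equivalence (ULiftHomULiftCategory.equiv.{u, u} J)
  exact hasColimitsOfShape_of_equivalence (ULiftHomULiftCategory.equiv.{u, u} J).symm

instance : HasColimitsOfShape ℤ (IndPro k) := hasColimitsOfShape_of_isFiltered ℤ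

instance : HasLimitsOfShape ℤ (Pro (FGModuleCat.{u} k)) :=
  have : HasColimitsOfShape ℤᵒᵖ (Ind (FGModuleCat.{u} k)ᵒᵖ) := hasColimitsOfShape_of_isFiltered ℤᵒᵖ
  hasLimitsOfShape_op_of_hasColimitsOfShape

/-- The functor `X ↦ "colim"_j "lim"_i X_{i,j}` from Tate spaces to ind-pro-objects. -/
def toIndPro : Tate k ⥤ IndPro k :=
  Localization.Construction.lift _
    (shiftMaps_isInvertedBy k (Ind.yoneda (C := (FGModuleCat.{u} k)ᵒᵖ)).rightOp Ind.yoneda)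

/-- In a category with a zero object, `i` is a kernel of `p` and `p` is a cokernel of `i`. In an
abelian category this says that `0 ⟶ X ⟶ Y ⟶ Z ⟶ 0` is a short exact sequence. -/
def IsKernelCokernelPair {C : Type*} [Category* C] {X Y Z : C} (i : X ⟶ Y) (p : Y ⟶ Z) : Prop :=
  ∃ (O : C) (_ : IsZero O) (s : X ⟶ O) (t : O ⟶ Z), IsPullback i s p t ∧ IsPushout i s p t

/-- The admissible short exact sequences of Tate spaces: those sequences which are short exact
in the abelian category of ind-pro-objects. -/
def Tate.IsAdmissibleExact {X Y Z : Tate k} (i : X ⟶ Y) (p : Y ⟶ Z) : Prop :=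
  IsKernelCokernelPair ((toIndPro k).map i) ((toIndPro k).map p)

/-! ### Locally linearly compact spaces -/

/-- A Hausdorff linearly topologized vector space is linearly compact if every family of closed
affine subspaces with the finite intersection property has nonempty intersection. -/
structure IsLinearlyCompact (V : Type*) [AddCommGroup V] [Module k V] [TopologicalSpace V] :
    Prop where
  isLinearTopology : IsLinearTopology k V
  t2Space : T2Space V
  nonempty_iInter : ∀ 𝓕 : Set (AffineSubspace k V), (∀ S ∈ 𝓕, IsClosed (S : Set V)) →
    (∀ t : Finset (AffineSubspace k V), (t : Set (AffineSubspace k V)) ⊆ 𝓕 →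
      (⋂ S ∈ t, (S : Set V)).Nonempty) → (⋂ S ∈ 𝓕, (S : Set V)).Nonempty

variable [TopologicalSpace k]

/-- A locally linearly compact space: a Hausdorff linearly topologized vector space with a linearly
compact open subspace. -/
structure IsLLC (V : TopModuleCat.{u} k) : Prop where
  isLinearTopology : IsLinearTopology k V
  t2Space : T2Space V
  exists_open : ∃ U : Submodule k V, IsOpen (U : Set V) ∧ IsLinearlyCompact k U

/-- A locally linearly compact space `V` is of countable type if `0` has a countable base of
neighbourhoods and `V / U` has countable dimension for some linearly compact open subspace `U`. -/
structure IsCountableLLC (V : TopModuleCat.{u} k) : Prop extends IsLLC k V where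
  countable_nhds : (nhds (0 : V)).IsCountablyGenerated
  countable_rank : ∃ U : Submodule k V, IsOpen (U : Set V) ∧ IsLinearlyCompact k U ∧
    Module.rank k (V ⧸ U) ≤ Cardinal.aleph0

/-- A vector space with the discrete topology, as a topological vector space over the discrete
field `k`. -/
def discrete [DiscreteTopology k] : FGModuleCat.{u} k ⥤ TopModuleCat.{u} k where
  obj V :=
    letI : TopologicalSpace V := ⊥
    haveI : DiscreteTopology V := ⟨rfl⟩
    haveI : ContinuousSMul k V := ⟨continuous_of_discreteTopology⟩
    TopModuleCat.of k V
  map {V W} f :=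
    letI : TopologicalSpace V := ⊥
    haveI : DiscreteTopology V := ⟨rfl⟩
    letI : TopologicalSpace W := ⊥
    haveI : DiscreteTopology W := ⟨rfl⟩
    haveI : ContinuousSMul k V := ⟨continuous_of_discreteTopology⟩
    haveI : ContinuousSMul k W := ⟨continuous_of_discreteTopology⟩
    TopModuleCat.ofHom ⟨f.hom.hom, continuous_of_discreteTopology⟩

instance : HasLimitsOfShape ℤ (TopModuleCat.{u} k) := inferInstance

/-- The functor `Φ` sending `X` to the topological vector space `colim_j lim_i X_{i,j}`, where the
`X_{i,j}` are discrete. -/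
def realization [DiscreteTopology k] : Tate k ⥤ TopModuleCat.{u} k :=
  Localization.Construction.lift _ (shiftMaps_isInvertedBy k (discrete k) (𝟭 _))

variable {k} [DiscreteTopology k]

/-- The admissible short exact sequences of locally linearly compact spaces: those isomorphic to
the image under `realization` of an admissible short exact sequence of Tate spaces. -/
def IsAdmissibleExact {V W Q : TopModuleCat.{u} k} (i : V ⟶ W) (p : W ⟶ Q) : Prop :=
  ∃ (X Y Z : Tate k) (i' : X ⟶ Y) (p' : Y ⟶ Z) (_ : Tate.IsAdmissibleExact k i' p')
    (eV : (realization k).obj X ≅ V) (eW : (realization k).obj Y ≅ W)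
    (eQ : (realization k).obj Z ≅ Q),
    (realization k).map i' ≫ eW.hom = eV.hom ≫ i ∧ (realization k).map p' ≫ eQ.hom = eW.hom ≫ p

/-- Admissible monomorphisms: the maps `i` in admissible short exact sequences
`0 ⟶ V ⟶ W ⟶ Q ⟶ 0`. -/
def IsAdmissibleMono {V W : TopModuleCat.{u} k} (i : V ⟶ W) : Prop :=
  ∃ (Q : TopModuleCat.{u} k) (p : W ⟶ Q), IsAdmissibleExact i p

/-- Admissible epimorphisms: the maps `p` in admissible short exact sequences
`0 ⟶ V ⟶ W ⟶ Q ⟶ 0`. -/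
def IsAdmissibleEpi {W Q : TopModuleCat.{u} k} (p : W ⟶ Q) : Prop :=
  ∃ (V : TopModuleCat.{u} k) (i : V ⟶ W), IsAdmissibleExact i p

/-- The canonical map `W / ker p → Q`. -/
def quotientKerMap {W Q : TopModuleCat.{u} k} (p : W ⟶ Q) :
    (W ⧸ LinearMap.ker p.hom.toLinearMap) →ₗ[k] Q :=
  (LinearMap.ker p.hom.toLinearMap).liftQ p.hom.toLinearMap le_rfl

end

end TateSpaces

namespace TateSpaces

noncomputable section

/-! ### Exactness of the passage to ind-pro-objects -/

section IndExact

variable {C : Type*} [Category.{u} C]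

/-! Both sides are compared through filtrations. A `Model` of a diagram `X` on a topological vector
space `V` is a complete, separated, exhaustive filtration of `V` by open subspaces `F j`, forming a
base at `0`, with `F j / F i` identified with `X_{i,j}`. The realization of `X` carries a canonical
model, and morphisms of diagrams correspond bijectively to filtered linear maps between models.
Finite-dimensionality of the `X_{i,j}` makes every continuous map filtered after reindexing the
target (`exists_reindex`). Since every morphism of the localization is a fraction whose denominator
is a reindexing (`isFraction`), the realization is full and faithful. Its essential image consists
of the spaces with a lattice filtration. By linear compactness these are the locally linearly
compact spaces of countable type (`exists_isLatticeFiltration_iff`).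

Strictly exact sequences are admissible: a lattice filtration of the middle term induces lattice
filtrations on a closed subspace and on the corresponding quotient. The graded diagrams are then
exact in each degree, and the passage to ind-pro-objects is exact (`isAdmissibleExact_of_exact`).

Conversely, maps from the line to an ind-pro-object recover the underlying set of the realization
and preserve finite limits. The kernel half of an admissible sequence thus gives injectivity of `i`
and exactness in the middle. Surjectivity of `p` uses the cokernel half: the quotient by `ker p` is
again of countable type, hence comes from a Tate space, and the universal property of the cokernel
yields a section of `B / ker p → C` on the level of ind-pro-objects. The topological assertions then
follow from an open mapping theorem (`IsLatticeFiltration.isOpenMap`), proved by a Baire argument in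
which linear compactness makes the images of the filtration steps closed. -/

instance preservesColimitsOfShape_indInclusion (J : Type) [SmallCategory J] [IsFiltered J] :
    PreservesColimitsOfShape J (Ind.inclusion C) := by
  have : IsFiltered (ULiftHom.{u} (ULift.{u} J)) :=
    IsFiltered.of_equivalence (ULiftHomULiftCategory.equiv.{u, u} J)
  exact preservesColimitsOfShape_of_equiv (ULiftHomULiftCategory.equiv.{u, u} J).symm _

/-- The detour through `ULift` only moves the index category to the universe `u`, in which exactness
of filtered colimits of sets is available. -/
theorem hasExactColimitsOfShape_types (J : Type) [SmallCategory J] [IsFiltered J] :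
    HasExactColimitsOfShape J (Type u) := by
  have : IsFiltered (ULiftHom.{u} (ULift.{u} J)) :=
    IsFiltered.of_equivalence (ULiftHomULiftCategory.equiv.{u, u} J)
  have : HasExactColimitsOfShape (ULiftHom.{u} (ULift.{u} J)) (Type u) := inferInstance
  exact HasExactColimitsOfShape.of_domain_equivalence _
    (ULiftHomULiftCategory.equiv.{u, u} J).symm

/-- Exactness can be tested after the inclusion into presheaves, which preserves finite limits and
filtered colimits; there it is the statement for sets, objectwise. -/
theorem hasExactColimitsOfShape_ind (J : Type) [SmallCategory J] [IsFiltered J]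
    [HasColimitsOfShape J (Ind C)] [HasFiniteLimits C] :
    HasExactColimitsOfShape J (Ind C) := by
  have := hasExactColimitsOfShape_types.{u} J
  exact HasExactColimitsOfShape.domain_of_functor J (Ind.inclusion C)

/-- The opposite of `colim` is a right adjoint of the constant diagram functor, so it is `lim` by
uniqueness of adjoints. Preservation of finite limits by `colim` dualizes. -/
theorem hasExactLimitsOfShape_op {C : Type*} [Category* C] (J : Type) [SmallCategory J]
    [HasColimitsOfShape Jᵒᵖ C] [HasExactColimitsOfShape Jᵒᵖ C] [HasLimitsOfShape J Cᵒᵖ] :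
    HasExactLimitsOfShape J Cᵒᵖ := by
  let e := Functor.leftOpRightOpEquiv J C
  have adj : (Functor.const Jᵒᵖ : C ⥤ _).op ⋙ e.functor ⊣
      e.inverse ⋙ (colim : (Jᵒᵖ ⥤ C) ⥤ C).op := (colimConstAdj.op).comp e.toAdjunction
  have i : (Functor.const Jᵒᵖ : C ⥤ _).op ⋙ e.functor ≅ Functor.const J :=
    NatIso.ofComponents
      (fun X => NatIso.ofComponents (fun j => Iso.refl _)
        fun _ => (Category.comp_id _).trans (Category.id_comp _).symm)
      fun _ => by
        ext
        exact (Category.comp_id _).trans (Category.id_comp _).symm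
  have i' : e.inverse ⋙ (colim : (Jᵒᵖ ⥤ C) ⥤ C).op ≅ lim :=
    (adj.ofNatIsoLeft i).rightAdjointUniq constLimAdj
  have : PreservesFiniteColimits (colim : (Jᵒᵖ ⥤ C) ⥤ C).op := preservesFiniteColimits_op _
  have : PreservesFiniteColimits e.inverse := inferInstance
  have := comp_preservesFiniteColimits e.inverse (colim : (Jᵒᵖ ⥤ C) ⥤ C).op
  exact ⟨preservesFiniteColimits_of_natIso i'⟩

end IndExact

variable (k : Type u) [Field k]

instance : HasExactColimitsOfShape ℤ (IndPro k) :=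
  hasExactColimitsOfShape_ind ℤ

instance : HasExactLimitsOfShape ℤ (Pro (FGModuleCat.{u} k)) := by
  have : HasColimitsOfShape ℤᵒᵖ (Ind (FGModuleCat.{u} k)ᵒᵖ) := hasColimitsOfShape_of_isFiltered ℤᵒᵖ
  have := hasExactColimitsOfShape_ind (C := (FGModuleCat.{u} k)ᵒᵖ) ℤᵒᵖ
  exact hasExactLimitsOfShape_op ℤ

/-! ### Exactness of iterated limits and colimits -/

section
universe v₁ v₂ v₃ u₁ u₂ u₃
variable {A : Type u₁} [Category.{v₁} A] {D : Type u₂} [Category.{v₂} D]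
  {D' : Type u₃} [Category.{v₃} D'] [HasLimitsOfShape ℤ D] [HasColimitsOfShape ℤ D']

/-- Evaluating `innerLim F` at `j`. -/
def innerLimCompEvaluation (F : A ⥤ D) (j : ℤ) :
    innerLim F ⋙ (evaluation ℤ D).obj j ≅
      (Functor.whiskeringRight Pairs A D).obj F ⋙
        (Functor.whiskeringLeft ℤ Pairs D).obj (clamp.obj j) ⋙ lim :=
  NatIso.ofComponents (fun _ => Iso.refl _)
    fun _ => (Category.comp_id _).trans (Category.id_comp _).symm

theorem preservesFiniteLimits_innerLim (F : A ⥤ D) [PreservesFiniteLimits F] [HasFiniteLimits A]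
    [HasFiniteLimits D] : PreservesFiniteLimits (innerLim F) where
  preservesFiniteLimits K _ _ := by
    refine preservesLimitsOfShape_of_evaluation _ K fun j => ?_
    have : PreservesLimitsOfShape K (lim : (ℤ ⥤ D) ⥤ D) := inferInstance
    exact preservesLimitsOfShape_of_natIso (innerLimCompEvaluation F j).symm

theorem preservesFiniteColimits_innerLim (F : A ⥤ D) [PreservesFiniteColimits F]
    [HasFiniteColimits A] [HasFiniteColimits D] [HasExactLimitsOfShape ℤ D] :
    PreservesFiniteColimits (innerLim F) where
  preservesFiniteColimits K _ _ := by
    refine preservesColimitsOfShape_of_evaluation _ K fun j => ?_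
    have : PreservesColimitsOfShape K (lim : (ℤ ⥤ D) ⥤ D) := inferInstance
    exact preservesColimitsOfShape_of_natIso (innerLimCompEvaluation F j).symm

/-- Limits commute with limits, so only the outer colimit needs an exactness hypothesis. In the dual
statement below, only the inner limit does. -/
theorem preservesFiniteLimits_colimLim (F : A ⥤ D) (G : D ⥤ D') [PreservesFiniteLimits F]
    [PreservesFiniteLimits G] [HasFiniteLimits A] [HasFiniteLimits D]
    [HasExactColimitsOfShape ℤ D'] : PreservesFiniteLimits (colimLim F G) := by
  have := preservesFiniteLimits_innerLim F
  have : PreservesFiniteLimits ((Functor.whiskeringRight ℤ D D').obj G) :=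
    ⟨fun K _ _ => inferInstance⟩
  have := comp_preservesFiniteLimits ((Functor.whiskeringRight ℤ D D').obj G) colim
  exact comp_preservesFiniteLimits (innerLim F) ((Functor.whiskeringRight ℤ D D').obj G ⋙ colim)

theorem preservesFiniteColimits_colimLim (F : A ⥤ D) (G : D ⥤ D') [PreservesFiniteColimits F]
    [PreservesFiniteColimits G] [HasFiniteColimits A] [HasFiniteColimits D]
    [HasExactLimitsOfShape ℤ D] : PreservesFiniteColimits (colimLim F G) := by
  have := preservesFiniteColimits_innerLim F
  have : PreservesFiniteColimits ((Functor.whiskeringRight ℤ D D').obj G) :=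
    ⟨fun K _ _ => inferInstance⟩
  have : PreservesFiniteColimits (colim : (ℤ ⥤ D') ⥤ D') := ⟨fun K _ _ => inferInstance⟩
  have := comp_preservesFiniteColimits ((Functor.whiskeringRight ℤ D D').obj G) colim
  exact comp_preservesFiniteColimits (innerLim F) ((Functor.whiskeringRight ℤ D D').obj G ⋙ colim)

end

/-- The functor `X ↦ "colim"_j "lim"_i X_{i,j}` on arbitrary diagrams. -/
abbrev indProLim : (Pairs ⥤ FGModuleCat.{u} k) ⥤ IndPro k :=
  colimLim (Ind.yoneda (C := (FGModuleCat.{u} k)ᵒᵖ)).rightOp Ind.yoneda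

instance : PreservesFiniteLimits (indProLim k) := by
  have : PreservesFiniteLimits (Ind.yoneda (C := (FGModuleCat.{u} k)ᵒᵖ)).rightOp :=
    preservesFiniteLimits_rightOp _
  have : HasFiniteLimits (Pro (FGModuleCat.{u} k)) := hasFiniteLimits_opposite
  have : PreservesFiniteLimits (Ind.yoneda (C := Pro (FGModuleCat.{u} k))) :=
    PreservesLimits.preservesFiniteLimits _
  exact preservesFiniteLimits_colimLim _ _

instance : PreservesFiniteColimits (indProLim k) := by
  have : PreservesFiniteLimits (Ind.yoneda (C := (FGModuleCat.{u} k)ᵒᵖ)) :=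
    PreservesLimits.preservesFiniteLimits _
  have : PreservesFiniteColimits (Ind.yoneda (C := (FGModuleCat.{u} k)ᵒᵖ)).rightOp :=
    preservesFiniteColimits_rightOp _
  exact preservesFiniteColimits_colimLim _ _

end

end TateSpaces

namespace TateSpaces

noncomputable section

/-! ### Points of ind-pro-objects and underlying sets of realizations -/

section
universe v₁ v₂ v₃ v₄ u₁ u₂ u₃ u₄
variable {A : Type u₁} [Category.{v₁} A] {D : Type u₂} [Category.{v₂} D]
  {D' : Type u₃} [Category.{v₃} D'] {E : Type u₄} [Category.{v₄} E]

/-- `innerLim` commutes with functors preserving limits. -/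
def innerLimComp [HasLimitsOfShape ℤ D] [HasLimitsOfShape ℤ E] (F : A ⥤ D) (K : D ⥤ E)
    [PreservesLimitsOfShape ℤ K] :
    innerLim F ⋙ (Functor.whiskeringRight ℤ D E).obj K ≅ innerLim (F ⋙ K) :=
  NatIso.ofComponents
    (fun X => Functor.isoWhiskerLeft (clamp ⋙ (Functor.whiskeringRight ℤ Pairs D).obj (X ⋙ F))
      (preservesLimitNatIso K))
    fun f => by
      ext j
      exact (preservesLimitNatIso K).hom.naturality
        (Functor.whiskerLeft (clamp.obj j) (Functor.whiskerRight f F))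

/-- `innerLim` depends on `F` only up to isomorphism. -/
def innerLimCongr [HasLimitsOfShape ℤ D] {F F' : A ⥤ D} (e : F ≅ F') : innerLim F ≅ innerLim F' :=
  NatIso.ofComponents
    (fun X => NatIso.ofComponents (fun j => lim.mapIso
      (Functor.isoWhiskerLeft (clamp.obj j) (Functor.isoWhiskerLeft X e)))
      fun f => by
        refine (lim.map_comp _ _).symm.trans (Eq.trans (congrArg _ ?_) (lim.map_comp _ _))
        ext i
        exact e.hom.naturality _)
    fun f => by
      ext j : 2
      refine (lim.map_comp _ _).symm.trans (Eq.trans (congrArg _ ?_) (lim.map_comp _ _))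
      ext i
      exact e.hom.naturality _

/-- `colimLim` commutes with functors preserving colimits. -/
def colimLimComp [HasLimitsOfShape ℤ D] [HasColimitsOfShape ℤ D'] [HasColimitsOfShape ℤ E]
    (F : A ⥤ D) (G : D ⥤ D') (K : D' ⥤ E) [PreservesColimitsOfShape ℤ K] :
    colimLim F G ⋙ K ≅ colimLim F (G ⋙ K) :=
  Functor.isoWhiskerLeft (innerLim F ⋙ (Functor.whiskeringRight ℤ D D').obj G)
      (preservesColimitNatIso K)

/-- A limit-preserving functor can be moved inside the limit. -/
def colimLimAssoc [HasLimitsOfShape ℤ D] [HasLimitsOfShape ℤ D'] [HasColimitsOfShape ℤ E]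
    (F : A ⥤ D) (G : D ⥤ D') (K : D' ⥤ E) [PreservesLimitsOfShape ℤ G] :
    colimLim F (G ⋙ K) ≅ colimLim (F ⋙ G) K :=
  Functor.isoWhiskerRight (innerLimComp F G) ((Functor.whiskeringRight ℤ D' E).obj K ⋙ colim)

/-- `colimLim F G` depends on `F` and `G` only up to isomorphism. -/
def colimLimCongr [HasLimitsOfShape ℤ D] [HasColimitsOfShape ℤ D']
    {F F' : A ⥤ D} {G G' : D ⥤ D'} (e : F ≅ F') (e' : G ≅ G') :
    colimLim F G ≅ colimLim F' G' :=
  Functor.isoWhiskerRight (innerLimCongr e) ((Functor.whiskeringRight ℤ D D').obj G ⋙ colim) ≪≫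
    Functor.isoWhiskerLeft (innerLim F')
      (Functor.isoWhiskerRight ((Functor.whiskeringRight ℤ D D').mapIso e') colim)

end

variable (k : Type u) [Field k]

/-- The line, as a pro-object. -/
abbrev proLine : Pro (FGModuleCat.{u} k) :=
  (Ind.yoneda (C := (FGModuleCat.{u} k)ᵒᵖ)).rightOp.obj (FGModuleCat.of k k)

/-- The underlying set of an ind-pro-object, the set of its maps from the line. -/
def IndPro.points : IndPro k ⥤ Type u :=
  Ind.inclusion (Pro (FGModuleCat.{u} k)) ⋙ (evaluation _ _).obj (Opposite.op (proLine k))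

instance : PreservesFiniteLimits (IndPro.points k) := by
  have : HasFiniteLimits (Pro (FGModuleCat.{u} k)) := hasFiniteLimits_opposite
  have h : PreservesFiniteLimits ((evaluation (Pro (FGModuleCat.{u} k))ᵒᵖ (Type u)).obj
    (Opposite.op (proLine k))) := ⟨fun _ _ _ => inferInstance⟩
  exact comp_preservesFiniteLimits _ _

instance : PreservesColimitsOfShape ℤ (IndPro.points k) := by
  have : PreservesColimitsOfShape ℤ ((evaluation (Pro (FGModuleCat.{u} k))ᵒᵖ (Type u)).obj
    (Opposite.op (proLine k))) := inferInstance
  exact comp_preservesColimitsOfShape _ _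

/-- The underlying set of a pro-object. -/
abbrev Pro.points : Pro (FGModuleCat.{u} k) ⥤ Type u := coyoneda.obj (Opposite.op (proLine k))

/-- The points of the ind-object of a pro-object. -/
def yonedaCompPoints : Ind.yoneda ⋙ IndPro.points k ≅ Pro.points k :=
  Functor.isoWhiskerRight Ind.yonedaCompInclusion
    ((evaluation _ _).obj (Opposite.op (proLine k)))

/-- The map from the line to `V` with value `v`. -/
def lineMap (V : FGModuleCat.{u} k) (v : V) : FGModuleCat.of k k ⟶ V :=
  FGModuleCat.ofHom (LinearMap.toSpanSingleton k V v)

theorem lineMap_apply_one (V : FGModuleCat.{u} k) (v : V) :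
    (lineMap k V v).hom.hom (1 : k) = v :=
  one_smul k v

theorem lineMap_bijective (V : FGModuleCat.{u} k) : Function.Bijective (lineMap k V) := by
  refine ⟨fun v w h => ?_, fun f => ⟨f.hom.hom (1 : k), ?_⟩⟩
  · rw [← lineMap_apply_one k V v, h, lineMap_apply_one]
  · ext
    exact lineMap_apply_one k V _

theorem lineMap_comp {V W : FGModuleCat.{u} k} (f : V ⟶ W) (v : V) :
    lineMap k V v ≫ f = lineMap k W (f.hom.hom v) := by
  apply FGModuleCat.hom_ext
  apply LinearMap.ext_ring
  exact (congrArg f.hom.hom (lineMap_apply_one k V v)).trans (lineMap_apply_one k W _).symm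

/-- The inclusion of finite-dimensional vector spaces into pro-objects. -/
abbrev proYoneda : FGModuleCat.{u} k ⥤ Pro (FGModuleCat.{u} k) :=
  (Ind.yoneda (C := (FGModuleCat.{u} k)ᵒᵖ)).rightOp

/-- The points of a finite-dimensional vector space, as a pro-object. -/
def proPoint (V : FGModuleCat.{u} k) (v : V) : proLine k ⟶ (proYoneda k).obj V :=
  (proYoneda k).map (lineMap k V v)

theorem proPoint_bijective (V : FGModuleCat.{u} k) : Function.Bijective (proPoint k V) :=
  Function.Bijective.comp (g := (proYoneda k).map)
    ⟨Functor.map_injective _, Functor.map_surjective _⟩ (lineMap_bijective k V)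

theorem proPoint_comp {V W : FGModuleCat.{u} k} (f : V ⟶ W) (v : V) :
    proPoint k V v ≫ (proYoneda k).map f = proPoint k W (f.hom.hom v) := by
  rw [proPoint, ← Functor.map_comp, lineMap_comp, proPoint]

/-- The points of a finite-dimensional vector space as a pro-object are its elements. -/
def proYonedaCompPoints : forget (FGModuleCat.{u} k) ≅ proYoneda k ⋙ Pro.points k :=
  NatIso.ofComponents (fun V => (Equiv.ofBijective _ (proPoint_bijective k V)).toIso)
    fun {V W} f => by
      ext v
      exact (proPoint_comp k f v).symm

theorem preservesColimitsOfShape_forget_moduleCat :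
    PreservesColimitsOfShape ℤ (forget (ModuleCat.{u} k)) := by
  have : IsFiltered (ULiftHom.{u} (ULift.{u} ℤ)) :=
    IsFiltered.of_equivalence (ULiftHomULiftCategory.equiv.{u, u} ℤ)
  exact preservesColimitsOfShape_of_equiv (ULiftHomULiftCategory.equiv.{u, u} ℤ).symm _

/-- The points of the ind-pro-object of a diagram. -/
def indProLimCompPoints :
    indProLim k ⋙ IndPro.points k ≅ colimLim (forget (FGModuleCat.{u} k)) (𝟭 (Type u)) :=
  -- Taking points commutes with the outer colimit, and, being corepresentable on pro-objects, with
  -- the inner limit; what remains is the set of points of each finite-dimensional space.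
  colimLimComp (proYoneda k) Ind.yoneda (IndPro.points k) ≪≫
    colimLimCongr (Iso.refl (proYoneda k))
      (yonedaCompPoints k ≪≫ (Functor.rightUnitor (Pro.points k)).symm) ≪≫
    colimLimAssoc (proYoneda k) (Pro.points k) (𝟭 (Type u)) ≪≫
    colimLimCongr (proYonedaCompPoints k).symm (Iso.refl (𝟭 (Type u)))

theorem Q_comp_toIndPro : (shiftMaps k).Q ⋙ toIndPro k = (IsAdmissible k).ι ⋙ indProLim k :=
  Localization.Construction.fac _ _

variable [TopologicalSpace k]

/-- The underlying set of a topological vector space. -/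
abbrev forgetTop : TopModuleCat.{u} k ⥤ Type u :=
  forget₂ (TopModuleCat.{u} k) (ModuleCat.{u} k) ⋙ forget (ModuleCat.{u} k)

instance : PreservesLimitsOfShape ℤ (forgetTop k) := inferInstance

instance : PreservesColimitsOfShape ℤ (forgetTop k) := by
  have := preservesColimitsOfShape_forget_moduleCat k
  exact comp_preservesColimitsOfShape _ _

variable [DiscreteTopology k]

/-- The underlying set of the realization of a diagram. -/
def colimLimDiscreteCompForget :
    colimLim (discrete k) (𝟭 (TopModuleCat.{u} k)) ⋙ forgetTop k ≅
      colimLim (forget (FGModuleCat.{u} k)) (𝟭 (Type u)) :=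
  colimLimComp (discrete k) (𝟭 _) (forgetTop k) ≪≫
    colimLimCongr (Iso.refl (discrete k)) (Functor.leftUnitor (forgetTop k) ≪≫
      (Functor.rightUnitor (forgetTop k)).symm) ≪≫
    colimLimAssoc (discrete k) (forgetTop k) (𝟭 (Type u)) ≪≫
    colimLimCongr (Iso.refl _ : discrete k ⋙ forgetTop k ≅ forget (FGModuleCat.{u} k))
      (Iso.refl (𝟭 (Type u)))

theorem Q_comp_realization :
    (shiftMaps k).Q ⋙ realization k = (IsAdmissible k).ι ⋙ colimLim (discrete k) (𝟭 _) :=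
  Localization.Construction.fac _ _

/-- The points of the ind-pro-object of a Tate space are the points of its realization. -/
def toIndProCompPoints : toIndPro k ⋙ IndPro.points k ≅ realization k ⋙ forgetTop k :=
  let L₁ := (IsAdmissible k).ι ⋙ indProLim k ⋙ IndPro.points k
  let L₂ := (IsAdmissible k).ι ⋙ colimLim (discrete k) (𝟭 _) ⋙ forgetTop k
  have : Localization.Lifting (shiftMaps k).Q (shiftMaps k) L₁
      (toIndPro k ⋙ IndPro.points k) :=
    ⟨Functor.isoWhiskerRight (eqToIso (Q_comp_toIndPro k)) (IndPro.points k)⟩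
  have : Localization.Lifting (shiftMaps k).Q (shiftMaps k) L₂
      (realization k ⋙ forgetTop k) :=
    ⟨Functor.isoWhiskerRight (eqToIso (Q_comp_realization k)) (forgetTop k)⟩
  Localization.liftNatIso (shiftMaps k).Q (shiftMaps k) L₁ L₂ _ _
    (Functor.isoWhiskerLeft (IsAdmissible k).ι
      (indProLimCompPoints k ≪≫ (colimLimDiscreteCompForget k).symm))

end

end TateSpaces

namespace TateSpaces

noncomputable section

/-! ### Filtered models of diagrams -/

variable {k : Type u} [Field k]

namespace AdmDiagram

/-- The transition map `X_{i,j} → X_{i',j'}`. -/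
def tr (X : AdmDiagram k) {i j i' j' : ℤ} (h : i ≤ j) (h' : i' ≤ j') (a : i ≤ i') (b : j ≤ j') :
    X.obj.obj (pair i j h) →ₗ[k] X.obj.obj (pair i' j' h') :=
  (X.obj.map (homOfLE ⟨a, b⟩)).hom.hom

theorem tr_tr (X : AdmDiagram k) {i j i' j' i'' j'' : ℤ} (h : i ≤ j) (h' : i' ≤ j')
    (h'' : i'' ≤ j'') (a : i ≤ i') (b : j ≤ j') (a' : i' ≤ i'') (b' : j' ≤ j'')
    (x : X.obj.obj (pair i j h)) :
    X.tr h' h'' a' b' (X.tr h h' a b x) = X.tr h h'' (a.trans a') (b.trans b') x := by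
  have : X.obj.map (homOfLE (⟨a, b⟩ : pair i j h ≤ pair i' j' h')) ≫
      X.obj.map (homOfLE (⟨a', b'⟩ : pair i' j' h' ≤ pair i'' j'' h'')) =
      X.obj.map (homOfLE (⟨a.trans a', b.trans b'⟩ : pair i j h ≤ pair i'' j'' h'')) := by
    rw [← Functor.map_comp]; rfl
  exact congrArg (fun f : X.obj.obj (pair i j h) ⟶ X.obj.obj (pair i'' j'' h'') => f.hom.hom x) this

theorem tr_self (X : AdmDiagram k) {i j : ℤ} (h : i ≤ j) (x : X.obj.obj (pair i j h)) :
    X.tr h h le_rfl le_rfl x = x := by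
  have : X.obj.map (homOfLE (le_refl (pair i j h))) = 𝟙 _ := X.obj.map_id _
  exact congrArg (fun f : X.obj.obj (pair i j h) ⟶ X.obj.obj (pair i j h) => f.hom.hom x) this

theorem tr_injective (X : AdmDiagram k) {i j l : ℤ} (h : i ≤ j) (h' : j ≤ l) :
    Function.Injective (X.tr h (h.trans h') le_rfl h') :=
  (X.property i j l h h').1

theorem tr_surjective (X : AdmDiagram k) {i j l : ℤ} (h : i ≤ j) (h' : j ≤ l) :
    Function.Surjective (X.tr (h.trans h') h' h le_rfl) :=
  (X.property i j l h h').2.2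

theorem tr_exact (X : AdmDiagram k) {i j l : ℤ} (h : i ≤ j) (h' : j ≤ l) :
    Function.Exact (X.tr h (h.trans h') le_rfl h') (X.tr (h.trans h') h' h le_rfl) :=
  (X.property i j l h h').2.1

/-- A component of a morphism of diagrams. -/
def app {X Y : AdmDiagram k} (g : X ⟶ Y) {i j : ℤ} (h : i ≤ j) :
    X.obj.obj (pair i j h) →ₗ[k] Y.obj.obj (pair i j h) :=
  (g.hom.app (pair i j h)).hom.hom

theorem app_tr {X Y : AdmDiagram k} (g : X ⟶ Y) {i j i' j' : ℤ} (h : i ≤ j) (h' : i' ≤ j')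
    (a : i ≤ i') (b : j ≤ j') (x : X.obj.obj (pair i j h)) :
    app g h' (X.tr h h' a b x) = Y.tr h h' a b (app g h x) := by
  have := g.hom.naturality (homOfLE (⟨a, b⟩ : pair i j h ≤ pair i' j' h'))
  exact congrArg (fun f : X.obj.obj (pair i j h) ⟶ Y.obj.obj (pair i' j' h') => f.hom.hom x) this

theorem hom_ext {X Y : AdmDiagram k} {g g' : X ⟶ Y}
    (H : ∀ (i j : ℤ) (h : i ≤ j) x, app g h x = app g' h x) : g = g' := by
  apply ObjectProperty.hom_ext
  ext p x
  exact H p.1.1 p.1.2 p.2 x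

/-- Constructor for morphisms of diagrams. -/
def homMk {X Y : AdmDiagram k}
    (f : ∀ (i j : ℤ) (h : i ≤ j), X.obj.obj (pair i j h) →ₗ[k] Y.obj.obj (pair i j h))
    (hf : ∀ (i j i' j' : ℤ) (h : i ≤ j) (h' : i' ≤ j') (a : i ≤ i') (b : j ≤ j')
      (x : X.obj.obj (pair i j h)), f i' j' h' (X.tr h h' a b x) = Y.tr h h' a b (f i j h x)) :
    X ⟶ Y :=
  ObjectProperty.homMk
    { app := fun p => FGModuleCat.ofHom (f p.1.1 p.1.2 p.2)
      naturality := fun p p' r => by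
        apply FGModuleCat.hom_ext
        ext x
        exact hf p.1.1 p.1.2 p'.1.1 p'.1.2 p.2 p'.2 (leOfHom r).1 (leOfHom r).2 x }

@[simp]
theorem app_comp {X Y Z : AdmDiagram k} (f : X ⟶ Y) (g : Y ⟶ Z) {i j : ℤ} (h : i ≤ j)
    (x : X.obj.obj (pair i j h)) : app (f ≫ g) h x = app g h (app f h x) := rfl

end AdmDiagram

variable [TopologicalSpace k]

/-- A realization of the diagram `X` by a filtration of `V` by open subspaces `F j`, with
`F j / F i ≅ X_{i,j}`. -/
structure Model (X : AdmDiagram k) (V : TopModuleCat.{u} k) where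
  F : ℤ → Submodule k V
  q : ∀ {i j : ℤ} (h : i ≤ j), F j →ₗ[k] X.obj.obj (pair i j h)
  mono : Monotone F
  isOpen : ∀ i, IsOpen (F i : Set V)
  basis : ∀ N ∈ nhds (0 : V), ∃ i, (F i : Set V) ⊆ N
  exhaust : ∀ v, ∃ j, v ∈ F j
  separated : ∀ v, (∀ i, v ∈ F i) → v = 0
  q_surjective : ∀ {i j : ℤ} (h : i ≤ j), Function.Surjective (q h)
  q_eq_zero : ∀ {i j : ℤ} (h : i ≤ j) (v : F j), q h v = 0 ↔ (v : V) ∈ F i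
  q_tr : ∀ {i j i' j' : ℤ} (h : i ≤ j) (h' : i' ≤ j') (a : i ≤ i') (b : j ≤ j') (v : V)
    (hv : v ∈ F j), q h' ⟨v, mono b hv⟩ = X.tr h h' a b (q h ⟨v, hv⟩)
  complete : ∀ (j : ℤ) (x : ∀ i (h : i ≤ j), X.obj.obj (pair i j h)),
    (∀ i i' (a : i ≤ i') (h : i' ≤ j), X.tr (a.trans h) h a le_rfl (x i (a.trans h)) = x i' h) →
      ∃ v : F j, ∀ i (h : i ≤ j), q h v = x i h

/-- A continuous linear map compatible with a morphism of diagrams. -/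
structure Compat {X Y : AdmDiagram k} {V W : TopModuleCat.{u} k} (M : Model X V) (N : Model Y W)
    (g : X ⟶ Y) (f : V ⟶ W) : Prop where
  map : ∀ j v, v ∈ M.F j → f.hom v ∈ N.F j
  q : ∀ {i j : ℤ} (h : i ≤ j) (v : V) (hv : v ∈ M.F j),
    N.q h ⟨f.hom v, map j v hv⟩ = AdmDiagram.app g h (M.q h ⟨v, hv⟩)

section

variable {X Y Z : AdmDiagram k} {V W U : TopModuleCat.{u} k} {M : Model X V} {N : Model Y W}
  {P : Model Z U}

theorem Compat.id (M : Model X V) : Compat M M (𝟙 X) (𝟙 V) where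
  map _ _ h := h
  q _ _ _ := rfl

theorem Compat.comp {g : X ⟶ Y} {g' : Y ⟶ Z} {f : V ⟶ W} {f' : W ⟶ U} (c : Compat M N g f)
    (c' : Compat N P g' f') : Compat M P (g ≫ g') (f ≫ f') where
  map j v h := c'.map j _ (c.map j v h)
  q h v hv := by
    rw [AdmDiagram.app_comp, ← c.q h v hv, ← c'.q h]
    rfl

/-- The diagram morphism determines `f v` modulo every step of the filtration of `W`, which is
separated. -/
theorem Compat.hom_unique {g : X ⟶ Y} {f f' : V ⟶ W} (c : Compat M N g f) (c' : Compat M N g f') :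
    f = f' := by
  apply ConcreteCategory.hom_ext
  intro v
  obtain ⟨j, hv⟩ := M.exhaust v
  rw [← sub_eq_zero]
  have h1 := c.map j v hv
  have h2 := c'.map j v hv
  refine N.separated _ fun i => ?_
  rcases le_total i j with h | h
  · refine (N.q_eq_zero h (⟨_, h1⟩ - ⟨_, h2⟩)).1 ?_
    rw [map_sub, c.q h v hv, c'.q h v hv, sub_self]
  · exact N.mono h ((N.F j).sub_mem h1 h2)

theorem Compat.diagram_hom_unique {g g' : X ⟶ Y} {f : V ⟶ W} (c : Compat M N g f)
    (c' : Compat M N g' f) : g = g' := by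
  apply AdmDiagram.hom_ext
  intro i j h x
  obtain ⟨⟨v, hv⟩, rfl⟩ := M.q_surjective h x
  rw [← c.q, ← c'.q]

/-- A filtered map induces a morphism of diagrams. -/
theorem exists_diagram_hom (M : Model X V) (N : Model Y W) (f : V ⟶ W)
    (hf : ∀ j v, v ∈ M.F j → f.hom v ∈ N.F j) : ∃ g : X ⟶ Y, Compat M N g f := by
  have key : ∀ (i j : ℤ) (h : i ≤ j), ∃ g : X.obj.obj (pair i j h) →ₗ[k] Y.obj.obj (pair i j h),
      ∀ v (hv : v ∈ M.F j), g (M.q h ⟨v, hv⟩) = N.q h ⟨f.hom v, hf j v hv⟩ := by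
    intro i j h
    let r : M.F j →ₗ[k] Y.obj.obj (pair i j h) :=
      N.q h ∘ₗ f.hom.toLinearMap.restrict (hf j)
    have hr : LinearMap.ker (M.q h) ≤ LinearMap.ker r := by
      intro v hv
      exact (N.q_eq_zero h _).2 (hf i _ ((M.q_eq_zero h v).1 hv))
    refine ⟨(LinearMap.ker (M.q h)).liftQ r hr ∘ₗ
      ((M.q h).quotKerEquivOfSurjective (M.q_surjective h)).symm.toLinearMap, fun v hv => ?_⟩
    have : ((M.q h).quotKerEquivOfSurjective (M.q_surjective h)).symm (M.q h ⟨v, hv⟩) =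
        Submodule.Quotient.mk ⟨v, hv⟩ := by
      rw [LinearEquiv.symm_apply_eq]
      rfl
    rw [LinearMap.comp_apply, LinearEquiv.coe_coe, this]
    rfl
  choose g hg using key
  refine ⟨AdmDiagram.homMk g fun i j i' j' h h' a b x => ?_, hf, fun h v hv => (hg _ _ h v hv).symm⟩
  obtain ⟨⟨v, hv⟩, rfl⟩ := M.q_surjective h x
  rw [hg, ← M.q_tr h h' a b v hv, hg, ← N.q_tr h h' a b]

theorem continuous_of_filtered (M : Model X V) (N : Model Y W) (f : V →ₗ[k] W)
    (hf : ∀ j v, v ∈ M.F j → f v ∈ N.F j) : Continuous f := by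
  apply continuous_of_continuousAt_zero f.toAddMonoidHom
  intro S hS
  rw [LinearMap.toAddMonoidHom_coe, map_zero] at hS
  obtain ⟨i, hi⟩ := N.basis S hS
  rw [Filter.mem_map]
  exact Filter.mem_of_superset ((M.isOpen i).mem_nhds (M.F i).zero_mem) fun v hv => hi (hf i v hv)

/-- A morphism of diagrams induces a filtered map. -/
theorem exists_hom (M : Model X V) (N : Model Y W) (g : X ⟶ Y) :
    ∃ f : V ⟶ W, Compat M N g f := by
  -- `S v w` says that `w` has the classes prescribed by `g` at every level where `v` is defined.
  -- Completeness gives existence of `w`, separatedness gives uniqueness, and uniqueness gives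
  -- linearity.
  let S : V → W → Prop := fun v w => ∀ {i j : ℤ} (h : i ≤ j) (hv : v ∈ M.F j),
    ∃ hw : w ∈ N.F j, N.q h ⟨w, hw⟩ = AdmDiagram.app g h (M.q h ⟨v, hv⟩)
  have ex : ∀ v, ∃ w, S v w := by
    intro v
    obtain ⟨j₀, hv₀⟩ := M.exhaust v
    obtain ⟨⟨w, hw₀⟩, hw⟩ := N.complete j₀ (fun i h => AdmDiagram.app g h (M.q h ⟨v, hv₀⟩))
      fun i i' a h => by
        rw [← AdmDiagram.app_tr, ← M.q_tr (a.trans h) h a le_rfl v hv₀]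
    refine ⟨w, fun {i j} h hv => ?_⟩
    rcases le_total j₀ j with hj | hj
    · refine ⟨N.mono hj hw₀, ?_⟩
      rcases le_total i j₀ with hi | hi
      · rw [N.q_tr hi h le_rfl hj w hw₀, M.q_tr hi h le_rfl hj v hv₀, AdmDiagram.app_tr, hw]
      · rw [(N.q_eq_zero h _).2 (N.mono hi hw₀), (M.q_eq_zero h _).2 (M.mono hi hv₀), map_zero]
    · have hwj : w ∈ N.F j := by
        refine (N.q_eq_zero hj ⟨w, hw₀⟩).1 ?_
        rw [hw, (M.q_eq_zero hj _).2 hv, map_zero]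
      refine ⟨hwj, Y.tr_injective h hj ?_⟩
      rw [← N.q_tr h (h.trans hj) le_rfl hj w hwj, ← AdmDiagram.app_tr,
        ← M.q_tr h (h.trans hj) le_rfl hj v hv, hw]
  have uniq : ∀ v w w', S v w → S v w' → w = w' := by
    intro v w w' hw hw'
    obtain ⟨j, hv⟩ := M.exhaust v
    rw [← sub_eq_zero]
    refine N.separated _ fun i => ?_
    obtain ⟨h1, -⟩ := hw le_rfl hv
    obtain ⟨h2, -⟩ := hw' le_rfl hv
    rcases le_total i j with h | h
    · refine (N.q_eq_zero h (⟨_, h1⟩ - ⟨_, h2⟩)).1 ?_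
      rw [map_sub, (hw h hv).2, (hw' h hv).2, sub_self]
    · exact N.mono h ((N.F j).sub_mem h1 h2)
  choose f hf using ex
  have fadd : ∀ v v', f (v + v') = f v + f v' := by
    intro v v'
    obtain ⟨j₁, h₁⟩ := M.exhaust v
    obtain ⟨j₂, h₂⟩ := M.exhaust v'
    have hv := M.mono (le_max_left j₁ j₂) h₁
    have hv' := M.mono (le_max_right j₁ j₂) h₂
    rw [← sub_eq_zero]
    refine N.separated _ fun i => ?_
    obtain ⟨e1, -⟩ := hf v le_rfl hv
    obtain ⟨e2, -⟩ := hf v' le_rfl hv'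
    obtain ⟨e3, -⟩ := hf _ le_rfl ((M.F _).add_mem hv hv')
    rcases le_total i (max j₁ j₂) with h | h
    · refine (N.q_eq_zero h (⟨_, e3⟩ - (⟨_, e1⟩ + ⟨_, e2⟩))).1 ?_
      rw [map_sub, map_add, (hf _ h ((M.F _).add_mem hv hv')).2, (hf v h hv).2, (hf v' h hv').2,
        ← map_add, ← map_add, AddMemClass.mk_add_mk, sub_self]
    · exact N.mono h ((N.F _).sub_mem e3 ((N.F _).add_mem e1 e2))
  have fsmul : ∀ (c : k) v, f (c • v) = c • f v := by
    intro c v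
    refine uniq (c • v) _ _ (hf (c • v)) fun {i j} h hcv => ?_
    -- Membership of `c • v` in `M.F j` gives that of `v` only for invertible `c`.
    by_cases hc : c = 0
    · subst hc
      refine ⟨by simp, ?_⟩
      rw [(N.q_eq_zero h _).2 (by simp), (M.q_eq_zero h _).2 (by simp), map_zero]
    · have hv : v ∈ M.F j := by
        have := (M.F j).smul_mem c⁻¹ hcv
        rwa [smul_smul, inv_mul_cancel₀ hc, one_smul] at this
      obtain ⟨h1, h2⟩ := hf v h hv
      refine ⟨(N.F j).smul_mem c h1, ?_⟩
      have e1 := (N.q h).map_smul c ⟨_, h1⟩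
      have e2 := (M.q h).map_smul c ⟨_, hv⟩
      rw [h2, ← map_smul, ← e2] at e1
      exact e1
  let f' : V →ₗ[k] W := ⟨⟨f, fadd⟩, fsmul⟩
  have hmap : ∀ j v, v ∈ M.F j → f' v ∈ N.F j := fun j v hv => (hf v le_rfl hv).1
  exact ⟨ConcreteCategory.ofHom ⟨f', continuous_of_filtered M N f' hmap⟩, hmap,
    fun h v hv => (hf v h hv).2⟩

/-- Two spaces modelling the same diagram are isomorphic. -/
theorem exists_iso (M : Model X V) (N : Model X W) : ∃ e : V ≅ W, Compat M N (𝟙 X) e.hom := by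
  obtain ⟨f, hf⟩ := exists_hom M N (𝟙 X)
  obtain ⟨f', hf'⟩ := exists_hom N M (𝟙 X)
  exact ⟨⟨f, f', (hf.comp hf').hom_unique (Compat.id M), (hf'.comp hf).hom_unique (Compat.id N)⟩, hf⟩

end

/-- The model of the reindexed diagram on the same space. -/
def Model.reindex {X : AdmDiagram k} {V : TopModuleCat.{u} k} (M : Model X V) (φ : Bicofinal) :
    Model (X.reindex φ) V where
  F j := M.F (φ.toFun j)
  q h := M.q (φ.mono h)
  mono := M.mono.comp φ.mono
  isOpen i := M.isOpen _
  basis N hN := by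
    obtain ⟨i, hi⟩ := M.basis N hN
    obtain ⟨j, hj⟩ := (φ.tendsto_atBot.eventually_le_atBot i).exists
    exact ⟨j, fun v hv => hi (M.mono hj hv)⟩
  exhaust v := by
    obtain ⟨i, hi⟩ := M.exhaust v
    obtain ⟨j, hj⟩ := (φ.tendsto_atTop.eventually_ge_atTop i).exists
    exact ⟨j, M.mono hj hi⟩
  separated v hv := by
    refine M.separated v fun i => ?_
    obtain ⟨j, hj⟩ := (φ.tendsto_atBot.eventually_le_atBot i).exists
    exact M.mono hj (hv j)
  q_surjective h := M.q_surjective _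
  q_eq_zero h := M.q_eq_zero _
  q_tr h h' a b := M.q_tr (φ.mono h) (φ.mono h') (φ.mono a) (φ.mono b)
  complete j x hx := by
    -- The system is given only at indices in the image of `φ`. At any other `i` its value is pushed
    -- forward from an index `φ (b i)` below `i`; compatibility makes the choice of `b i`
    -- irrelevant.
    have hb : ∀ i, ∃ i', φ.toFun i' ≤ i ∧ i' ≤ j := fun i =>
      ((φ.tendsto_atBot.eventually_le_atBot i).and (Filter.eventually_le_atBot j)).exists
    choose b hb hb' using hb
    obtain ⟨v, hv⟩ := M.complete (φ.toFun j)
      (fun i h => X.tr (φ.mono (hb' i)) h (hb i) le_rfl (x (b i) (hb' i))) (by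
        intro i i' a h
        refine (X.tr_tr (φ.mono (hb' i)) (a.trans h) h (hb i) le_rfl a le_rfl
          (x (b i) (hb' i))).trans ?_
        rcases le_total (b i) (b i') with hbb | hbb
        · rw [← hx _ _ hbb (hb' i')]
          exact (X.tr_tr (φ.mono (hb' i)) (φ.mono (hb' i')) h (φ.mono hbb) le_rfl (hb i') le_rfl
            (x (b i) (hb' i))).symm
        · rw [← hx _ _ hbb (hb' i)]
          exact X.tr_tr (φ.mono (hb' i')) (φ.mono (hb' i)) h (φ.mono hbb) le_rfl
            ((hb i).trans a) le_rfl (x (b i') (hb' i')))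
    refine ⟨v, fun i h => ?_⟩
    refine (hv _ (φ.mono h)).trans ?_
    rcases le_total (b (φ.toFun i)) i with hbb | hbb
    · exact hx _ _ hbb h
    · rw [← hx _ _ hbb (hb' _)]
      refine (X.tr_tr (φ.mono h) (φ.mono (hb' _)) (φ.mono h) (φ.mono hbb) le_rfl (hb _) le_rfl
            (x i h)).trans (X.tr_self _ _)

/-- The identity reindexing. -/
def Bicofinal.refl : Bicofinal := ⟨_root_.id, monotone_id, Filter.tendsto_id, Filter.tendsto_id⟩

/-- The morphism with components `X_{i,j} ⟶ X_{ψ i, ψ j}`. -/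
def AdmDiagram.toReindex (X : AdmDiagram k) (ψ : Bicofinal) (h : ∀ i, i ≤ ψ.toFun i) :
    X ⟶ X.reindex ψ :=
  X.shift (φ₀ := Bicofinal.refl) h

/-- The maps used as denominators are realized by the identity: they only renumber the filtration.
-/
theorem Model.compat_toReindex {X : AdmDiagram k} {V : TopModuleCat.{u} k} (M : Model X V)
    (ψ : Bicofinal) (h : ∀ i, i ≤ ψ.toFun i) :
    Compat M (M.reindex ψ) (X.toReindex ψ h) (𝟙 V) where
  map j _ hv := M.mono (h j) hv
  q h' v hv := M.q_tr h' (ψ.mono h') (h _) (h _) v hv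

end

end TateSpaces

namespace TateSpaces

noncomputable section

variable {k : Type u} [Field k]

/-! ### Lifting elements of a diagram to compatible systems -/

namespace AdmDiagram

/-- Exactness for `i = j = l` concerns two identity maps, so the kernel `0` of the second is
everything. -/
theorem subsingleton_diag (X : AdmDiagram k) {j : ℤ} (x : X.obj.obj (pair j j le_rfl)) : x = 0 := by
  have h := (X.tr_exact (le_refl j) (le_refl j) x).2 ⟨x, X.tr_self _ _⟩
  rwa [X.tr_self] at h

/-- Surjectivity of the transition maps allows lifting one index at a time, as for any countable
inverse system with surjective maps. -/
theorem exists_lift (X : AdmDiagram k) {i j : ℤ} (h : i ≤ j) (x : X.obj.obj (pair i j h)) :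
    ∃ y : ∀ i' (h' : i' ≤ j), X.obj.obj (pair i' j h'), y i h = x ∧
      ∀ i' i'' (a : i' ≤ i'') (h' : i'' ≤ j),
        X.tr (a.trans h') h' a le_rfl (y i' (a.trans h')) = y i'' h' := by
  have step : ∀ (n : ℕ) (y : X.obj.obj (pair (i - n) j (by omega))),
      ∃ y' : X.obj.obj (pair (i - (n + 1 : ℕ)) j (by omega)),
        X.tr (by omega) (by omega) (by omega) le_rfl y' = y := fun n y =>
    X.tr_surjective (i := i - (n + 1 : ℕ)) (j := i - n) (l := j) (by omega) (by omega) y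
  choose s hs using step
  -- `z n` is the lift to index `i - n`. The value at an arbitrary `i'` is pushed forward from `z (i
  -- - i').toNat`; for `i' ≥ i` the truncation makes this `z 0`.
  let z : ∀ n : ℕ, X.obj.obj (pair (i - n) j (by omega)) := fun n =>
    Nat.rec (X.tr h (by simpa using h) (by simp) le_rfl x) (fun n y => s n y) n
  have hz : ∀ n m : ℕ, ∀ (a : n ≤ m),
      X.tr (i := i - m) (i' := i - n) (by omega) (by omega) (by omega) le_rfl (z m) = z n := by
    intro n m a
    induction m, a using Nat.le_induction with
    | base => exact X.tr_self _ _
    | succ m a ih =>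
      rw [← ih, ← hs m (z m), X.tr_tr]
  have hc : ∀ i' i'' (a : i' ≤ i'') (h' : i'' ≤ j),
        X.tr (a.trans h') h' a le_rfl
          (X.tr (i := i - (i - i').toNat) (j := j) (by omega) (a.trans h') (by omega) le_rfl
            (z (i - i').toNat)) =
          X.tr (i := i - (i - i'').toNat) (j := j) (by omega) h' (by omega) le_rfl
            (z (i - i'').toNat) := by
    intro i' i'' a h'
    rw [← hz (i - i'').toNat (i - i').toNat (by omega), X.tr_tr, X.tr_tr]
  refine ⟨fun i' h' => X.tr (i := i - (i - i').toNat) (j := j) (by omega) h' (by omega) le_rfl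
    (z (i - i').toNat), ?_, hc⟩
  have h0 : z 0 = X.tr h (by omega) (by omega) le_rfl x := rfl
  have h1 := hz 0 (i - i).toNat (by omega)
  change X.tr _ _ _ _ _ = x
  have h2 := X.tr_tr (i := i - (i - i).toNat) (i' := i - (0 : ℕ)) (i'' := i) (j := j) (by omega)
    (by omega) h (by omega) le_rfl (by omega) le_rfl (z (i - i).toNat)
  rw [← h2, h1, h0, X.tr_tr, X.tr_self]

end AdmDiagram

/-! ### Elements of limits and colimits of topological vector spaces -/

theorem continuous_of_ker {V W : Type*} [AddCommGroup V] [Module k V] [TopologicalSpace V]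
    [IsTopologicalAddGroup V] [AddCommGroup W] [Module k W] [TopologicalSpace W]
    [IsTopologicalAddGroup W] (f : V →ₗ[k] W) (U : Submodule k V) (hU : IsOpen (U : Set V))
    (h : U ≤ LinearMap.ker f) : Continuous f := by
  apply continuous_of_continuousAt_zero f.toAddMonoidHom
  intro S hS
  rw [LinearMap.toAddMonoidHom_coe, map_zero] at hS
  rw [Filter.mem_map]
  refine Filter.mem_of_superset (hU.mem_nhds U.zero_mem) fun v hv => ?_
  have : f v = 0 := h hv
  exact (congrArg (· ∈ S) this).mpr (mem_of_mem_nhds hS)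

variable [TopologicalSpace k]

theorem topLimit_ext (F : ℤ ⥤ TopModuleCat.{u} k) {x y : (limit F : TopModuleCat.{u} k)}
    (h : ∀ i, (limit.π F i).hom x = (limit.π F i).hom y) : x = y :=
  (Types.isLimitEquivSections (isLimitOfPreserves (forgetTop k) (limit.isLimit F))).injective
    (Subtype.ext (funext h))

theorem topLimit_exists (F : ℤ ⥤ TopModuleCat.{u} k) (x : ∀ i, F.obj i)
    (h : ∀ i i' (a : i ⟶ i'), (F.map a).hom (x i) = x i') :
    ∃ l : (limit F : TopModuleCat.{u} k), ∀ i, (limit.π F i).hom l = x i :=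
  let e := Types.isLimitEquivSections (isLimitOfPreserves (forgetTop k) (limit.isLimit F))
  ⟨e.symm ⟨x, fun a => h _ _ a⟩, fun i =>
    congrFun (congrArg Subtype.val (e.apply_symm_apply ⟨x, fun a => h _ _ a⟩)) i⟩

theorem topLimit_nhds (F : ℤ ⥤ TopModuleCat.{u} k) :
    nhds (0 : (limit F : TopModuleCat.{u} k)) =
      ⨅ i, Filter.comap (limit.π F i).hom (nhds (0 : F.obj i)) := by
  have h := TopCat.induced_of_isLimit _
    (isLimitOfPreserves (forget₂ (TopModuleCat.{u} k) TopCat) (limit.isLimit F))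
  have h' : (limit F : TopModuleCat.{u} k).topologicalSpace =
    ⨅ i, (F.obj i).topologicalSpace.induced (limit.π F i).hom := h
  have e : nhds (0 : (limit F : TopModuleCat.{u} k)) =
    @nhds _ (⨅ i, (F.obj i).topologicalSpace.induced (limit.π F i).hom) 0 := by rw [← h']
  rw [e, nhds_iInf]
  refine iInf_congr fun i => ?_
  rw [nhds_induced, map_zero]

theorem topColimit_exists (F : ℤ ⥤ TopModuleCat.{u} k) (x : (colimit F : TopModuleCat.{u} k)) :
    ∃ (j : ℤ) (y : F.obj j), (colimit.ι F j).hom y = x :=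
  Types.jointly_surjective_of_isColimit
    (isColimitOfPreserves (forgetTop k) (colimit.isColimit F)) x

theorem topColimit_injective (F : ℤ ⥤ TopModuleCat.{u} k)
    (h : ∀ j j' (a : j ⟶ j'), Function.Injective (F.map a).hom) (j : ℤ) :
    Function.Injective (colimit.ι F j).hom := by
  intro x y hxy
  obtain ⟨l, f, e⟩ := (Types.FilteredColimit.isColimit_eq_iff'
    (isColimitOfPreserves (forgetTop k) (colimit.isColimit F)) x y).1 hxy
  exact h _ _ f e

variable [DiscreteTopology k]

/-! ### The canonical model -/

instance discreteTopology_discrete (V : FGModuleCat.{u} k) :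
    DiscreteTopology ((discrete k).obj V) := ⟨rfl⟩

namespace AdmDiagram

/-- The space `lim_i X_{i,j}`. -/
abbrev level (X : AdmDiagram k) (j : ℤ) : TopModuleCat.{u} k :=
  ((innerLim (discrete k)).obj X.obj).obj j

/-- The realization of a diagram. -/
abbrev real (X : AdmDiagram k) : TopModuleCat.{u} k :=
  (colimLim (discrete k) (𝟭 _)).obj X.obj

/-- The projection from the limit, before clamping. -/
def rawProj (X : AdmDiagram k) (j i : ℤ) :
    X.level j →ₗ[k] X.obj.obj (pair (min i j) j (min_le_right i j)) :=
  (limit.π (clamp.obj j ⋙ X.obj ⋙ discrete k) i).hom.toLinearMap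

/-- The projection from the limit to `X_{i,j}`. -/
def proj (X : AdmDiagram k) {i j : ℤ} (h : i ≤ j) : X.level j →ₗ[k] X.obj.obj (pair i j h) :=
  X.tr (min_le_right i j) h (min_le_left i j) le_rfl ∘ₗ X.rawProj j i

/-- The inclusion of `lim_i X_{i,j}` in `lim_i X_{i,j'}`. -/
def incl (X : AdmDiagram k) {j j' : ℤ} (h : j ≤ j') : X.level j ⟶ X.level j' :=
  ((innerLim (discrete k)).obj X.obj).map (homOfLE h)

theorem tr_rawProj (X : AdmDiagram k) {j i i' : ℤ} (a : i ≤ i') (l : X.level j) :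
    X.tr (min_le_right i j) (min_le_right i' j) (min_le_min_right j a) le_rfl (X.rawProj j i l) =
      X.rawProj j i' l :=
  congrArg (fun f : X.level j ⟶ _ => f.hom l)
    (limit.w (clamp.obj j ⋙ X.obj ⋙ discrete k) (homOfLE a))

theorem rawProj_eq (X : AdmDiagram k) (j i : ℤ) (l : X.level j) :
    X.rawProj j i l = X.proj (min_le_right i j) l :=
  (X.tr_rawProj (min_le_left i j) l).symm

theorem proj_eq (X : AdmDiagram k) {i j : ℤ} (h : i ≤ j) (l : X.level j) :
    X.proj h l = X.tr (min_le_right i j) h (min_le_left i j) le_rfl (X.rawProj j i l) := rfl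

theorem tr_proj (X : AdmDiagram k) {i i' j : ℤ} (a : i ≤ i') (h : i' ≤ j) (l : X.level j) :
    X.tr (a.trans h) h a le_rfl (X.proj (a.trans h) l) = X.proj h l := by
  rw [proj_eq, proj_eq, ← X.tr_rawProj a, tr_tr, tr_tr]

theorem rawProj_incl (X : AdmDiagram k) {i j j' : ℤ} (h' : j ≤ j') (l : X.level j) :
    X.rawProj j' i ((X.incl h').hom l) =
      X.tr (min_le_right i j) (min_le_right i j') (min_le_min_left i h') h' (X.rawProj j i l) :=
  congrArg (fun f : X.level j ⟶ _ => f.hom l)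
    (limMap_π (Functor.whiskerRight (clamp.map (homOfLE h')) (X.obj ⋙ discrete k)) i)

theorem proj_incl (X : AdmDiagram k) {i j j' : ℤ} (h : i ≤ j) (h' : j ≤ j') (l : X.level j) :
    X.proj (h.trans h') ((X.incl h').hom l) = X.tr h (h.trans h') le_rfl h' (X.proj h l) := by
  rw [proj_eq, proj_eq, rawProj_incl, tr_tr, tr_tr]

theorem proj_ext (X : AdmDiagram k) {j : ℤ} {l l' : X.level j}
    (hl : ∀ i (h : i ≤ j), X.proj h l = X.proj h l') : l = l' := by
  refine topLimit_ext (clamp.obj j ⋙ X.obj ⋙ discrete k) fun i => ?_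
  change X.rawProj j i l = X.rawProj j i l'
  rw [rawProj_eq, rawProj_eq, hl]

theorem proj_exists (X : AdmDiagram k) {j : ℤ} (x : ∀ i (h : i ≤ j), X.obj.obj (pair i j h))
    (hx : ∀ i i' (a : i ≤ i') (h : i' ≤ j), X.tr (a.trans h) h a le_rfl (x i (a.trans h)) = x i' h) :
    ∃ l : X.level j, ∀ i (h : i ≤ j), X.proj h l = x i h := by
  obtain ⟨l, hl⟩ := topLimit_exists (clamp.obj j ⋙ X.obj ⋙ discrete k)
    (fun i => x (min i j) (min_le_right i j))
    fun i i' a => hx _ _ (min_le_min_right j (leOfHom a)) (min_le_right i' j)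
  refine ⟨l, fun i h => ?_⟩
  have h' : X.rawProj j i l = x (min i j) (min_le_right i j) := hl i
  exact (congrArg (X.tr (min_le_right i j) h (min_le_left i j) le_rfl) h').trans (hx _ _ _ h)

theorem proj_surjective (X : AdmDiagram k) {i j : ℤ} (h : i ≤ j) :
    Function.Surjective (X.proj h) := by
  intro x
  obtain ⟨y, hy, hy'⟩ := X.exists_lift h x
  obtain ⟨l, hl⟩ := X.proj_exists y hy'
  exact ⟨l, (hl i h).trans hy⟩

/-- The limit topology is induced by projections to discrete spaces, so kernels of projections
generate the neighbourhoods of `0`. Smaller `i` gives a smaller kernel, hence a single kernel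
suffices. -/
theorem proj_basis (X : AdmDiagram k) {j : ℤ} (N : Set (X.level j)) (hN : N ∈ nhds 0) :
    ∃ (i : ℤ) (h : i ≤ j), ∀ l, X.proj h l = 0 → l ∈ N := by
  have e : nhds (0 : X.level j) = ⨅ i, Filter.principal {l | X.rawProj j i l = 0} := by
    refine (topLimit_nhds (clamp.obj j ⋙ X.obj ⋙ discrete k)).trans (iInf_congr fun i => ?_)
    have : DiscreteTopology ((clamp.obj j ⋙ X.obj ⋙ discrete k).obj i) := ⟨rfl⟩
    have : nhds (0 : (clamp.obj j ⋙ X.obj ⋙ discrete k).obj i) = Filter.principal {0} :=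
      (congrFun (nhds_discrete _) _).trans (Filter.principal_singleton _).symm
    rw [this, Filter.comap_principal]
    rfl
  rw [e, Filter.mem_iInf_of_directed] at hN
  · obtain ⟨i, hi⟩ := hN
    refine ⟨min i j, min_le_right i j, fun l hl => hi ?_⟩
    rwa [← rawProj_eq] at hl
  · intro i i'
    refine ⟨min i i', ?_, ?_⟩
    · refine Filter.principal_mono.2 fun l (hl : _ = 0) => ?_
      change _ = 0
      rw [← X.tr_rawProj (min_le_left i i'), hl, map_zero]
    · refine Filter.principal_mono.2 fun l (hl : _ = 0) => ?_
      change _ = 0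
      rw [← X.tr_rawProj (min_le_right i i'), hl, map_zero]

theorem isOpen_ker_proj (X : AdmDiagram k) {i j : ℤ} (h : i ≤ j) :
    IsOpen (LinearMap.ker (X.proj h) : Set (X.level j)) := by
  let f := limit.π (clamp.obj j ⋙ X.obj ⋙ discrete k) i
  have ho : IsOpen (X := (discrete k).obj (X.obj.obj (pair (min i j) j (min_le_right i j))))
      {x | X.tr (min_le_right i j) h (min_le_left i j) le_rfl x = 0} :=
    isOpen_discrete (α := (discrete k).obj (X.obj.obj (pair (min i j) j (min_le_right i j)))) _
  exact ho.preimage f.hom.continuous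

/-- Exactness lifts each component of `l'` to `X_{i,j}`, and injectivity of the transition maps
makes the lifts compatible. -/
theorem exists_incl (X : AdmDiagram k) {j j' : ℤ} (h : j ≤ j') (l' : X.level j')
    (hl' : X.proj h l' = 0) : ∃ l, (X.incl h).hom l = l' := by
  have key : ∀ i (hi : i ≤ j), ∃ x : X.obj.obj (pair i j hi),
      X.tr hi (hi.trans h) le_rfl h x = X.proj (hi.trans h) l' := fun i hi =>
    (X.tr_exact hi h _).1 (by rw [tr_proj, hl'])
  choose x hx using key
  obtain ⟨l, hl⟩ := X.proj_exists x fun i i' a hi => by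
    apply X.tr_injective hi h
    rw [tr_tr, hx, ← X.tr_proj a, ← hx, tr_tr]
  refine ⟨l, X.proj_ext fun i hi => ?_⟩
  rcases le_total i j with hij | hij
  · rw [X.proj_incl hij, hl, hx]
  · rw [← X.tr_proj hij hi, ← X.tr_proj hij hi, hl', X.proj_incl le_rfl h,
      X.subsingleton_diag (X.proj le_rfl l), map_zero]

theorem incl_injective (X : AdmDiagram k) {j j' : ℤ} (h : j ≤ j') :
    Function.Injective (X.incl h).hom := by
  intro l l' e
  refine X.proj_ext fun i hi => X.tr_injective hi h ?_
  rw [← X.proj_incl hi h, ← X.proj_incl hi h, e]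

/-- The inclusion of `lim_i X_{i,j}` in the realization. -/
def toReal (X : AdmDiagram k) (j : ℤ) : X.level j ⟶ X.real :=
  colimit.ι ((innerLim (discrete k)).obj X.obj ⋙ 𝟭 _) j

theorem toReal_incl (X : AdmDiagram k) {j j' : ℤ} (h : j ≤ j') (l : X.level j) :
    (X.toReal j').hom ((X.incl h).hom l) = (X.toReal j).hom l :=
  congrArg (fun f : X.level j ⟶ X.real => f.hom l)
    (colimit.w ((innerLim (discrete k)).obj X.obj ⋙ 𝟭 _) (homOfLE h))

theorem exists_toReal (X : AdmDiagram k) (v : X.real) : ∃ j l, (X.toReal j).hom l = v :=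
  topColimit_exists ((innerLim (discrete k)).obj X.obj ⋙ 𝟭 _) v

theorem toReal_injective (X : AdmDiagram k) (j : ℤ) : Function.Injective (X.toReal j).hom :=
  topColimit_injective ((innerLim (discrete k)).obj X.obj ⋙ 𝟭 _)
    (fun _ _ a => X.incl_injective (leOfHom a)) j

/-- The filtration of the realization by the spaces `lim_i X_{i,j}`. -/
def realF (X : AdmDiagram k) (j : ℤ) : Submodule k X.real :=
  LinearMap.range (X.toReal j).hom.toLinearMap

theorem realF_mono (X : AdmDiagram k) : Monotone X.realF := by
  rintro j j' h _ ⟨l, rfl⟩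
  exact ⟨(X.incl h).hom l, X.toReal_incl h l⟩

theorem toReal_mem_iff (X : AdmDiagram k) {i j : ℤ} (h : i ≤ j) (l : X.level j) :
    (X.toReal j).hom l ∈ X.realF i ↔ X.proj h l = 0 := by
  constructor
  · rintro ⟨l', hl'⟩
    have : (X.incl h).hom l' = l := X.toReal_injective j ((X.toReal_incl h l').trans hl')
    rw [← this, X.proj_incl le_rfl h, X.subsingleton_diag (X.proj le_rfl l'), map_zero]
  · intro hl
    obtain ⟨l', rfl⟩ := X.exists_incl h l hl
    exact ⟨l', (X.toReal_incl h l').symm⟩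

/-- The colimit topology is accessible only through its universal property. The quotient by `realF
j`, given the discrete topology, receives compatible continuous maps from all levels; the induced
continuous map has kernel `realF j`. -/
theorem isOpen_realF (X : AdmDiagram k) (j : ℤ) : IsOpen (X.realF j : Set X.real) := by
  let _ : TopologicalSpace (X.real ⧸ X.realF j) := ⊥
  have : DiscreteTopology (X.real ⧸ X.realF j) := ⟨rfl⟩
  have : ContinuousSMul k (X.real ⧸ X.realF j) := ⟨continuous_of_discreteTopology⟩
  let q := (X.realF j).mkQ
  have hc : ∀ j', Continuous (q ∘ₗ (X.toReal j').hom.toLinearMap) := by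
    intro j'
    rcases le_total j j' with h | h
    · refine continuous_of_ker _ _ (X.isOpen_ker_proj h) fun l hl => ?_
      exact (Submodule.Quotient.mk_eq_zero _).2 ((X.toReal_mem_iff h l).2 hl)
    · refine continuous_of_ker _ ⊤ isOpen_univ fun l _ => ?_
      exact (Submodule.Quotient.mk_eq_zero _).2 (X.realF_mono h ⟨l, rfl⟩)
  let c : Cocone ((innerLim (discrete k)).obj X.obj ⋙ 𝟭 _) :=
    { pt := TopModuleCat.of k (X.real ⧸ X.realF j)
      ι :=
        { app := fun j' => TopModuleCat.ofHom ⟨q ∘ₗ (X.toReal j').hom.toLinearMap, hc j'⟩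
          naturality := fun j' j'' a => by
            apply ConcreteCategory.hom_ext
            intro l
            exact congrArg q (X.toReal_incl (leOfHom a) l) } }
  let d : X.real ⟶ TopModuleCat.of k (X.real ⧸ X.realF j) := colimit.desc _ c
  have hd : ∀ v, d.hom v = q v := by
    intro v
    obtain ⟨j', l, rfl⟩ := X.exists_toReal v
    exact congrArg (fun f : X.level j' ⟶ TopModuleCat.of k (X.real ⧸ X.realF j) => f.hom l)
      (colimit.ι_desc c j')
  have e : (X.realF j : Set X.real) = d.hom ⁻¹' {0} := by
    ext v
    change v ∈ X.realF j ↔ d.hom v = 0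
    rw [hd, ← Submodule.Quotient.mk_eq_zero]
    rfl
  rw [e]
  exact (isOpen_discrete (α := X.real ⧸ X.realF j) {0}).preimage d.hom.continuous

/-- The isomorphism of `lim_i X_{i,j}` with its image. -/
def levelEquiv (X : AdmDiagram k) (j : ℤ) : X.level j ≃ₗ[k] X.realF j :=
  LinearEquiv.ofInjective (X.toReal j).hom.toLinearMap (X.toReal_injective j)

/-- The projection from the filtered pieces of the realization to `X_{i,j}`. -/
def realQ (X : AdmDiagram k) {i j : ℤ} (h : i ≤ j) : X.realF j →ₗ[k] X.obj.obj (pair i j h) :=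
  X.proj h ∘ₗ (X.levelEquiv j).symm.toLinearMap

theorem realQ_toReal (X : AdmDiagram k) {i j : ℤ} (h : i ≤ j) (l : X.level j)
    (hl : (X.toReal j).hom l ∈ X.realF j) : X.realQ h ⟨(X.toReal j).hom l, hl⟩ = X.proj h l := by
  have : (X.levelEquiv j).symm ⟨(X.toReal j).hom l, hl⟩ = l := by
    rw [LinearEquiv.symm_apply_eq]
    rfl
  rw [realQ, LinearMap.comp_apply, LinearEquiv.coe_coe, this]

/-- The canonical model of a diagram. -/
def model (X : AdmDiagram k) : Model X X.real where
  F := X.realF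
  q := X.realQ
  mono := X.realF_mono
  isOpen := X.isOpen_realF
  basis N hN := by
    -- It suffices to look inside level `0`: small steps of the filtration lie in its image, where
    -- kernels of projections form a base.
    have : (X.toReal 0).hom ⁻¹' N ∈ nhds (0 : X.level 0) :=
      (X.toReal 0).hom.continuous.continuousAt.preimage_mem_nhds (by rwa [map_zero])
    obtain ⟨i, hi, H⟩ := X.proj_basis _ this
    refine ⟨i, ?_⟩
    rintro _ ⟨l, rfl⟩
    change (X.toReal i).hom l ∈ N
    rw [← X.toReal_incl hi]
    refine H _ ?_
    rw [X.proj_incl le_rfl hi, X.subsingleton_diag (X.proj le_rfl l), map_zero]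
  exhaust v := by
    obtain ⟨j, l, rfl⟩ := X.exists_toReal v
    exact ⟨j, l, rfl⟩
  separated v hv := by
    obtain ⟨j, l, rfl⟩ := X.exists_toReal v
    have : l = 0 := X.proj_ext fun i h => by
      rw [(X.toReal_mem_iff h l).1 (hv i), map_zero]
    rw [this, map_zero]
  q_surjective h x := by
    obtain ⟨l, hl⟩ := X.proj_surjective h x
    exact ⟨⟨_, l, rfl⟩, (X.realQ_toReal h l _).trans hl⟩
  q_eq_zero h v := by
    obtain ⟨_, l, rfl⟩ := v
    exact (Eq.congr_left (X.realQ_toReal h l _)).trans (X.toReal_mem_iff h l).symm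
  q_tr {i j i' j'} h h' a b v hv := by
    obtain ⟨l, rfl⟩ := hv
    have e : X.realQ h ⟨(X.toReal j).hom l, l, rfl⟩ = X.proj h l := X.realQ_toReal h l _
    have e' : X.realQ h' ⟨(X.toReal j).hom l, X.realF_mono b ⟨l, rfl⟩⟩ =
        X.proj h' ((X.incl b).hom l) := by
      rw [← X.realQ_toReal h' _ ⟨_, rfl⟩]
      exact congrArg (X.realQ h') (Subtype.ext (X.toReal_incl b l).symm)
    refine e'.trans (Eq.trans ?_ (congrArg _ e).symm)
    rw [← X.tr_proj a h', X.proj_incl h b, tr_tr]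
  complete j x hx := by
    obtain ⟨l, hl⟩ := X.proj_exists x hx
    exact ⟨⟨_, l, rfl⟩, fun i h => (X.realQ_toReal h l _).trans (hl i h)⟩

theorem rawProj_map {X Y : AdmDiagram k} (g : X ⟶ Y) (j i : ℤ) (l : X.level j) :
    Y.rawProj j i ((((innerLim (discrete k)).map g.hom).app j).hom l) =
      app g (min_le_right i j) (X.rawProj j i l) :=
  congrArg (fun f : X.level j ⟶ _ => f.hom l)
    (limMap_π (Functor.whiskerLeft (clamp.obj j) (Functor.whiskerRight g.hom (discrete k))) i)

theorem toReal_map {X Y : AdmDiagram k} (g : X ⟶ Y) (j : ℤ) (l : X.level j) :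
    ((colimLim (discrete k) (𝟭 _)).map g.hom).hom ((X.toReal j).hom l) =
      (Y.toReal j).hom ((((innerLim (discrete k)).map g.hom).app j).hom l) :=
  congrArg (fun f : X.level j ⟶ _ => f.hom l)
    (ι_colimMap (Functor.whiskerRight ((innerLim (discrete k)).map g.hom) (𝟭 _)) j)

/-- The realization of a morphism is compatible with the canonical models. -/
theorem compat_map {X Y : AdmDiagram k} (g : X ⟶ Y) :
    Compat X.model Y.model g ((colimLim (discrete k) (𝟭 _)).map g.hom) where
  map j v hv := by
    obtain ⟨l, rfl⟩ := hv
    exact ⟨_, (toReal_map g j l).symm⟩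
  q {i j} h v hv := by
    obtain ⟨l, rfl⟩ := hv
    have e : X.realQ h ⟨(X.toReal j).hom l, l, rfl⟩ = X.proj h l := X.realQ_toReal h l _
    refine Eq.trans ?_ (congrArg _ e).symm
    have e' := Y.realQ_toReal h ((((innerLim (discrete k)).map g.hom).app j).hom l) ⟨_, rfl⟩
    refine Eq.trans ?_ (e'.trans ?_)
    · exact congrArg (Y.realQ h) (Subtype.ext (toReal_map g j l))
    · rw [proj_eq, proj_eq, rawProj_map, app_tr]

end AdmDiagram

end

end TateSpaces

namespace TateSpaces

noncomputable section

/-! ### Fullness and faithfulness of the realization -/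

/-- Take for `ψ j` the least `n ≥ j` with `P j n`. Minimality gives monotonicity and, with `ex'`,
the limit at `-∞`; the bound `j ≤ n` makes the minimum exist and gives the limit at `∞`. -/
theorem exists_bicofinal (P : ℤ → ℤ → Prop) (mono₁ : ∀ j j' n, j ≤ j' → P j' n → P j n)
    (ex : ∀ j, ∃ n, P j n) (mono₂ : ∀ j n n', n ≤ n' → P j n → P j n') (ex' : ∀ n, ∃ j, P j n) :
    ∃ ψ : Bicofinal, (∀ j, j ≤ ψ.toFun j) ∧ ∀ j, P j (ψ.toFun j) := by
  have key : ∀ j, ∃ n, (j ≤ n ∧ P j n) ∧ ∀ m, (j ≤ m ∧ P j m) → n ≤ m := fun j => by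
    obtain ⟨n, hn⟩ := ex j
    exact Int.exists_least_of_bdd ⟨j, fun z hz => hz.1⟩
      ⟨max j n, le_max_left _ _, mono₂ j n _ (le_max_right _ _) hn⟩
  choose ψ h1 h2 using key
  refine ⟨⟨ψ, fun j j' h => h2 j _ ⟨h.trans (h1 j').1, mono₁ j j' _ h (h1 j').2⟩, ?_, ?_⟩,
    fun j => (h1 j).1, fun j => (h1 j).2⟩
  · refine Filter.tendsto_atBot.2 fun n => ?_
    obtain ⟨j₀, h₀⟩ := ex' n
    filter_upwards [Filter.eventually_le_atBot j₀, Filter.eventually_le_atBot n] with j hj hn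
    exact h2 j n ⟨hn, mono₁ _ _ _ hj h₀⟩
  · exact Filter.tendsto_atTop_mono (fun j => (h1 j).1) Filter.tendsto_id

variable {k : Type u} [Field k]

/-- Composition of reindexings. -/
def Bicofinal.comp (φ ψ : Bicofinal) : Bicofinal :=
  ⟨φ.toFun ∘ ψ.toFun, φ.mono.comp ψ.mono, φ.tendsto_atBot.comp ψ.tendsto_atBot,
    φ.tendsto_atTop.comp ψ.tendsto_atTop⟩

/-- Reindexing a morphism. -/
def AdmDiagram.reindexMap {X Y : AdmDiagram k} (g : X ⟶ Y) (φ : Bicofinal) :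
    X.reindex φ ⟶ Y.reindex φ :=
  ObjectProperty.homMk (Functor.whiskerLeft φ.onPairs g.hom)

theorem AdmDiagram.shiftMaps_toReindex (X : AdmDiagram k) (ψ : Bicofinal)
    (h : ∀ i, i ≤ ψ.toFun i) : shiftMaps k (X.toReindex ψ h) :=
  shiftMaps.mk X (φ₀ := Bicofinal.refl) h

instance isIso_Q_toReindex (X : AdmDiagram k) (ψ : Bicofinal) (h : ∀ i, i ≤ ψ.toFun i) :
    IsIso ((shiftMaps k).Q.map (X.toReindex ψ h)) :=
  (shiftMaps k).Q_inverts _ (X.shiftMaps_toReindex ψ h)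

theorem AdmDiagram.toReindex_comp (X : AdmDiagram k) (ψ ψ' : Bicofinal)
    (h : ∀ i, i ≤ ψ.toFun i) (h' : ∀ i, i ≤ ψ'.toFun i)
    (h'' : ∀ i, i ≤ (ψ'.comp ψ).toFun i) :
    X.toReindex (ψ'.comp ψ) h'' = X.toReindex ψ' h' ≫ (X.reindex ψ').toReindex ψ h := by
  apply AdmDiagram.hom_ext
  intro i j hij x
  exact (X.tr_tr hij (ψ'.mono hij) (ψ'.mono (ψ.mono hij)) (h' i) (h' j) (ψ'.mono (h i))
    (ψ'.mono (h j)) x).symm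

theorem AdmDiagram.toReindex_naturality {X Y : AdmDiagram k} (g : X ⟶ Y) (ψ : Bicofinal)
    (h : ∀ i, i ≤ ψ.toFun i) :
    g ≫ Y.toReindex ψ h = X.toReindex ψ h ≫ AdmDiagram.reindexMap g ψ := by
  apply AdmDiagram.hom_ext
  intro i j hij x
  exact (AdmDiagram.app_tr g hij (ψ.mono hij) (h i) (h j) x).symm

/-- A morphism of Tate spaces is a fraction if it is the composition of a morphism of diagrams
and the inverse of some `Y ⟶ Y.reindex ψ`. -/
def IsFraction {X Y : AdmDiagram k} (h : (shiftMaps k).Q.obj X ⟶ (shiftMaps k).Q.obj Y) : Prop :=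
  ∃ (ψ : Bicofinal) (hψ : ∀ i, i ≤ ψ.toFun i) (g : X ⟶ Y.reindex ψ),
    h ≫ (shiftMaps k).Q.map (Y.toReindex ψ hψ) = (shiftMaps k).Q.map g

/-- Naturality of `toReindex` moves the denominator of `h` past the numerator of `h'`; the two
denominators then compose. -/
theorem IsFraction.comp {X Y Z : AdmDiagram k}
    {h : (shiftMaps k).Q.obj X ⟶ (shiftMaps k).Q.obj Y}
    {h' : (shiftMaps k).Q.obj Y ⟶ (shiftMaps k).Q.obj Z} (hh : IsFraction h)
    (hh' : IsFraction h') : IsFraction (h ≫ h') := by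
  obtain ⟨ψ, hψ, g, e⟩ := hh
  obtain ⟨ψ', hψ', g', e'⟩ := hh'
  refine ⟨ψ'.comp ψ, fun i => (hψ i).trans (hψ' _), g ≫ AdmDiagram.reindexMap g' ψ, ?_⟩
  have key : (h ≫ h') ≫ (shiftMaps k).Q.map
      (Z.toReindex ψ' hψ' ≫ (Z.reindex ψ').toReindex ψ hψ) =
      (shiftMaps k).Q.map (g ≫ AdmDiagram.reindexMap g' ψ) := by
    rw [Functor.map_comp, Category.assoc, reassoc_of% e',
      ← Functor.map_comp, AdmDiagram.toReindex_naturality, Functor.map_comp, reassoc_of% e,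
      Functor.map_comp]
  exact (congrArg (fun t => (h ≫ h') ≫ (shiftMaps k).Q.map t)
    (Z.toReindex_comp ψ ψ' hψ hψ' _)).trans key

theorem isFraction_map {X Y : AdmDiagram k} (g : X ⟶ Y) : IsFraction ((shiftMaps k).Q.map g) :=
  ⟨Bicofinal.refl, fun _ => le_rfl, g ≫ Y.toReindex Bicofinal.refl (fun _ => le_rfl),
    ((shiftMaps k).Q.map_comp _ _).symm⟩

/-- As `φ₀` is cofinal, some `ψ` satisfies `φ₁ ≤ φ₀ ∘ ψ`. The denominator `X_{φ₀} ⟶ X_{φ₀ ψ}` then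
factors through the map to be inverted, and the other factor is the numerator. -/
theorem isFraction_inv (X : AdmDiagram k) {φ₀ φ₁ : Bicofinal}
    (h : ∀ i, φ₀.toFun i ≤ φ₁.toFun i) :
    IsFraction (Localization.Construction.wInv (X.shift h) (shiftMaps.mk X h)) := by
  obtain ⟨ψ, hψ, H⟩ := exists_bicofinal (fun j n => φ₁.toFun j ≤ φ₀.toFun n)
    (fun j j' n a b => (φ₁.mono a).trans b)
    (fun j => (φ₀.tendsto_atTop.eventually_ge_atTop _).exists)
    (fun j n n' a b => b.trans (φ₀.mono a))
    (fun n => (φ₁.tendsto_atBot.eventually_le_atBot _).exists)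
  refine ⟨ψ, hψ, X.shift (φ₁ := φ₀.comp ψ) H, ?_⟩
  have e : (X.reindex φ₀).toReindex ψ hψ = X.shift h ≫ X.shift (φ₁ := φ₀.comp ψ) H := by
    apply AdmDiagram.hom_ext
    intro i j hij x
    exact (X.tr_tr (φ₀.mono hij) (φ₁.mono hij) (φ₀.mono (ψ.mono hij)) (h i) (h j) (H i) (H j)
      x).symm
  have key : Localization.Construction.wInv (X.shift h) (shiftMaps.mk X h) ≫
      (shiftMaps k).Q.map (X.shift h ≫ X.shift (φ₀ := φ₁) (φ₁ := φ₀.comp ψ) H) =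
        (shiftMaps k).Q.map (X.shift (φ₀ := φ₁) (φ₁ := φ₀.comp ψ) H) := by
    rw [Functor.map_comp]
    exact (Localization.Construction.wIso (X.shift h) (shiftMaps.mk X h)).inv_hom_id_assoc _
  exact (congrArg (fun t => Localization.Construction.wInv (X.shift h) (shiftMaps.mk X h) ≫
    (shiftMaps k).Q.map t) e).trans key

/-- The class of fractions. -/
def fractions : MorphismProperty (Tate k) := fun T T' h =>
  IsFraction (X := (Localization.Construction.objEquiv _).symm T)
    (Y := (Localization.Construction.objEquiv _).symm T') h

instance : (fractions : MorphismProperty (Tate k)).IsStableUnderComposition :=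
  ⟨fun _ _ hh hh' => IsFraction.comp hh hh'⟩

/-- The localization is generated under composition by images of diagram maps and by formal
inverses, and both kinds are fractions. -/
theorem isFraction {X Y : AdmDiagram k} (h : (shiftMaps k).Q.obj X ⟶ (shiftMaps k).Q.obj Y) :
    IsFraction h := by
  have e : (fractions : MorphismProperty (Tate k)) = ⊤ := by
    apply Localization.Construction.morphismProperty_eq_top
    · exact fun X Y f => isFraction_map f
    · rintro _ _ _ ⟨X, h⟩
      exact isFraction_inv X h
  have : fractions h := by rw [e]; trivial
  exact this

/-- Two fractions have a common denominator. -/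
theorem IsFraction.of_le {X Y : AdmDiagram k}
    {h : (shiftMaps k).Q.obj X ⟶ (shiftMaps k).Q.obj Y} {ψ ψ' : Bicofinal}
    (hψ : ∀ i, i ≤ ψ.toFun i) (hψ' : ∀ i, i ≤ ψ'.toFun i) (le : ∀ i, ψ.toFun i ≤ ψ'.toFun i)
    (g : X ⟶ Y.reindex ψ)
    (e : h ≫ (shiftMaps k).Q.map (Y.toReindex ψ hψ) = (shiftMaps k).Q.map g) :
    h ≫ (shiftMaps k).Q.map (Y.toReindex ψ' hψ') = (shiftMaps k).Q.map (g ≫ Y.shift le) := by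
  have e1 : Y.toReindex ψ' hψ' = Y.toReindex ψ hψ ≫ Y.shift le := by
    apply AdmDiagram.hom_ext
    intro i j hij x
    exact (Y.tr_tr hij (ψ.mono hij) (ψ'.mono hij) (hψ i) (hψ j) (le i) (le j) x).symm
  rw [e1, Functor.map_comp, reassoc_of% e]
  exact ((shiftMaps k).Q.map_comp _ _).symm

variable [TopologicalSpace k]

/-- A continuous linear map is filtered up to reindexing. -/
theorem exists_reindex {X Y : AdmDiagram k} {V W : TopModuleCat.{u} k} (M : Model X V)
    (N : Model Y W) (f : V ⟶ W) : ∃ ψ : Bicofinal, (∀ j, j ≤ ψ.toFun j) ∧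
      ∀ j v, v ∈ M.F j → f.hom v ∈ N.F (ψ.toFun j) := by
  have ex' : ∀ n, ∃ j, ∀ v, v ∈ M.F j → f.hom v ∈ N.F n := by
    intro n
    exact M.basis _ (f.hom.continuous.continuousAt.preimage_mem_nhds
      (by rw [map_zero]; exact (N.isOpen n).mem_nhds (N.F n).zero_mem))
  refine exists_bicofinal (fun j n => ∀ v, v ∈ M.F j → f.hom v ∈ N.F n)
    (fun j j' n a H v hv => H v (M.mono a hv)) ?_
    (fun j n n' a H v hv => N.mono a (H v hv)) ex'
  intro j
  obtain ⟨i₀, hi₀⟩ := ex' 0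
  obtain ⟨i, hij, hi⟩ : ∃ i, i ≤ j ∧ ∀ v, v ∈ M.F i → f.hom v ∈ N.F 0 :=
    ⟨min i₀ j, min_le_right _ _, fun v hv => hi₀ v (M.mono (min_le_left _ _) hv)⟩
  -- `T n` is the image in `X_{i,j}` of the vectors of `M.F j` that `f` sends into `N.F n`. This
  -- increasing sequence stabilizes by finite-dimensionality.
  let T : ℕ →o Submodule k (X.obj.obj (pair i j hij)) :=
    ⟨fun n => ((N.F n).comap (f.hom.toLinearMap ∘ₗ (M.F j).subtype)).map (M.q hij),
      fun n n' h => Submodule.map_mono (Submodule.comap_mono (N.mono (by exact_mod_cast h)))⟩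
  obtain ⟨n, hn⟩ := monotone_stabilizes_iff_noetherian.2
    (inferInstanceAs (IsNoetherian k (X.obj.obj (pair i j hij)))) T
  refine ⟨n, fun v hv => ?_⟩
  obtain ⟨m, hm⟩ := N.exhaust (f.hom v)
  have h1 : M.q hij ⟨v, hv⟩ ∈ T (max n m.toNat) :=
    ⟨⟨v, hv⟩, N.mono (by omega) hm, rfl⟩
  rw [← hn _ (le_max_left _ _)] at h1
  obtain ⟨v', hv', e⟩ := h1
  -- Thus `v` differs by an element of `M.F i` from some `v'` with `f v' ∈ N.F n`, and `f` maps `M.F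
  -- i` into `N.F 0`, which lies in `N.F n`.
  have h2 := hi _ ((M.q_eq_zero hij (⟨v, hv⟩ - v')).1 (by rw [map_sub, e, sub_self]))
  have h3 := (N.F n).add_mem (N.mono (by omega) h2) hv'
  simpa using h3

/-- Transport of a model along an isomorphism. -/
def Model.ofIso {X : AdmDiagram k} {V W : TopModuleCat.{u} k} (M : Model X V) (e : V ≅ W) :
    Model X W :=
  have hi : ∀ v, e.inv.hom (e.hom.hom v) = v := fun v => e.toContinuousLinearEquiv.symm_apply_apply v
  have hi' : ∀ w, e.hom.hom (e.inv.hom w) = w := fun w => e.toContinuousLinearEquiv.apply_symm_apply w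
  { F := fun j => (M.F j).comap e.inv.hom.toLinearMap
    q := fun {i j} h => M.q h ∘ₗ e.inv.hom.toLinearMap.restrict (fun _ hv => hv)
    mono := fun _ _ h => Submodule.comap_mono (M.mono h)
    isOpen := fun i => (M.isOpen i).preimage e.inv.hom.continuous
    basis := fun N hN => by
      obtain ⟨i, hi⟩ := M.basis (e.hom.hom ⁻¹' N)
        (e.hom.hom.continuous.continuousAt.preimage_mem_nhds (by rwa [map_zero]))
      refine ⟨i, fun w hw => ?_⟩
      rw [← hi' w]
      exact hi hw
    exhaust := fun w => M.exhaust (e.inv.hom w)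
    separated := fun w hw => by
      rw [← hi' w]
      exact (congrArg e.hom.hom (M.separated _ hw)).trans (map_zero _)
    q_surjective := fun h x => by
      obtain ⟨⟨v, hv⟩, rfl⟩ := M.q_surjective h x
      exact ⟨⟨e.hom.hom v, (congrArg (· ∈ M.F _) (hi v)).mpr hv⟩,
        congrArg (M.q h) (Subtype.ext (hi v))⟩
    q_eq_zero := fun h v => M.q_eq_zero h ⟨e.inv.hom v, v.2⟩
    q_tr := fun h h' a b v hv => M.q_tr h h' a b (e.inv.hom v) hv
    complete := fun j x hx => by
      obtain ⟨⟨v, hv⟩, H⟩ := M.complete j x hx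
      exact ⟨⟨e.hom.hom v, (congrArg (· ∈ M.F _) (hi v)).mpr hv⟩,
        fun i h => (congrArg (M.q h) (Subtype.ext (hi v))).trans (H i h)⟩ }

variable [DiscreteTopology k]

/-- The canonical model on the realization of a Tate space. -/
def tateModel (X : AdmDiagram k) : Model X ((realization k).obj ((shiftMaps k).Q.obj X)) :=
  X.model

theorem realization_compat {X Y : AdmDiagram k} (g : X ⟶ Y) :
    Compat (tateModel X) (tateModel Y) g ((realization k).map ((shiftMaps k).Q.map g)) :=
  AdmDiagram.compat_map g

/-- Over a common denominator the two numerators have the same realization, which determines a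
morphism of diagrams; the denominator is an isomorphism and cancels. -/
theorem realization_map_injective {X Y : AdmDiagram k}
    {h h' : (shiftMaps k).Q.obj X ⟶ (shiftMaps k).Q.obj Y}
    (e : (realization k).map h = (realization k).map h') : h = h' := by
  obtain ⟨ψ₁, hψ₁, g₁, e₁⟩ := isFraction h
  obtain ⟨ψ₂, hψ₂, g₂, e₂⟩ := isFraction h'
  let ψ : Bicofinal := ψ₁.comp ψ₂
  have hψ : ∀ i, i ≤ ψ.toFun i := fun i => (hψ₂ i).trans (hψ₁ _)
  have le₁ : ∀ i, ψ₁.toFun i ≤ ψ.toFun i := fun i => ψ₁.mono (hψ₂ i)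
  have le₂ : ∀ i, ψ₂.toFun i ≤ ψ.toFun i := fun i => hψ₁ _
  have e₁' := IsFraction.of_le hψ₁ hψ le₁ g₁ e₁
  have e₂' := IsFraction.of_le hψ₂ hψ le₂ g₂ e₂
  have c₁ := realization_compat (g₁ ≫ Y.shift le₁)
  have c₂ := realization_compat (g₂ ≫ Y.shift le₂)
  rw [← e₁', Functor.map_comp, e, ← Functor.map_comp, e₂'] at c₁
  rw [c₁.diagram_hom_unique c₂, ← e₂'] at e₁'
  exact (cancel_mono _).1 e₁'

instance realization_faithful : (realization k).Faithful where
  map_injective {T T'} h h' e := by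
    obtain ⟨X, rfl⟩ := (Localization.Construction.objEquiv _).surjective T
    obtain ⟨Y, rfl⟩ := (Localization.Construction.objEquiv _).surjective T'
    exact realization_map_injective e

/-- A continuous map between realizations comes from a map of Tate spaces. -/
theorem exists_realization_map {X Y : AdmDiagram k}
    (f : (realization k).obj ((shiftMaps k).Q.obj X) ⟶
      (realization k).obj ((shiftMaps k).Q.obj Y)) :
    ∃ h : (shiftMaps k).Q.obj X ⟶ (shiftMaps k).Q.obj Y, (realization k).map h = f := by
  obtain ⟨ψ, hψ, H⟩ := exists_reindex (tateModel X) (tateModel Y) f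
  obtain ⟨g, hg⟩ := exists_diagram_hom (tateModel X) ((tateModel Y).reindex ψ) f H
  -- The reindexed model lives on the realization of `Y`, not on that of `Y.reindex ψ`; `e`
  -- identifies the two. It is also the realization of the denominator, so the fraction below
  -- realizes to `f`.
  obtain ⟨e, he⟩ := exists_iso ((tateModel Y).reindex ψ) (tateModel (Y.reindex ψ))
  have c₁ := hg.comp he
  rw [Category.comp_id] at c₁
  have c₂ := ((tateModel Y).compat_toReindex ψ hψ).comp he
  rw [Category.comp_id, Category.id_comp] at c₂
  have e₁ := (realization_compat g).hom_unique c₁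
  have e₂ := (realization_compat (Y.toReindex ψ hψ)).hom_unique c₂
  refine ⟨(shiftMaps k).Q.map g ≫ inv ((shiftMaps k).Q.map (Y.toReindex ψ hψ)), ?_⟩
  rw [Functor.map_comp, Functor.map_inv, IsIso.comp_inv_eq, e₁, e₂]

instance realization_full : (realization k).Full where
  map_surjective {T T'} f := by
    obtain ⟨X, rfl⟩ := (Localization.Construction.objEquiv _).surjective T
    obtain ⟨Y, rfl⟩ := (Localization.Construction.objEquiv _).surjective T'
    exact exists_realization_map f

theorem realization_essImage_iff (V : TopModuleCat.{u} k) :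
    (realization k).essImage V ↔ ∃ X : AdmDiagram k, Nonempty (Model X V) := by
  constructor
  · rintro ⟨T, ⟨e⟩⟩
    obtain ⟨X, rfl⟩ := (Localization.Construction.objEquiv _).surjective T
    exact ⟨X, ⟨(tateModel X).ofIso e⟩⟩
  · rintro ⟨X, ⟨M⟩⟩
    obtain ⟨e, -⟩ := exists_iso (tateModel X) M
    exact ⟨(shiftMaps k).Q.obj X, ⟨e⟩⟩

end

end TateSpaces

namespace TateSpaces

noncomputable section

/-! ### Linear compactness -/

variable {k : Type u} [Field k]

section LinearlyCompact

variable {U : Type*} [AddCommGroup U] [Module k U] [TopologicalSpace U]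

/-- The affine hyperplane `φ = c`. -/
def levelSet (φ : U →ₗ[k] k) (c : k) : AffineSubspace k U where
  carrier := {x | φ x = c}
  smul_vsub_vadd_mem' a x y z hx hy hz := by
    simp only [Set.mem_ofPred_eq, vsub_eq_sub, vadd_eq_add] at *
    rw [map_add, map_smul, map_sub, hx, hy, hz, sub_self, smul_zero, zero_add]

theorem isLinearTopology_of_basis {ι : Type*} {G : ι → Submodule k U}
    (isOpen : ∀ n, IsOpen (G n : Set U))
    (basis : ∀ N ∈ nhds (0 : U), ∃ n, (G n : Set U) ⊆ N) : IsLinearTopology k U := by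
  refine IsLinearTopology.mk_of_hasBasis (ι := ι) (p := fun _ => True) (S := Submodule k U) k
    (s := G) ⟨fun N => ⟨fun h => ?_, ?_⟩⟩
  · obtain ⟨n, hn⟩ := basis N h
    exact ⟨n, trivial, hn⟩
  · rintro ⟨n, -, hn⟩
    exact Filter.mem_of_superset ((isOpen n).mem_nhds (G n).zero_mem) hn

theorem IsLinearlyCompact.exists_forall_mem (hU : IsLinearlyCompact k U) {ι : Type*}
    (S : ι → AffineSubspace k U) (hS : ∀ i, IsClosed (S i : Set U))
    (h : ∀ t : Finset ι, ∃ x, ∀ i ∈ t, x ∈ S i) : ∃ x, ∀ i, x ∈ S i := by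
  classical
  obtain ⟨x, hx⟩ := hU.nonempty_iInter (Set.range S) (by rintro _ ⟨i, rfl⟩; exact hS i) (by
    intro t ht
    rw [← Set.image_univ] at ht
    obtain ⟨t', -, rfl⟩ := Finset.subset_set_image_iff.1 ht
    obtain ⟨x, hx⟩ := h t'
    refine ⟨x, Set.mem_iInter₂.2 fun T hT => ?_⟩
    obtain ⟨i, hi, rfl⟩ := Finset.mem_image.1 hT
    exact hx i hi)
  exact ⟨x, fun i => Set.mem_iInter₂.1 hx _ ⟨i, rfl⟩⟩

variable [IsTopologicalAddGroup U]

theorem isClosed_submodule_of_isOpen (G : Submodule k U) (hG : IsOpen (G : Set U)) :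
    IsClosed (G : Set U) :=
  AddSubgroup.isClosed_of_isOpen G.toAddSubgroup hG

/-- A point approximated by elements of a closed set modulo each step of a basis lies in it. -/
theorem mem_of_isClosed_of_basis {ι : Type*} {G : ι → Submodule k U}
    (basis : ∀ N ∈ nhds (0 : U), ∃ n, (G n : Set U) ⊆ N) {S : Set U} (hS : IsClosed S) {v : U}
    (h : ∀ n, ∃ b ∈ S, b - v ∈ G n) : v ∈ S := by
  rw [← hS.closure_eq, mem_closure_iff_nhds]
  intro N hN
  have : (fun x => x + v) ⁻¹' N ∈ nhds (0 : U) :=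
    (continuous_add_const v).continuousAt.preimage_mem_nhds (by rwa [zero_add])
  obtain ⟨n, hn⟩ := basis _ this
  obtain ⟨b, hb, hb'⟩ := h n
  refine ⟨b, ?_, hb⟩
  have := hn hb'
  rwa [Set.mem_preimage, sub_add_cancel] at this

theorem t2Space_of_basis {ι : Type*} {G : ι → Submodule k U}
    (isOpen : ∀ n, IsOpen (G n : Set U))
    (separated : ∀ v, (∀ n, v ∈ G n) → v = 0) : T2Space U := by
  apply IsTopologicalAddGroup.t2Space_of_zero_sep
  intro x hx
  have : ∃ n, x ∉ G n := by
    by_contra! h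
    exact hx (separated x h)
  obtain ⟨n, hn⟩ := this
  exact ⟨G n, (isOpen n).mem_nhds (G n).zero_mem, hn⟩

/-- For each `n`, choose a finite subfamily whose intersection has direction of least dimension
modulo `G n`. Any point of this intersection can then be corrected by an element of `G n` to lie in
any further finite set of members. Successive corrections converge by completeness, and the limit
lies in every member because the members are closed. -/
theorem isLinearlyCompact_of_basis (G : ℕ → Submodule k U)
    (isOpen : ∀ n, IsOpen (G n : Set U)) (basis : ∀ N ∈ nhds (0 : U), ∃ n, (G n : Set U) ⊆ N)
    (separated : ∀ v, (∀ n, v ∈ G n) → v = 0)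
    (finite : ∀ n, Module.Finite k (U ⧸ G n))
    (complete : ∀ x : ℕ → U, (∀ n, x (n + 1) - x n ∈ G n) → ∃ v, ∀ n, v - x n ∈ G n) :
    IsLinearlyCompact k U where
  isLinearTopology := isLinearTopology_of_basis isOpen basis
  t2Space := t2Space_of_basis isOpen separated
  nonempty_iInter 𝓕 hcl hfip := by
    classical
    let S : Finset (AffineSubspace k U) → AffineSubspace k U := fun t => sInf (t : Set _)
    have hS : ∀ t : Finset (AffineSubspace k U), (t : Set (AffineSubspace k U)) ⊆ 𝓕 → (S t : Set U).Nonempty := fun t ht => by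
      have := hfip t ht
      rwa [AffineSubspace.coe_sInf]
    have hmem : ∀ t x, x ∈ S t ↔ ∀ T ∈ t, x ∈ T := fun t x => by
      rw [← SetLike.mem_coe, AffineSubspace.coe_sInf, Set.mem_iInter₂]
      rfl
    let d : ℕ → Finset (AffineSubspace k U) → ℕ := fun n t =>
      Module.finrank k ((S t).direction.map (G n).mkQ)
    have hmin : ∀ n, ∃ t : Finset (AffineSubspace k U), (t : Set (AffineSubspace k U)) ⊆ 𝓕 ∧
        ∀ t' : Finset (AffineSubspace k U), (t' : Set (AffineSubspace k U)) ⊆ 𝓕 →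
          d n t ≤ d n t' := by
      intro n
      have hne : {t : Finset (AffineSubspace k U) | (t : Set (AffineSubspace k U)) ⊆ 𝓕}.Nonempty :=
        ⟨∅, by simp⟩
      refine ⟨Function.argminOn (d n) _ hne, Function.argminOn_mem (d n) _ hne, fun t' ht' => ?_⟩
      exact Function.argminOn_le (d n) _ ht'
    choose t ht htmin using hmin
    have approx : ∀ n (t' : Finset (AffineSubspace k U)), (t' : Set (AffineSubspace k U)) ⊆ 𝓕 →
        ∀ a ∈ S (t n), ∃ b, (∀ T ∈ t', b ∈ T) ∧ b - a ∈ G n := by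
      intro n t' ht' a ha
      have hsub : ((t n ∪ t' : Finset _) : Set (AffineSubspace k U)) ⊆ 𝓕 := by
        rw [Finset.coe_union]
        exact Set.union_subset (ht n) ht'
      have hle : S (t n ∪ t') ≤ S (t n) := sInf_le_sInf (by simp)
      have hd : (S (t n ∪ t')).direction.map (G n).mkQ ≤ (S (t n)).direction.map (G n).mkQ :=
        Submodule.map_mono (AffineSubspace.direction_le hle)
      -- By minimality, adding `t'` does not shrink the direction modulo `G n`. Hence `a - c` is
      -- congruent to a vector `e` of the smaller direction, and `e + c` is the corrected point.
      have heq := Submodule.eq_of_le_of_finrank_le hd (htmin n _ hsub)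
      obtain ⟨c, hc⟩ := hS _ hsub
      have h1 : a - c ∈ (S (t n)).direction := AffineSubspace.vsub_mem_direction ha (hle hc)
      have h2 : (G n).mkQ (a - c) ∈ (S (t n ∪ t')).direction.map (G n).mkQ := by
        rw [heq]
        exact ⟨_, h1, rfl⟩
      obtain ⟨e, he, he'⟩ := h2
      refine ⟨e + c, fun T hT => ?_, ?_⟩
      · have := AffineSubspace.vadd_mem_of_mem_direction he hc
        exact (hmem _ _).1 this T (Finset.mem_union_right _ hT)
      · have := (Submodule.Quotient.eq (G n)).1 he'
        rwa [show e + c - a = e - (a - c) by abel]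
    obtain ⟨x₀, hx₀⟩ := hS (t 0) (ht 0)
    have step : ∀ n (a : {a // a ∈ S (t n)}), ∃ b : {b // b ∈ S (t (n + 1))},
        (b : U) - a ∈ G n := fun n a => by
      obtain ⟨b, hb, hb'⟩ := approx n (t (n + 1)) (ht _) a a.2
      exact ⟨⟨b, (hmem _ _).2 hb⟩, hb'⟩
    choose s hs using step
    let x : ∀ n, {a // a ∈ S (t n)} := fun n => Nat.rec ⟨x₀, hx₀⟩ (fun n a => s n a) n
    have hx : ∀ n, (x (n + 1)).1 - (x n).1 ∈ G n := fun n => hs n (x n)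
    obtain ⟨v, hv⟩ := complete (fun n => (x n).1) hx
    refine ⟨v, Set.mem_iInter₂.2 fun T hT => ?_⟩
    refine mem_of_isClosed_of_basis basis (hcl T hT) fun n => ?_
    obtain ⟨b, hb, hb'⟩ := approx n {T} (by simpa using hT) (x n).1 (x n).2
    refine ⟨b, hb T (by simp), ?_⟩
    have := (G n).sub_mem hb' (hv n)
    rwa [sub_sub_sub_cancel_right] at this

/-- The hyperplanes "coordinate equal to `1`" for a basis of `U ⧸ G` have the finite intersection
property, by sums of basis vectors. A common point has all coordinates `1`, and only finitely many
can be nonzero. -/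
theorem IsLinearlyCompact.finite_quotient (hU : IsLinearlyCompact k U) (G : Submodule k U)
    (hG : IsOpen (G : Set U)) : Module.Finite k (U ⧸ G) := by
  let b := Module.Basis.ofVectorSpace k (U ⧸ G)
  let φ : _ → U →ₗ[k] k := fun i => b.coord i ∘ₗ G.mkQ
  have hcl : ∀ i, IsClosed (levelSet (φ i) 1 : Set U) := by
    intro i
    let _ : TopologicalSpace k := ⊥
    have : DiscreteTopology k := ⟨rfl⟩
    have hc : Continuous (φ i) := continuous_of_ker _ G hG fun x hx => by
      exact (congrArg (b.coord i) ((Submodule.Quotient.mk_eq_zero G).2 hx)).trans (map_zero _)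
    exact (isClosed_discrete {(1 : k)}).preimage hc
  obtain ⟨x, hx⟩ := hU.exists_forall_mem (fun i => levelSet (φ i) 1) hcl fun t => by
    classical
    obtain ⟨x, hx⟩ := G.mkQ_surjective (∑ i ∈ t, b i)
    refine ⟨x, fun i hi => ?_⟩
    change b.coord i (G.mkQ x) = 1
    rw [hx, map_sum, Finset.sum_eq_single i]
    · simp
    · intro j _ hj
      simp [hj]
    · exact fun h => absurd hi h
  have : Finite (Module.Basis.ofVectorSpaceIndex k (U ⧸ G)) := by
    refine Set.finite_univ_iff.1 ((b.repr (G.mkQ x)).support.finite_toSet.subset fun i _ => ?_)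
    have h : b.repr (G.mkQ x) i = 1 := hx i
    rw [Finset.mem_coe, Finsupp.mem_support_iff, h]
    exact one_ne_zero
  exact Module.Finite.of_basis b

/-- The cosets `x n + G n` are closed, and the entry of `x` with the largest index of a finite set
of indices lies in all the corresponding cosets. -/
theorem IsLinearlyCompact.complete (hU : IsLinearlyCompact k U) (G : ℕ → Submodule k U)
    (hG : ∀ n, IsOpen (G n : Set U)) (x : ℕ → U) (hx : ∀ n m, n ≤ m → x m - x n ∈ G n) :
    ∃ v, ∀ n, v - x n ∈ G n := by
  have hS : ∀ n v, v ∈ AffineSubspace.mk' (x n) (G n) ↔ v - x n ∈ G n := fun n v => by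
    rw [AffineSubspace.mem_mk', vsub_eq_sub]
  obtain ⟨v, hv⟩ := hU.exists_forall_mem (fun n => AffineSubspace.mk' (x n) (G n)) (fun n => by
    have : (AffineSubspace.mk' (x n) (G n) : Set U) = (fun v => v - x n) ⁻¹' (G n) := by
      ext v
      exact hS n v
    rw [this]
    exact (isClosed_submodule_of_isOpen _ (hG n)).preimage (continuous_id.sub continuous_const))
    fun t => ⟨x (t.sup id), fun n hn => (hS _ _).2 (hx _ _ (Finset.le_sup (f := id) hn))⟩
  exact ⟨v, fun n => (hS _ _).1 (hv n)⟩

end LinearlyCompact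

end

end TateSpaces

namespace TateSpaces

noncomputable section

/-! ### Lattice filtrations -/

variable {k : Type u} [Field k]

/-- The right-hand form of finiteness passes to images and to larger subspaces without manipulating
nested quotients. -/
theorem finite_quotient_iff {V : Type*} [AddCommGroup V] [Module k V] (P Q : Submodule k V) :
    Module.Finite k (P ⧸ Q.submoduleOf P) ↔ ∃ T : Submodule k V, T.FG ∧ P ≤ T ⊔ Q := by
  constructor
  · rintro ⟨s, hs⟩
    choose f hf using (Q.submoduleOf P).mkQ_surjective
    classical
    refine ⟨Submodule.span k (s.image fun x => (f x : V)), ⟨_, rfl⟩, fun v hv => ?_⟩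
    have h1 : (Q.submoduleOf P).mkQ ⟨v, hv⟩ ∈ Submodule.span k (s : Set _) := by
      rw [hs]; trivial
    have h2 : Submodule.span k (s : Set _) ≤
        (((Submodule.span k (s.image fun x => (f x : V)) ⊔ Q).comap P.subtype).map
          (Q.submoduleOf P).mkQ) := by
      rw [Submodule.span_le]
      intro x hx
      refine ⟨f x, Submodule.mem_sup_left (Submodule.subset_span ?_), hf x⟩
      rw [Finset.mem_coe, Finset.mem_image]
      exact ⟨x, hx, rfl⟩
    obtain ⟨w, hw, e⟩ := h2 h1
    have h3 : v - w ∈ Q := (Submodule.Quotient.eq (Q.submoduleOf P)).1 e.symm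
    have h4 := Submodule.add_mem _ (Submodule.mem_sup_right h3) hw
    simpa using h4
  · rintro ⟨T, hT, hP⟩
    let f : P ⧸ Q.submoduleOf P →ₗ[k] V ⧸ Q := Submodule.mapQ _ _ P.subtype le_rfl
    have hf : Function.Injective f := by
      rw [← LinearMap.ker_eq_bot, LinearMap.ker_eq_bot']
      intro x hx
      obtain ⟨x, rfl⟩ := Submodule.mkQ_surjective _ x
      exact (Submodule.Quotient.mk_eq_zero _).2 ((Submodule.Quotient.mk_eq_zero Q).1 hx)
    have hr : LinearMap.range f ≤ T.map Q.mkQ := by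
      rintro _ ⟨x, rfl⟩
      obtain ⟨⟨x, hx⟩, rfl⟩ := Submodule.mkQ_surjective _ x
      obtain ⟨t, ht, q, hq, rfl⟩ := Submodule.mem_sup.1 (hP hx)
      refine ⟨t, ht, (Submodule.Quotient.eq Q).2 ?_⟩
      simpa using hq
    have : Module.Finite k (T.map Q.mkQ) := Module.Finite.iff_fg.2 (hT.map _)
    exact Module.Finite.of_injective (f.codRestrict (T.map Q.mkQ) fun x => hr ⟨x, rfl⟩)
      fun x y h => hf (congrArg Subtype.val h)

theorem sub_mem_of_succ {V : Type*} [AddCommGroup V] [Module k V] {G : ℕ → Submodule k V}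
    (hG : Antitone G) {x : ℕ → V} (hx : ∀ n, x (n + 1) - x n ∈ G n) {n m : ℕ} (h : n ≤ m) :
    x m - x n ∈ G n := by
  induction m, h using Nat.le_induction with
  | base => simp
  | succ m h ih =>
    have := (G n).add_mem (hG h (hx m)) ih
    rwa [sub_add_sub_cancel] at this

/-- An increasing filtration of a topological vector space by open subspaces with
finite-dimensional quotients, for which the space is complete. -/
structure IsLatticeFiltration {V : Type*} [AddCommGroup V] [Module k V] [TopologicalSpace V]
    (F : ℤ → Submodule k V) : Prop where
  mono : Monotone F
  isOpen : ∀ i, IsOpen (F i : Set V)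
  basis : ∀ N ∈ nhds (0 : V), ∃ i, (F i : Set V) ⊆ N
  exhaust : ∀ v, ∃ j, v ∈ F j
  separated : ∀ v, (∀ i, v ∈ F i) → v = 0
  finite : ∀ i j, ∃ T : Submodule k V, T.FG ∧ F j ≤ T ⊔ F i
  complete : ∀ x : ℕ → V, (∀ n : ℕ, x (n + 1) - x n ∈ F (-n)) → ∃ v, ∀ n : ℕ, v - x n ∈ F (-n)

namespace IsLatticeFiltration

section

variable {V : Type*} [AddCommGroup V] [Module k V] [TopologicalSpace V]
    {F : ℤ → Submodule k V}

theorem basis_nat (hF : IsLatticeFiltration F) (N : Set V) (hN : N ∈ nhds (0 : V)) :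
    ∃ n : ℕ, (F (-n) : Set V) ⊆ N := by
  obtain ⟨i, hi⟩ := hF.basis N hN
  exact ⟨(-i).toNat, fun v hv => hi (hF.mono (by omega) hv)⟩

theorem t2Space [IsTopologicalAddGroup V] (hF : IsLatticeFiltration F) : T2Space V :=
  t2Space_of_basis hF.isOpen hF.separated

theorem isLinearlyCompact [IsTopologicalAddGroup V] (hF : IsLatticeFiltration F) (j : ℤ) :
    IsLinearlyCompact k (F j) := by
  let G : ℕ → Submodule k (F j) := fun n => (F (-n)).submoduleOf (F j)
  have anti : Antitone G := fun n m h => Submodule.comap_mono (hF.mono (by simpa using h))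
  refine isLinearlyCompact_of_basis G (fun n => (hF.isOpen _).preimage continuous_subtype_val)
    (fun N hN => ?_) (fun v hv => ?_)
    (fun n => (finite_quotient_iff _ _).2 (hF.finite _ _)) (fun x hx => ?_)
  · rw [nhds_subtype_eq_comap, Filter.mem_comap] at hN
    obtain ⟨N', hN', h⟩ := hN
    obtain ⟨n, hn⟩ := hF.basis_nat N' hN'
    exact ⟨n, fun v hv => h (hn hv)⟩
  · refine Subtype.ext (hF.separated _ fun i => ?_)
    exact hF.mono (by omega) (hv (-i).toNat)
  · obtain ⟨v, hv⟩ := hF.complete (fun n => x n) hx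
    -- The limit taken in `V` lies in `F j`: at stage `n = (-j).toNat` the error is in `F (-n)`,
    -- which is contained in `F j`.
    have hj := hv (-j).toNat
    have hvj : v ∈ F j := by
      have h1 := (F j).add_mem (hF.mono (by omega) hj) (x (-j).toNat).2
      rwa [sub_add_cancel] at h1
    exact ⟨⟨v, hvj⟩, hv⟩

theorem rank_le [IsTopologicalAddGroup V] (hF : IsLatticeFiltration F) :
    Module.rank k (V ⧸ F 0) ≤ Cardinal.aleph0 := by
  have h : ∀ n : ℕ, ∃ s : Finset V, F n ≤ Submodule.span k s ⊔ F 0 := by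
    intro n
    obtain ⟨_, ⟨s, rfl⟩, hs⟩ := hF.finite 0 n
    exact ⟨s, hs⟩
  choose s hs using h
  let S : Set (V ⧸ F 0) := (F 0).mkQ '' ⋃ n, (s n : Set V)
  have hS : S.Countable := (Set.countable_iUnion fun n => (s n).countable_toSet).image _
  have hspan : Submodule.span k S = ⊤ := by
    rw [eq_top_iff]
    intro x _
    obtain ⟨v, rfl⟩ := (F 0).mkQ_surjective x
    obtain ⟨j, hj⟩ := hF.exhaust v
    have hv := hs j.toNat (hF.mono (by omega) hj)
    obtain ⟨t, ht, q, hq, rfl⟩ := Submodule.mem_sup.1 hv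
    have e : (F 0).mkQ (t + q) = (F 0).mkQ t := (Submodule.Quotient.eq _).2 (by simpa using hq)
    rw [e, Submodule.span_image]
    exact ⟨t, Submodule.span_mono (Set.subset_iUnion (fun n => (s n : Set V)) _) ht, rfl⟩
  rw [← rank_top, ← hspan]
  exact (rank_span_le S).trans (Cardinal.mk_le_aleph0_iff.2 hS.to_subtype)

theorem countable_nhds (hF : IsLatticeFiltration F) : (nhds (0 : V)).IsCountablyGenerated := by
  have : (nhds (0 : V)).HasBasis (fun _ : ℤ => True) fun i => (F i : Set V) :=
    ⟨fun N => ⟨fun hN => (hF.basis N hN).imp fun i hi => ⟨trivial, hi⟩, fun ⟨i, _, hi⟩ =>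
      Filter.mem_of_superset ((hF.isOpen i).mem_nhds (F i).zero_mem) hi⟩⟩
  exact Filter.HasCountableBasis.isCountablyGenerated ⟨this, Set.to_countable _⟩

end

end IsLatticeFiltration

theorem IsLatticeFiltration.isCountableLLC [TopologicalSpace k] {V : TopModuleCat.{u} k}
    {F : ℤ → Submodule k V} (hF : IsLatticeFiltration F) : IsCountableLLC k V where
  isLinearTopology := isLinearTopology_of_basis hF.isOpen hF.basis
  t2Space := hF.t2Space
  exists_open := ⟨F 0, hF.isOpen 0, hF.isLinearlyCompact 0⟩
  countable_nhds := hF.countable_nhds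
  countable_rank := ⟨F 0, hF.isOpen 0, hF.isLinearlyCompact 0, hF.rank_le⟩

theorem exists_seq_spanning {V : Type*} [AddCommGroup V] [Module k V] (U : Submodule k V)
    (hr : Module.rank k (V ⧸ U) ≤ Cardinal.aleph0) :
    ∃ w : ℕ → V, ∀ v, ∃ n : ℕ, v ∈ U ⊔ Submodule.span k (w '' Set.Iio n) := by
  let b := Module.Basis.ofVectorSpace k (V ⧸ U)
  rw [← b.mk_eq_rank'', Cardinal.mk_le_aleph0_iff] at hr
  -- Adding `0` makes the set nonempty, so that it can be enumerated by `ℕ` even when `V ⧸ U` is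
  -- zero.
  obtain ⟨f, hf⟩ := ((Set.countable_range b).insert 0).exists_eq_range (Set.insert_nonempty _ _)
  choose w hw using fun n => U.mkQ_surjective (f n)
  refine ⟨w, fun v => ?_⟩
  have key : ∀ x ∈ Submodule.span k (Set.range f), ∃ n : ℕ, ∀ v, U.mkQ v = x →
      v ∈ U ⊔ Submodule.span k (w '' Set.Iio n) := by
    have le : ∀ {n m : ℕ}, n ≤ m → U ⊔ Submodule.span k (w '' Set.Iio n) ≤
        U ⊔ Submodule.span k (w '' Set.Iio m) := fun h =>
      sup_le_sup_left (Submodule.span_mono (Set.image_mono (Set.Iio_subset_Iio h))) _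
    intro x hx
    induction hx using Submodule.span_induction with
    | mem x hx =>
      obtain ⟨m, rfl⟩ := hx
      refine ⟨m + 1, fun v hv => ?_⟩
      rw [← hw m] at hv
      have h1 : v - w m ∈ U := (Submodule.Quotient.eq U).1 hv
      have h2 : w m ∈ Submodule.span k (w '' Set.Iio (m + 1)) :=
        Submodule.subset_span ⟨m, Nat.lt_succ_self m, rfl⟩
      have := Submodule.add_mem_sup h1 h2
      rwa [sub_add_cancel] at this
    | zero => exact ⟨0, fun v hv => Submodule.mem_sup_left ((Submodule.Quotient.mk_eq_zero U).1 hv)⟩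
    | add x y _ _ hx hy =>
      obtain ⟨n, hn⟩ := hx
      obtain ⟨m, hm⟩ := hy
      obtain ⟨a, ha⟩ := U.mkQ_surjective x
      refine ⟨max n m, fun v hv => ?_⟩
      have h1 := le (le_max_left n m) (hn a ha)
      have h2 := le (le_max_right n m) (hm (v - a) (by rw [map_sub, hv, ha, add_sub_cancel_left]))
      have := Submodule.add_mem _ h1 h2
      rwa [add_sub_cancel] at this
    | smul c x _ hx =>
      obtain ⟨n, hn⟩ := hx
      refine ⟨n, fun v hv => ?_⟩
      obtain ⟨a, ha⟩ := U.mkQ_surjective x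
      have h1 := Submodule.smul_mem _ c (hn a ha)
      have h2 : v - c • a ∈ U := by
        apply (Submodule.Quotient.eq U).1
        exact hv.trans ((congrArg (c • ·) ha).symm.trans (map_smul U.mkQ c a).symm)
      have := Submodule.add_mem _ (Submodule.mem_sup_left h2) h1
      rwa [sub_add_cancel] at this
  have htop : U.mkQ v ∈ Submodule.span k (Set.range f) := by
    have : Submodule.span k (Set.range b) ≤ Submodule.span k (Set.range f) := by
      rw [← hf]
      exact Submodule.span_mono (Set.subset_insert _ _)
    exact this (by rw [b.span_eq]; trivial)
  obtain ⟨n, hn⟩ := key _ htop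
  exact ⟨n, hn v rfl⟩

/-- Above `U`, adjoin one more vector of a sequence spanning `V` modulo `U` at each step; below `U`,
intersect with a decreasing base of open subspaces. Linear compactness of `U` supplies both
finite-dimensional quotients and completeness. -/
theorem exists_isLatticeFiltration_of_linearlyCompact {V : Type*} [AddCommGroup V] [Module k V]
    [TopologicalSpace V] [IsTopologicalAddGroup V] [IsLinearTopology k V] [T2Space V]
    (hcg : (nhds (0 : V)).IsCountablyGenerated) (U : Submodule k V) (hU : IsOpen (U : Set V))
    (hUc : IsLinearlyCompact k U) (hr : Module.rank k (V ⧸ U) ≤ Cardinal.aleph0) :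
    ∃ F : ℤ → Submodule k V, IsLatticeFiltration F := by
  obtain ⟨N, hNo, hN⟩ := (IsLinearTopology.hasBasis_open_submodule k (M := V)).exists_antitone_subbasis
  obtain ⟨w, hw⟩ := exists_seq_spanning U hr
  obtain ⟨F, hpos, hneg⟩ : ∃ F : ℤ → Submodule k V,
      (∀ j, 0 ≤ j → F j = U ⊔ Submodule.span k (w '' Set.Iio j.toNat)) ∧
        ∀ j, j < 0 → F j = U ⊓ N (-j).toNat := by
    classical
    exact ⟨fun j => if 0 ≤ j then U ⊔ Submodule.span k (w '' Set.Iio j.toNat) else U ⊓ N (-j).toNat,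
      fun j hj => if_pos hj, fun j hj => if_neg (not_le.2 hj)⟩
  have hopen : ∀ j, IsOpen (F j : Set V) := by
    intro j
    rcases le_or_gt 0 j with hj | hj
    · rw [hpos j hj]
      exact Submodule.isOpen_mono le_sup_left hU
    · rw [hneg j hj]
      exact hU.inter (hNo _)
  have hnegU : ∀ j, j ≤ 0 → F j ≤ U := by
    intro j hj
    rcases hj.lt_or_eq with hj | rfl
    · rw [hneg j hj]; exact inf_le_left
    · rw [hpos 0 le_rfl]; simp
  have hN' : ∀ n : ℕ, F (-n) ≤ N n ∨ n = 0 := by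
    intro n
    rcases Nat.eq_zero_or_pos n with rfl | h
    · exact Or.inr rfl
    · left
      rw [hneg _ (by omega)]
      simp
  have hmono : Monotone F := by
    intro i j hij
    rcases le_or_gt 0 i with hi | hi
    · rw [hpos i hi, hpos j (hi.trans hij)]
      refine sup_le_sup_left (Submodule.span_mono (Set.image_mono (Set.Iio_subset_Iio ?_))) _
      omega
    · rcases le_or_gt 0 j with hj | hj
      · rw [hpos j hj]
        exact (hnegU i hi.le).trans le_sup_left
      · rw [hneg i hi, hneg j hj]
        exact inf_le_inf_left _ (hN.2 (by omega))
  have hbasis : ∀ S ∈ nhds (0 : V), ∃ i, (F i : Set V) ⊆ S := by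
    intro S hS
    obtain ⟨n, -, hn⟩ := hN.1.mem_iff.1 hS
    -- The step `F 0` is `U` itself, not `U ⊓ N 0`, so the index is shifted to be strictly negative.
    refine ⟨-(n + 1 : ℕ), fun v hv => hn (hN.2 (Nat.le_succ n) ?_)⟩
    exact (hN' (n + 1)).resolve_right (by omega) hv
  refine ⟨F, hmono, hopen, hbasis, fun v => ?_, fun v hv => ?_, fun i j => ?_, fun x hx => ?_⟩
  · obtain ⟨n, hn⟩ := hw v
    exact ⟨n, by rw [hpos _ (by omega)]; simpa using hn⟩
  · by_contra hne
    obtain ⟨i, hi⟩ := hbasis {v}ᶜ (isOpen_compl_singleton.mem_nhds fun h => hne h.symm)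
    exact hi (hv i) rfl
  · obtain ⟨T, hT, hUT⟩ := (finite_quotient_iff U (F (min i 0))).1
      (hUc.finite_quotient _ ((hopen _).preimage continuous_subtype_val))
    refine ⟨T ⊔ Submodule.span k (w '' Set.Iio (max j 0).toNat),
      hT.sup (Submodule.fg_span ((Set.finite_Iio _).image _)), ?_⟩
    have h1 := hmono (le_max_left j 0)
    rw [hpos _ (le_max_right j 0)] at h1
    refine h1.trans (sup_le (hUT.trans (sup_le ?_ ?_)) ?_)
    · exact le_sup_left.trans le_sup_left
    · exact (hmono (min_le_left _ _)).trans le_sup_right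
    · exact le_sup_right.trans le_sup_left
  · have hx' : ∀ n m : ℕ, n ≤ m → x m - x n ∈ F (-n) := fun n m h =>
      sub_mem_of_succ (G := fun n : ℕ => F (-n)) (fun a b h => hmono (by simpa using h)) hx h
    -- The terms `x n` need not lie in `U`, but the differences `x n - x 0` do; their limit is
    -- translated back by `x 0`.
    obtain ⟨v, hv⟩ := hUc.complete (fun n : ℕ => (F (-n)).submoduleOf U)
      (fun n => (hopen _).preimage continuous_subtype_val)
      (fun n => ⟨x n - x 0, hnegU 0 le_rfl (hx' 0 n (Nat.zero_le n))⟩)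
      fun n m h => by
        have := hx' n m h
        rw [← sub_sub_sub_cancel_right _ _ (x 0)] at this
        exact this
    refine ⟨v + x 0, fun n => ?_⟩
    have := hv n
    have e : (v : V) + x 0 - x n = v - (x n - x 0) := by abel
    rw [e]
    exact this

theorem exists_isLatticeFiltration_iff [TopologicalSpace k] (V : TopModuleCat.{u} k) :
    IsCountableLLC k V ↔ ∃ F : ℤ → Submodule k V, IsLatticeFiltration F := by
  constructor
  · intro h
    have := h.isLinearTopology
    have := h.t2Space
    obtain ⟨U, hU, hUc, hr⟩ := h.countable_rank
    exact exists_isLatticeFiltration_of_linearlyCompact h.countable_nhds U hU hUc hr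
  · rintro ⟨F, hF⟩
    exact hF.isCountableLLC

end

end TateSpaces

namespace TateSpaces

noncomputable section

/-! ### The graded diagram of a lattice filtration -/

variable {k : Type u} [Field k]

namespace IsLatticeFiltration

section

section

variable {V : Type*} [AddCommGroup V] [Module k V] {F : ℤ → Submodule k V}

theorem mkQ_eq_zero (i j : ℤ) (v : F j) :
    ((F i).submoduleOf (F j)).mkQ v = 0 ↔ (v : V) ∈ F i :=
  Submodule.Quotient.mk_eq_zero _

theorem mkQ_eq (i j : ℤ) (v w : F j) :
    ((F i).submoduleOf (F j)).mkQ v = ((F i).submoduleOf (F j)).mkQ w ↔ (v - w : V) ∈ F i :=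
  Submodule.Quotient.eq _

end

variable {V : Type u} [AddCommGroup V] [Module k V] [TopologicalSpace V] {F : ℤ → Submodule k V}

/-- The transition map `F j / F i → F j' / F i'`. -/
def grTr (hF : IsLatticeFiltration F) {i j i' j' : ℤ} (a : i ≤ i') (b : j ≤ j') :
    (F j ⧸ (F i).submoduleOf (F j)) →ₗ[k] (F j' ⧸ (F i').submoduleOf (F j')) :=
  Submodule.mapQ _ _ (Submodule.inclusion (hF.mono b)) fun _ hv => hF.mono a hv

/-- The space `F j / F i`. -/
def gr (hF : IsLatticeFiltration F) (i j : ℤ) : FGModuleCat.{u} k :=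
  haveI : Module.Finite k (F j ⧸ (F i).submoduleOf (F j)) :=
    (finite_quotient_iff _ _).2 (hF.finite _ _)
  FGModuleCat.of k (F j ⧸ (F i).submoduleOf (F j))

/-- The transition map `F j / F i → F j' / F i'`, as a morphism. -/
def grMap (hF : IsLatticeFiltration F) {i j i' j' : ℤ} (a : i ≤ i') (b : j ≤ j') :
    hF.gr i j ⟶ hF.gr i' j' :=
  ConcreteCategory.ofHom (C := FGModuleCat.{u} k) (X := hF.gr i j) (Y := hF.gr i' j') (hF.grTr a b)

/-- The diagram `(i, j) ↦ F j / F i`. -/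
def diagram (hF : IsLatticeFiltration F) : AdmDiagram k :=
  ⟨{ obj := fun p => hF.gr p.1.1 p.1.2
     map := fun f => hF.grMap (leOfHom f).1 (leOfHom f).2
     map_id := fun p => by
      apply FGModuleCat.hom_ext
      refine LinearMap.ext fun x => ?_
      obtain ⟨x, rfl⟩ := Submodule.mkQ_surjective _ x
      rfl
     map_comp := fun f g => by
      apply FGModuleCat.hom_ext
      refine LinearMap.ext fun x => ?_
      obtain ⟨x, rfl⟩ := Submodule.mkQ_surjective _ x
      rfl }, by
    intro i j l hij hjl
    refine ⟨?_, ?_, ?_⟩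
    · refine (injective_iff_map_eq_zero (hF.grTr (le_refl i) hjl)).2 fun x hx => ?_
      obtain ⟨x, rfl⟩ := Submodule.mkQ_surjective _ x
      exact (mkQ_eq_zero _ _ _).2 ((mkQ_eq_zero i l _).1 hx)
    · intro y
      change hF.grTr hij (le_refl l) y = 0 ↔ y ∈ Set.range (hF.grTr (le_refl i) hjl)
      obtain ⟨y, rfl⟩ := Submodule.mkQ_surjective _ y
      constructor
      · intro hy
        exact ⟨((F i).submoduleOf (F j)).mkQ ⟨y, (mkQ_eq_zero j l _).1 hy⟩, rfl⟩
      · rintro ⟨x, hx⟩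
        obtain ⟨x, rfl⟩ := Submodule.mkQ_surjective _ x
        have h : (x - y : V) ∈ F i := (mkQ_eq (F := F) i l ⟨x, hF.mono hjl x.2⟩ y).1 hx
        refine (mkQ_eq_zero j l y).2 ?_
        simpa using (F j).sub_mem x.2 (hF.mono hij h)
    · intro y
      obtain ⟨y, rfl⟩ := Submodule.mkQ_surjective _ y
      exact ⟨((F i).submoduleOf (F l)).mkQ y, rfl⟩⟩

end

/-- The model of the graded diagram of a lattice filtration. -/
def model [TopologicalSpace k] {V : TopModuleCat.{u} k} {F : ℤ → Submodule k V}
    (hF : IsLatticeFiltration F) : Model hF.diagram V where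
  F := F
  q {i j} _ := ((F i).submoduleOf (F j)).mkQ
  mono := hF.mono
  isOpen := hF.isOpen
  basis := hF.basis
  exhaust := hF.exhaust
  separated := hF.separated
  q_surjective _ := Submodule.mkQ_surjective _
  q_eq_zero _ v := mkQ_eq_zero _ _ v
  q_tr _ _ _ _ _ _ := rfl
  complete j x hx := by
    choose s hs using fun i (h : i ≤ j) => ((F i).submoduleOf (F j)).mkQ_surjective (x i h)
    have key : ∀ i i' (a : i ≤ i') (h : i' ≤ j),
        (s i (a.trans h) - s i' h : V) ∈ F i' := fun i i' a h => by
      refine (mkQ_eq i' j _ _).1 ?_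
      rw [hs i' h, ← hx i i' a h, ← hs i (a.trans h)]
      rfl
    -- Representatives exist only for indices at most `j`, hence the `min`.
    obtain ⟨v, hv⟩ := hF.complete (fun n => s (min (-n) j) (min_le_right _ _)) fun n =>
      hF.mono (min_le_left _ _) (key (min (-(n + 1 : ℕ)) j) (min (-n) j)
        (min_le_min_right _ (by push_cast; omega)) (min_le_right _ _))
    have hvj : v ∈ F j := by
      have := (F j).add_mem (hF.mono (by omega) (hv (-j).toNat))
        (s (min (-((-j).toNat : ℤ)) j) (min_le_right _ _)).2
      rwa [sub_add_cancel] at this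
    refine ⟨⟨v, hvj⟩, fun i h => ?_⟩
    refine Eq.trans ?_ (hs i h)
    refine (mkQ_eq i j _ _).2 ?_
    have := (F i).add_mem (hF.mono (by omega) (hv (-i).toNat))
      (key (min (-((-i).toNat : ℤ)) j) i (by omega) h)
    rwa [sub_add_sub_cancel] at this

end IsLatticeFiltration

theorem Model.isLatticeFiltration [TopologicalSpace k] {X : AdmDiagram k} {V : TopModuleCat.{u} k}
    (M : Model X V) : IsLatticeFiltration M.F where
  mono := M.mono
  isOpen := M.isOpen
  basis := M.basis
  exhaust := M.exhaust
  separated := M.separated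
  finite i j := by
    rcases le_total i j with h | h
    · refine (finite_quotient_iff _ _).1 ?_
      have e : (M.F i).submoduleOf (M.F j) = LinearMap.ker (M.q h) := by
        ext v
        exact (M.q_eq_zero h v).symm
      rw [e]
      exact Module.Finite.equiv ((M.q h).quotKerEquivOfSurjective (M.q_surjective h)).symm
    · exact ⟨⊥, Submodule.fg_bot, (M.mono h).trans le_sup_right⟩
  complete x hx := by
    have hx' : ∀ n m : ℕ, n ≤ m → x m - x n ∈ M.F (-n) := fun n m h =>
      sub_mem_of_succ (G := fun n : ℕ => M.F (-n)) (fun a b h => M.mono (by simpa using h)) hx h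
    obtain ⟨j₀, hj₀⟩ := M.exhaust (x 0)
    let j := max j₀ 0
    -- All terms lie in one step because `x n - x 0 ∈ M.F 0`. The completeness of the model at this
    -- level then applies, with class at index `i` given by the term `x (-i).toNat`.
    have hj : ∀ n, x n ∈ M.F j := fun n => by
      have := (M.F j).add_mem (M.mono (by simp [j]) (hx' 0 n (Nat.zero_le n)))
        (M.mono (le_max_left _ _) hj₀)
      rwa [sub_add_cancel] at this
    obtain ⟨v, hv⟩ := M.complete j (fun i h => M.q h ⟨x (-i).toNat, hj _⟩) fun i i' a h => by
      rw [← M.q_tr (a.trans h) h a le_rfl _ (hj _), ← sub_eq_zero, ← map_sub, M.q_eq_zero]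
      exact M.mono (by omega) (hx' (-i').toNat (-i).toNat (by omega))
    refine ⟨v, fun n => ?_⟩
    have hn : -(n : ℤ) ≤ j := by simp only [j]; omega
    have := hv (-n) hn
    rw [← sub_eq_zero, ← map_sub, M.q_eq_zero] at this
    simpa using this

theorem realization_essImage_iff_isCountableLLC [TopologicalSpace k] [DiscreteTopology k]
    (V : TopModuleCat.{u} k) : (realization k).essImage V ↔ IsCountableLLC k V := by
  rw [realization_essImage_iff, exists_isLatticeFiltration_iff]
  constructor
  · rintro ⟨X, ⟨M⟩⟩
    exact ⟨M.F, M.isLatticeFiltration⟩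
  · rintro ⟨F, hF⟩
    exact ⟨_, ⟨hF.model⟩⟩

/-! ### Subspaces and quotients -/

namespace IsLatticeFiltration

section

variable {V W : Type*} [AddCommGroup V] [Module k V] [TopologicalSpace V] [IsTopologicalAddGroup V]
  [AddCommGroup W] [Module k W] [TopologicalSpace W] {F : ℤ → Submodule k V}

/-- The filtration induced on a closed subspace. -/
theorem comap (hF : IsLatticeFiltration F) (i : W →ₗ[k] V) (hi : Topology.IsClosedEmbedding i) :
    IsLatticeFiltration fun j => (F j).comap i where
  mono _ _ h := Submodule.comap_mono (hF.mono h)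
  isOpen j := (hF.isOpen j).preimage hi.continuous
  basis N hN := by
    rw [hi.isInducing.nhds_eq_comap, map_zero] at hN
    obtain ⟨N', hN', h⟩ := hN
    obtain ⟨j, hj⟩ := hF.basis N' hN'
    exact ⟨j, fun v hv => h (hj hv)⟩
  exhaust v := hF.exhaust (i v)
  separated v hv := hi.injective ((hF.separated _ hv).trans (map_zero i).symm)
  finite a b := by
    obtain ⟨T, hT, h⟩ := hF.finite a b
    have hfin := (finite_quotient_iff (F b) (F a)).2 ⟨T, hT, h⟩
    refine (finite_quotient_iff _ _).1 ?_
    let f : (F b).comap i →ₗ[k] F b := i.restrict fun _ hv => hv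
    let g : _ ⧸ ((F a).comap i).submoduleOf ((F b).comap i) →ₗ[k] F b ⧸ (F a).submoduleOf (F b) :=
      Submodule.mapQ _ _ f fun _ hv => hv
    refine Module.Finite.of_injective g ((injective_iff_map_eq_zero g).2 fun x hx => ?_)
    obtain ⟨x, rfl⟩ := Submodule.mkQ_surjective _ x
    exact (mkQ_eq_zero (F := fun j => (F j).comap i) a b x).2 ((mkQ_eq_zero a b (f x)).1 hx)
  complete x hx := by
    obtain ⟨v, hv⟩ := hF.complete (fun n => i (x n)) fun n => by
      rw [← map_sub]; exact hx n
    -- Closedness of the range keeps the limit inside the subspace.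
    obtain ⟨w, rfl⟩ : v ∈ Set.range i :=
      mem_of_isClosed_of_basis hF.basis_nat hi.isClosed_range fun n => ⟨i (x n), ⟨_, rfl⟩, by
        rw [← neg_mem_iff, neg_sub]; exact hv n⟩
    exact ⟨w, fun n => by simpa using hv n⟩

/-- The filtration induced on a Hausdorff quotient. -/
theorem map (hF : IsLatticeFiltration F) (p : V →ₗ[k] W) (hp : IsOpenQuotientMap p)
    (hK : IsClosed (LinearMap.ker p : Set V)) : IsLatticeFiltration fun j => (F j).map p where
  mono _ _ h := Submodule.map_mono (hF.mono h)
  isOpen j := hp.isOpenMap _ (hF.isOpen j)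
  basis N hN := by
    obtain ⟨j, hj⟩ := hF.basis (p ⁻¹' N) (hp.continuous.continuousAt.preimage_mem_nhds
      (by rwa [map_zero]))
    exact ⟨j, by rintro _ ⟨v, hv, rfl⟩; exact hj hv⟩
  exhaust w := by
    obtain ⟨v, rfl⟩ := hp.surjective w
    obtain ⟨j, hj⟩ := hF.exhaust v
    exact ⟨j, v, hj, rfl⟩
  separated w hw := by
    obtain ⟨v, rfl⟩ := hp.surjective w
    -- A vector whose image lies in every `p (F n)` is approximated by `ker p` modulo every `F n`.
    refine mem_of_isClosed_of_basis hF.basis hK fun n => ?_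
    obtain ⟨x, hx, e⟩ := hw n
    refine ⟨v - x, ?_, ?_⟩
    · rw [SetLike.mem_coe, LinearMap.mem_ker, map_sub, e, sub_self]
    · simpa using hx
  finite a b := by
    obtain ⟨T, hT, h⟩ := hF.finite a b
    refine ⟨T.map p, hT.map p, ?_⟩
    rw [← Submodule.map_sup]
    exact Submodule.map_mono h
  complete y hy := by
    choose d hd hd' using hy
    obtain ⟨x₀, hx₀⟩ := hp.surjective (y 0)
    -- Each increment of `y` lifts to some `d n ∈ F (-n)`; the partial sums form a lift of `y` to
    -- which completeness of `V` applies.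
    let x : ℕ → V := fun n => x₀ + ∑ m ∈ Finset.range n, d m
    have hx : ∀ n, p (x n) = y n := fun n => by
      simp only [x, map_add, map_sum, hx₀, hd', Finset.sum_range_sub, add_sub_cancel]
    obtain ⟨v, hv⟩ := hF.complete x fun n => by
      simp only [x, Finset.sum_range_succ, add_sub_add_left_eq_sub, add_sub_cancel_left]
      exact hd n
    exact ⟨p v, fun n => ⟨v - x n, hv n, by rw [map_sub, hx]⟩⟩

end

end IsLatticeFiltration

end

end TateSpaces

namespace TateSpaces

noncomputable section

/-! ### The open mapping theorem -/

variable {k : Type u} [Field k]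

namespace IsLatticeFiltration

variable {V W : Type*} [AddCommGroup V] [Module k V] [TopologicalSpace V] [IsTopologicalAddGroup V]
  [AddCommGroup W] [Module k W] [TopologicalSpace W] [IsTopologicalAddGroup W]
  {F : ℤ → Submodule k V} {G : ℤ → Submodule k W}

/-- The image of a step of the filtration is closed. -/
theorem mem_map_of_forall (hF : IsLatticeFiltration F) (hG : IsLatticeFiltration G)
    (f : V →ₗ[k] W) (hf : Continuous f) (j : ℤ) (y : W)
    (hy : ∀ n : ℕ, ∃ x ∈ F j, f x - y ∈ G (-n)) : y ∈ (F j).map f := by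
  -- `S n` consists of the points of `F j` mapping into `y + G (-n)`. These are closed, nonempty and
  -- decreasing, so linear compactness of `F j` gives a common point, which maps to `y`.
  let S : ℕ → AffineSubspace k (F j) := fun n =>
    (AffineSubspace.mk' y (G (-n))).comap (f ∘ₗ (F j).subtype).toAffineMap
  have hS : ∀ n x, x ∈ S n ↔ f x - y ∈ G (-n) := fun n x => by
    rw [AffineSubspace.mem_comap, AffineSubspace.mem_mk', vsub_eq_sub]
    rfl
  obtain ⟨x, hx⟩ := (hF.isLinearlyCompact j).exists_forall_mem S (fun n => by
    have : (S n : Set (F j)) = (fun x : F j => f x - y) ⁻¹' (G (-n)) := Set.ext (hS n)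
    rw [this]
    exact (isClosed_submodule_of_isOpen _ (hG.isOpen _)).preimage
      ((hf.comp continuous_subtype_val).sub continuous_const)) fun t => by
    obtain ⟨x, hx, hxy⟩ := hy (t.sup id)
    refine ⟨⟨x, hx⟩, fun n hn => (hS _ _).2 (hG.mono ?_ hxy)⟩
    have := Finset.le_sup (f := id) hn
    simpa using this
  refine ⟨x, x.2, ?_⟩
  rw [← sub_eq_zero]
  exact hG.separated _ fun i => hG.mono (by omega) ((hS (-i).toNat x).1 (hx _))

/-- If the space is a countable union of images of steps of a filtration, one of them is open. -/
theorem exists_le_map (hF : IsLatticeFiltration F) (hG : IsLatticeFiltration G)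
    (f : V →ₗ[k] W) (hf : Continuous f) (hs : Function.Surjective f) :
    ∃ n m : ℕ, G (-m) ≤ (F n).map f := by
  by_contra! H
  -- Baire argument: a pair `(y, m)` stands for the coset `y + G (-m)`. Inside any such coset there
  -- is a smaller one disjoint from the image of `F n`.
  have step : ∀ (n : ℕ) (s : W × ℕ), ∃ t : W × ℕ, t.1 - s.1 ∈ G (-s.2) ∧ s.2 < t.2 ∧
      ∀ x ∈ F n, f x - t.1 ∉ G (-t.2) := by
    intro n s
    obtain ⟨z, hz, hz'⟩ := SetLike.not_le_iff_exists.1 (H n s.2)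
    obtain ⟨y, hy, hy'⟩ : ∃ y, y - s.1 ∈ G (-s.2) ∧ y ∉ (F n).map f := by
      by_cases h : s.1 ∈ (F n).map f
      · refine ⟨z + s.1, by simpa using hz, fun h' => hz' ?_⟩
        simpa using Submodule.sub_mem _ h' h
      · exact ⟨s.1, by simp, h⟩
    -- The image of `F n` is closed, so it misses a whole neighbourhood of `y`.
    obtain ⟨m, hm⟩ : ∃ m : ℕ, ∀ x ∈ F n, f x - y ∉ G (-m) := by
      by_contra! h
      exact hy' (hF.mem_map_of_forall hG f hf n y h)
    refine ⟨(y, max m (s.2 + 1)), hy, by simp, fun x hx h => hm x hx (hG.mono ?_ h)⟩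
    simp
  choose g hg hg' hg'' using step
  let s : ℕ → W × ℕ := fun n => Nat.rec (0, 0) g n
  have hsucc : ∀ n, s (n + 1) = g n (s n) := fun n => rfl
  have hmono : StrictMono fun n => (s n).2 := strictMono_nat_of_lt_succ fun n => by
    rw [hsucc]
    exact hg' n (s n)
  have hsub : ∀ n m, n ≤ m → (s m).1 - (s n).1 ∈ G (-(s n).2) := fun n m h =>
    sub_mem_of_succ (G := fun n => G (-(s n).2))
      (fun a b h => hG.mono (by simpa using hmono.monotone h)) (x := fun n => (s n).1)
      (fun n => hg n (s n)) h
  obtain ⟨y, hy⟩ := hG.complete (fun n => (s n).1) fun n =>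
    hG.mono (by simpa using hmono.id_le n) (hsub n (n + 1) (Nat.le_succ n))
  have hy' : ∀ n, y - (s n).1 ∈ G (-(s n).2) := fun n => by
    have h1 := hG.mono (b := -((s n).2 : ℤ)) (by simp) (hy (n + (s n).2))
    have := (G (-(s n).2)).add_mem h1 (hsub n (n + (s n).2) (Nat.le_add_right _ _))
    rwa [sub_add_sub_cancel] at this
  obtain ⟨x, rfl⟩ := hs y
  obtain ⟨j, hj⟩ := hF.exhaust x
  -- A preimage of the limit lies in some `F j`, while the limit lies in a coset chosen to avoid the
  -- image of that step.
  exact hg'' j.toNat (s j.toNat) x (hF.mono (by omega) hj) (hy' (j.toNat + 1))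

/-- The open mapping theorem. -/
theorem isOpenMap (hF : IsLatticeFiltration F) (hG : IsLatticeFiltration G)
    (f : V →ₗ[k] W) (hf : Continuous f) (hs : Function.Surjective f) : IsOpenMap f := by
  obtain ⟨n, m, hnm⟩ := hF.exists_le_map hG f hf hs
  -- Openness of the image of one step `F n` is transferred to every `F i`, using that `F n ≤ T ⊔ F
  -- i` with `T` finitely generated.
  have key : ∀ i : ℤ, ∃ l : ℤ, G l ≤ (F i).map f := by
    intro i
    obtain ⟨T, hT, hTF⟩ := hF.finite i n
    have hle : G (-m) ≤ T.map f ⊔ (F i).map f := by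
      rw [← Submodule.map_sup]
      exact hnm.trans (Submodule.map_mono hTF)
    have : Module.Finite k (T.map f) := Module.Finite.iff_fg.2 (hT.map f)
    -- The traces of `G (-l) + f (F i)` on the finite-dimensional space `f T` decrease, hence
    -- stabilize. An element of the stable trace lies in the closure of `f (F i)`, which is closed.
    let P : ℕ →o (Submodule k (T.map f))ᵒᵈ :=
      ⟨fun l => OrderDual.toDual ((G (-l) ⊔ (F i).map f).comap (T.map f).subtype),
        fun a b h => Submodule.comap_mono (sup_le_sup_right (hG.mono (by simpa using h)) _)⟩
    obtain ⟨l, hl⟩ := monotone_stabilizes_iff_artinian.2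
      (inferInstanceAs (IsArtinian k (T.map f))) P
    refine ⟨-(max l m : ℕ), fun y hy => ?_⟩
    obtain ⟨t, ht, z, hz, rfl⟩ := Submodule.mem_sup.1 (hle (hG.mono (by simp) hy))
    have ht' : ∀ l' : ℕ, t ∈ G (-l') ⊔ (F i).map f := by
      have h1 : t ∈ G (-l) ⊔ (F i).map f := by
        have hy' : t + z ∈ G (-l) := hG.mono (by simp) hy
        have := Submodule.sub_mem _ (Submodule.mem_sup_left hy') (Submodule.mem_sup_right hz)
        rwa [add_sub_cancel_right] at this
      intro l'
      have h2 : (⟨t, ht⟩ : T.map f) ∈ OrderDual.ofDual (P (max l l')) := by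
        rw [← hl _ (le_max_left _ _)]
        exact h1
      exact sup_le_sup_right (hG.mono (by simp)) _ h2
    refine hF.mem_map_of_forall hG f hf i _ fun l' => ?_
    obtain ⟨a, ha, _, ⟨b, hb, rfl⟩, e⟩ := Submodule.mem_sup.1 (ht' l')
    obtain ⟨c, hc, rfl⟩ := hz
    refine ⟨b + c, (F i).add_mem hb hc, ?_⟩
    rw [← e, map_add, add_sub_add_right_eq_sub, sub_add_cancel_right]
    exact neg_mem ha
  refine IsTopologicalAddGroup.isOpenMap_iff_nhds_zero (f := f.toAddMonoidHom) |>.2 fun N hN => ?_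
  obtain ⟨i, hi⟩ := hF.basis _ hN
  obtain ⟨l, hl⟩ := key i
  refine Filter.mem_of_superset ((hG.isOpen l).mem_nhds (G l).zero_mem) fun y hy => ?_
  obtain ⟨x, hx, rfl⟩ := hl hy
  exact hi hx

end IsLatticeFiltration

end

end TateSpaces

namespace TateSpaces

noncomputable section

/-! ### Exact sequences of filtered spaces -/

variable {k : Type u} [Field k]

section FiniteDimensional

variable {U V W O : FGModuleCat.{u} k} {f : U ⟶ V} {g : V ⟶ W}

theorem isPullback_of_exact (hf : Function.Injective f.hom.hom)
    (h : Function.Exact f.hom.hom g.hom.hom) (hO : IsZero O) (s : U ⟶ O) (t : O ⟶ W) :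
    IsPullback f s g t := by
  have ht : t = 0 := hO.eq_of_src _ _
  have w : f ≫ g = s ≫ t := by
    rw [ht, comp_zero]
    apply FGModuleCat.hom_ext
    exact h.linearMap_comp_eq_zero
  have : Mono f := ConcreteCategory.mono_of_injective f hf
  have hl : ∀ {P : FGModuleCat.{u} k} (a : P ⟶ V), a ≫ g = 0 → ∃ l : P ⟶ U, l ≫ f = a := by
    intro P a ha
    have h0 : ∀ x, g.hom.hom (a.hom.hom x) = 0 := fun x =>
      congrArg (fun r : P ⟶ W => r.hom.hom x) ha
    have hr : ∀ x, a.hom.hom x ∈ LinearMap.range f.hom.hom := fun x => (h _).1 (h0 x)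
    refine ⟨FGModuleCat.ofHom ((LinearEquiv.ofInjective f.hom.hom hf).symm.toLinearMap ∘ₗ
      a.hom.hom.codRestrict _ hr), ?_⟩
    apply FGModuleCat.hom_ext
    refine LinearMap.ext fun x => ?_
    exact congrArg Subtype.val
      ((LinearEquiv.ofInjective f.hom.hom hf).apply_symm_apply ⟨a.hom.hom x, hr x⟩)
  have hl' : ∀ c : PullbackCone g t, ∃ l : c.pt ⟶ U, l ≫ f = c.fst := fun c =>
    hl c.fst (c.condition.trans ((congrArg (c.snd ≫ ·) ht).trans comp_zero))
  choose l hl using hl'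
  exact ⟨⟨w⟩, ⟨PullbackCone.IsLimit.mk _ l hl (fun _ => hO.eq_of_tgt _ _)
    fun c m hm _ => (cancel_mono f).1 (hm.trans (hl c).symm)⟩⟩

theorem isPushout_of_exact (h : Function.Exact f.hom.hom g.hom.hom)
    (hg : Function.Surjective g.hom.hom) (hO : IsZero O) (s : U ⟶ O) (t : O ⟶ W) :
    IsPushout f s g t := by
  have ht : t = 0 := hO.eq_of_src _ _
  have hs : s = 0 := hO.eq_of_tgt _ _
  have w : f ≫ g = s ≫ t := by
    rw [ht, comp_zero]
    apply FGModuleCat.hom_ext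
    exact h.linearMap_comp_eq_zero
  have : Epi g := ConcreteCategory.epi_of_surjective g hg
  have hl : ∀ {P : FGModuleCat.{u} k} (a : V ⟶ P), f ≫ a = 0 → ∃ l : W ⟶ P, g ≫ l = a := by
    intro P a ha
    have h0 : ∀ x, a.hom.hom (f.hom.hom x) = 0 := fun x =>
      congrArg (fun r : U ⟶ P => r.hom.hom x) ha
    have hr : LinearMap.ker g.hom.hom ≤ LinearMap.ker a.hom.hom := by
      intro x hx
      obtain ⟨y, rfl⟩ := (h x).1 hx
      exact h0 y
    let e := g.hom.hom.quotKerEquivOfSurjective hg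
    refine ⟨FGModuleCat.ofHom ((LinearMap.ker g.hom.hom).liftQ a.hom.hom hr ∘ₗ
      e.symm.toLinearMap), ?_⟩
    apply FGModuleCat.hom_ext
    refine LinearMap.ext fun x => ?_
    have : e.symm (g.hom.hom x) = Submodule.Quotient.mk x := by
      rw [LinearEquiv.symm_apply_eq]
      rfl
    exact congrArg ((LinearMap.ker g.hom.hom).liftQ a.hom.hom hr) this
  have hl' : ∀ c : PushoutCocone f s, ∃ l : W ⟶ c.pt, g ≫ l = c.inl := fun c =>
    hl c.inl (c.condition.trans ((congrArg (· ≫ c.inr) hs).trans zero_comp))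
  choose l hl using hl'
  exact ⟨⟨w⟩, ⟨PushoutCocone.IsColimit.mk _ l hl (fun _ => hO.eq_of_src _ _)
    fun c m hm _ => (cancel_epi g).1 (hm.trans (hl c).symm)⟩⟩

end FiniteDimensional

theorem isZero_of_punit (k : Type u) [Field k] : IsZero (FGModuleCat.of.{u} k PUnit) :=
  ⟨fun Y => ⟨⟨⟨0⟩, fun f => by
    apply FGModuleCat.hom_ext
    refine LinearMap.ext fun x => ?_
    exact map_zero f.hom.hom⟩⟩, fun Y => ⟨⟨⟨0⟩, fun f => by
    apply FGModuleCat.hom_ext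
    rfl⟩⟩⟩

theorem isZero_of_isTerminal_of_isInitial {C : Type*} [Category* C] {O : C} (h : IsTerminal O)
    (h' : IsInitial O) : IsZero O :=
  ⟨fun Y => ⟨⟨⟨h'.to Y⟩, fun _ => h'.hom_ext _ _⟩⟩, fun Y => ⟨⟨⟨h.from Y⟩, fun _ => h.hom_ext _ _⟩⟩⟩

/-- The functor preserves terminal and initial objects, so no additive structure is needed. -/
theorem isZero_indProLim {O : Pairs ⥤ FGModuleCat.{u} k} (h : IsZero O) :
    IsZero ((indProLim k).obj O) :=
  isZero_of_isTerminal_of_isInitial (h.isTerminal.isTerminalObj (indProLim k))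
    (h.isInitial.isInitialObj (indProLim k))

theorem toIndPro_map_Q {X Y : AdmDiagram k} (g : X ⟶ Y) :
    (toIndPro k).map ((shiftMaps k).Q.map g) = (indProLim k).map g.hom :=
  Category.id_comp _

/-- A levelwise short exact sequence of diagrams is an admissible short exact sequence. -/
theorem tate_isAdmissibleExact_of_levelwise {X Y Z : AdmDiagram k} (g : X ⟶ Y) (g' : Y ⟶ Z)
    (inj : ∀ (i j : ℤ) (h : i ≤ j), Function.Injective (AdmDiagram.app g h))
    (ex : ∀ (i j : ℤ) (h : i ≤ j), Function.Exact (AdmDiagram.app g h) (AdmDiagram.app g' h))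
    (surj : ∀ (i j : ℤ) (h : i ≤ j), Function.Surjective (AdmDiagram.app g' h)) :
    Tate.IsAdmissibleExact k ((shiftMaps k).Q.map g) ((shiftMaps k).Q.map g') := by
  let O : Pairs ⥤ FGModuleCat.{u} k := (Functor.const Pairs).obj (FGModuleCat.of k PUnit)
  have hO : ∀ p, IsZero (O.obj p) := fun _ => isZero_of_punit k
  have hO' : IsZero O := Functor.isZero _ hO
  have h1 : IsPullback g.hom (0 : X.obj ⟶ O) g'.hom 0 :=
    IsPullback.of_forall_isPullback_app fun p =>
      isPullback_of_exact (inj p.1.1 p.1.2 p.2) (ex p.1.1 p.1.2 p.2) (hO p) _ _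
  have h2 : IsPushout g.hom (0 : X.obj ⟶ O) g'.hom 0 :=
    IsPushout.of_forall_isPushout_app fun p =>
      isPushout_of_exact (ex p.1.1 p.1.2 p.2) (surj p.1.1 p.1.2 p.2) (hO p) _ _
  unfold Tate.IsAdmissibleExact
  rw [toIndPro_map_Q, toIndPro_map_Q]
  exact ⟨_, isZero_indProLim hO', _, _, h1.map (indProLim k), h2.map (indProLim k)⟩

variable [TopologicalSpace k] [DiscreteTopology k]

/-- A strictly exact sequence of filtered spaces is an admissible short exact sequence. -/
theorem isAdmissibleExact_of_exact {A B C : TopModuleCat.{u} k} {i : A ⟶ B} {p : B ⟶ C}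
    {F : ℤ → Submodule k B} (hF : IsLatticeFiltration F) (hi : Topology.IsClosedEmbedding i.hom)
    (hp : IsOpenQuotientMap p.hom) (hex : Function.Exact i.hom p.hom) :
    IsAdmissibleExact i p := by
  have hK : IsClosed (LinearMap.ker p.hom.toLinearMap : Set B) := by
    have : (LinearMap.ker p.hom.toLinearMap : Set B) = Set.range i.hom := Set.ext hex
    rw [this]
    exact hi.isClosed_range
  -- With the preimage filtration on `A` and the image filtration on `C`, both maps are strict, so
  -- strict exactness passes to all graded pieces.
  let MA := (hF.comap i.hom.toLinearMap hi).model
  let MB := hF.model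
  let MC := (hF.map p.hom.toLinearMap hp hK).model
  obtain ⟨g, hg⟩ := exists_diagram_hom MA MB i fun j v hv => hv
  obtain ⟨g', hg'⟩ := exists_diagram_hom MB MC p fun j v hv => ⟨v, hv, rfl⟩
  obtain ⟨eA, hA⟩ := exists_iso (tateModel _) MA
  obtain ⟨eB, hB⟩ := exists_iso (tateModel _) MB
  obtain ⟨eC, hC⟩ := exists_iso (tateModel _) MC
  refine ⟨_, _, _, (shiftMaps k).Q.map g, (shiftMaps k).Q.map g', ?_, eA, eB, eC, ?_, ?_⟩
  · refine tate_isAdmissibleExact_of_levelwise g g' (fun a b h => ?_) (fun a b h => ?_)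
      fun a b h => ?_
    · refine (injective_iff_map_eq_zero _).2 fun x hx => ?_
      obtain ⟨⟨v, hv⟩, rfl⟩ := MA.q_surjective h x
      rw [← hg.q h v hv, MB.q_eq_zero] at hx
      exact (MA.q_eq_zero h _).2 hx
    · intro x
      obtain ⟨⟨v, hv⟩, rfl⟩ := MB.q_surjective h x
      rw [← hg'.q h v hv, MC.q_eq_zero]
      constructor
      · rintro ⟨c, hc, e⟩
        obtain ⟨w, hw⟩ := (hex (v - c)).1 ((map_sub p.hom v c).trans (sub_eq_zero.2 e.symm))
        have hwb : w ∈ MA.F b := by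
          change i.hom w ∈ MB.F b
          rw [hw]
          exact (MB.F b).sub_mem hv (MB.mono h hc)
        refine ⟨MA.q h ⟨w, hwb⟩, ?_⟩
        rw [← hg.q h w hwb, ← sub_eq_zero, ← map_sub, MB.q_eq_zero]
        change i.hom w - v ∈ MB.F a
        rw [hw, sub_sub_cancel_left]
        exact neg_mem hc
      · rintro ⟨y, hy⟩
        obtain ⟨⟨w, hw⟩, rfl⟩ := MA.q_surjective h y
        rw [← hg.q h w hw, ← sub_eq_zero, ← map_sub, MB.q_eq_zero] at hy
        have hy' : v - i.hom w ∈ MB.F a := by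
          rw [← neg_mem_iff, neg_sub]
          exact hy
        refine ⟨_, hy', ?_⟩
        exact (map_sub p.hom v (i.hom w)).trans (by rw [hex.apply_apply_eq_zero, sub_zero])
    · intro x
      obtain ⟨⟨_, v, hv, rfl⟩, rfl⟩ := MC.q_surjective h x
      exact ⟨MB.q h ⟨v, hv⟩, (hg'.q h v hv).symm⟩
  · have c1 := (realization_compat g).comp hB
    have c2 := hA.comp hg
    rw [Category.comp_id] at c1
    rw [Category.id_comp] at c2
    exact c1.hom_unique c2
  · have c1 := (realization_compat g').comp hC
    have c2 := hB.comp hg'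
    rw [Category.comp_id] at c1
    rw [Category.id_comp] at c2
    exact c1.hom_unique c2

end

end TateSpaces

namespace TateSpaces

noncomputable section

/-! ### Admissible short exact sequences are strictly exact -/

variable {k : Type u} [Field k] [TopologicalSpace k]

theorem isHomeomorph_quotientKerMap_iff {B C : TopModuleCat.{u} k} (p : B ⟶ C)
    (hp : Function.Surjective p.hom) : IsHomeomorph (quotientKerMap p) ↔ IsOpenMap p.hom := by
  have hq := (LinearMap.ker p.hom.toLinearMap).isOpenQuotientMap_mkQ
  constructor
  · intro h
    exact h.isOpenMap.comp hq.isOpenMap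
  · intro h
    refine ⟨hq.isQuotientMap.continuous_iff.2 p.hom.continuous, fun U hU => ?_, ?_, fun z => ?_⟩
    · have := h _ (hU.preimage hq.continuous)
      convert this using 1
      ext z
      constructor
      · rintro ⟨x, hx, rfl⟩
        obtain ⟨x, rfl⟩ := Submodule.mkQ_surjective _ x
        exact ⟨x, hx, rfl⟩
      · rintro ⟨x, hx, rfl⟩
        exact ⟨_, hx, rfl⟩
    · refine (injective_iff_map_eq_zero (quotientKerMap p)).2 fun x hx => ?_
      obtain ⟨x, rfl⟩ := Submodule.mkQ_surjective _ x
      exact (Submodule.Quotient.mk_eq_zero _).2 hx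
    · obtain ⟨x, rfl⟩ := hp z
      exact ⟨(LinearMap.ker p.hom.toLinearMap).mkQ x, rfl⟩

variable [DiscreteTopology k]

/-- Taking points preserves finite limits, so the kernel square becomes a pullback of sets, with a
singleton in place of the zero object. Cokernels need not be preserved, so surjectivity of `p`
requires a separate argument. -/
theorem injective_exact_of_tate_isAdmissibleExact {X Y Z : Tate k} {i : X ⟶ Y} {p : Y ⟶ Z}
    (h : Tate.IsAdmissibleExact k i p) :
    Function.Injective ((realization k).map i).hom ∧
      Function.Exact ((realization k).map i).hom ((realization k).map p).hom := by
  obtain ⟨O, hO, s, t, h, -⟩ := h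
  have sub : ∀ x y : (IndPro.points k).obj O, x = y := fun x y => by
    have e := (hO.isTerminal.isTerminalObj (IndPro.points k)).hom_ext
      (TypeCat.ofHom fun _ : PUnit.{u + 1} => x) (TypeCat.ofHom fun _ : PUnit.{u + 1} => y)
    exact congrArg (fun f => f PUnit.unit) e
  let α := toIndProCompPoints k
  have hp : IsPullback ((forgetTop k).map ((realization k).map i))
      ((α.app X).inv ≫ (IndPro.points k).map s) ((forgetTop k).map ((realization k).map p))
      ((IndPro.points k).map t ≫ (α.app Z).hom) := by
    refine IsPullback.of_iso (h.map (IndPro.points k)) (α.app X) (α.app Y) (Iso.refl _) (α.app Z)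
      ?_ ?_ ?_ ?_
    · exact α.hom.naturality i
    · simp
    · exact α.hom.naturality p
    · simp
  obtain ⟨w, hinj, hex⟩ := (Types.isPullback_iff _ _ _ _).1 hp
  refine ⟨fun x y hxy => hinj x y ⟨hxy, sub _ _⟩, ?_⟩
  have hw : ∀ x y, ((realization k).map p).hom (((realization k).map i).hom x) =
      ((IndPro.points k).map t ≫ (α.app Z).hom) y := fun x y => by
    have := congrArg (fun f => f x) w
    refine this.trans ?_
    exact congrArg ((IndPro.points k).map t ≫ (α.app Z).hom) (sub _ y)
  have hz : ∀ y, ((IndPro.points k).map t ≫ (α.app Z).hom) y =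
      (0 : (realization k).obj Z) := fun y => by
    rw [← hw 0 y, map_zero, map_zero]
  intro b
  constructor
  · intro hb
    obtain ⟨x, hx, -⟩ := hex b (((α.app X).inv ≫ (IndPro.points k).map s) (0 : (realization k).obj X))
      (hb.trans (hz _).symm)
    exact ⟨x, hx⟩
  · rintro ⟨x, rfl⟩
    exact (hw x _).trans (hz (((α.app X).inv ≫ (IndPro.points k).map s) (0 : (realization k).obj X)))

/-- A diagram all of whose terms are zero. -/
def zeroDiagram (k : Type u) [Field k] : AdmDiagram k :=
  ⟨(Functor.const Pairs).obj (FGModuleCat.of k PUnit), fun _ _ _ _ _ =>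
    ⟨fun _ _ _ => rfl, fun x => ⟨fun _ => ⟨x, rfl⟩, fun _ => rfl⟩, fun x => ⟨x, rfl⟩⟩⟩

theorem isZero_toIndPro_zeroDiagram (k : Type u) [Field k] :
    IsZero ((toIndPro k).obj ((shiftMaps k).Q.obj (zeroDiagram k))) :=
  isZero_indProLim (Functor.isZero _ fun _ => isZero_of_punit k)

/-- Through a factorization of the second map of an admissible short exact sequence whose first map
kills the subobject, the second map becomes surjective. -/
theorem surjective_of_tate_isAdmissibleExact {X Y Z Z' : Tate k} {i : X ⟶ Y} {p : Y ⟶ Z}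
    (h : Tate.IsAdmissibleExact k i p) (π : Y ⟶ Z') (q : Z' ⟶ Z) (e : π ≫ q = p)
    (hi : (realization k).map (i ≫ π) = 0) :
    Function.Surjective ((realization k).map q).hom := by
  obtain ⟨O, hO, s, t, -, h⟩ := h
  let N := (shiftMaps k).Q.obj (zeroDiagram k)
  have hN : IsZero ((toIndPro k).obj N) := isZero_toIndPro_zeroDiagram k
  -- Zero maps of Tate spaces are obtained by fullness and faithfulness as factorizations through
  -- the zero diagram; this form lets the universal property of the pushout apply.
  obtain ⟨a, ha⟩ := (realization k).map_surjective (X := X) (Y := N) 0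
  obtain ⟨b, hb⟩ := (realization k).map_surjective (X := N) (Y := Z') 0
  have hab : i ≫ π = a ≫ b := by
    apply (realization k).map_injective
    rw [hi, Functor.map_comp, ha, zero_comp]
  let v : O ⟶ (toIndPro k).obj N := hN.isTerminal.from O
  let d := h.desc ((toIndPro k).map π) (v ≫ (toIndPro k).map b) (by
    rw [← Functor.map_comp, hab, Functor.map_comp, ← Category.assoc]
    congr 1
    exact hN.eq_of_tgt _ _)
  -- The map induced on the cokernel is a section of `q`, so `q` is surjective on points.
  have hd : d ≫ (toIndPro k).map q = 𝟙 _ := by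
    apply h.hom_ext
    · rw [IsPushout.inl_desc_assoc, ← Functor.map_comp, e, Category.comp_id]
    · exact hO.eq_of_src _ _
  let α := toIndProCompPoints k
  intro z
  let y := (IndPro.points k).map d ((α.app Z).inv z)
  refine ⟨(α.app Z').hom y, ?_⟩
  have n : ((realization k).map q).hom ((α.app Z').hom y) =
      (α.app Z).hom ((IndPro.points k).map ((toIndPro k).map q) y) :=
    (congrArg (fun f => f y) (α.hom.naturality q)).symm
  rw [n]
  have e1 : (IndPro.points k).map ((toIndPro k).map q) y = (α.app Z).inv z := by
    have h1 := (IndPro.points k).map_comp d ((toIndPro k).map q)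
    rw [hd, CategoryTheory.Functor.map_id] at h1
    exact (congrArg (fun f => f ((α.app Z).inv z)) h1).symm
  rw [e1]
  exact congrArg (fun f => f z) (α.app Z).inv_hom_id

theorem exists_isLatticeFiltration_realization (T : Tate k) :
    ∃ F : ℤ → Submodule k ((realization k).obj T), IsLatticeFiltration F :=
  (exists_isLatticeFiltration_iff _).1
    ((realization_essImage_iff_isCountableLLC _).1 ((realization k).obj_mem_essImage T))

/-- The quotient of the middle space by the kernel inherits a lattice filtration, hence is the
realization of a Tate space. The preceding lemma applies to the factorization of `p` through it. -/
theorem realization_map_surjective_of_tate_isAdmissibleExact {X Y Z : Tate k} {i : X ⟶ Y}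
    {p : Y ⟶ Z} (h : Tate.IsAdmissibleExact k i p) :
    Function.Surjective ((realization k).map p).hom := by
  obtain ⟨G, hG⟩ := exists_isLatticeFiltration_realization Y
  obtain ⟨H, hH⟩ := exists_isLatticeFiltration_realization Z
  have := hH.t2Space
  let f : (realization k).obj Y →L[k] (realization k).obj Z := ((realization k).map p).hom
  let K : Submodule k ((realization k).obj Y) := LinearMap.ker f.toLinearMap
  have hK : IsClosed (K : Set ((realization k).obj Y)) := isClosed_singleton.preimage f.continuous
  have hker : LinearMap.ker K.mkQ = K := K.ker_mkQ
  let Q : TopModuleCat.{u} k := TopModuleCat.of k ((realization k).obj Y ⧸ K)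
  have hQ : IsCountableLLC k Q := (exists_isLatticeFiltration_iff Q).2
    ⟨_, hG.map K.mkQ K.isOpenQuotientMap_mkQ (by rw [hker]; exact hK)⟩
  obtain ⟨T, ⟨e⟩⟩ := (realization_essImage_iff_isCountableLLC Q).2 hQ
  let π₀ : (realization k).obj Y ⟶ Q := ConcreteCategory.ofHom (C := TopModuleCat.{u} k) K.mkQL
  let q₀ : Q ⟶ (realization k).obj Z := ConcreteCategory.ofHom (C := TopModuleCat.{u} k)
    (⟨K.liftQ f.toLinearMap le_rfl, K.isOpenQuotientMap_mkQ.isQuotientMap.continuous_iff.2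
      f.continuous⟩ : ((realization k).obj Y ⧸ K) →L[k] (realization k).obj Z)
  have hπq : π₀ ≫ q₀ = (realization k).map p := rfl
  obtain ⟨π, hπ⟩ := (realization k).map_surjective (π₀ ≫ e.inv)
  obtain ⟨q, hq⟩ := (realization k).map_surjective (e.hom ≫ q₀)
  have hs := surjective_of_tate_isAdmissibleExact h π q (by
    apply (realization k).map_injective
    rw [Functor.map_comp, hπ, hq, Category.assoc, e.inv_hom_id_assoc, hπq]) (by
    rw [Functor.map_comp, hπ]
    apply ConcreteCategory.hom_ext
    intro x
    have h0 : π₀.hom (((realization k).map i).hom x) = 0 := (Submodule.Quotient.mk_eq_zero K).2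
      ((injective_exact_of_tate_isAdmissibleExact h).2.apply_apply_eq_zero x)
    exact (congrArg e.inv.hom h0).trans (map_zero e.inv.hom))
  intro z
  obtain ⟨y, rfl⟩ := hs z
  rw [hq]
  obtain ⟨x, hx⟩ := K.mkQ_surjective (e.hom.hom y)
  exact ⟨x, congrArg q₀.hom hx⟩

theorem IsAdmissibleExact.isCountableLLC {A B C : TopModuleCat.{u} k} {i : A ⟶ B} {p : B ⟶ C}
    (h : IsAdmissibleExact i p) :
    IsCountableLLC k A ∧ IsCountableLLC k B ∧ IsCountableLLC k C := by
  obtain ⟨X, Y, Z, -, -, -, eA, eB, eC, -, -⟩ := h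
  exact ⟨(realization_essImage_iff_isCountableLLC _).1 ⟨X, ⟨eA⟩⟩,
    (realization_essImage_iff_isCountableLLC _).1 ⟨Y, ⟨eB⟩⟩,
    (realization_essImage_iff_isCountableLLC _).1 ⟨Z, ⟨eC⟩⟩⟩

theorem IsAdmissibleExact.exact {A B C : TopModuleCat.{u} k} {i : A ⟶ B} {p : B ⟶ C}
    (h : IsAdmissibleExact i p) :
    Function.Injective i.hom ∧ Function.Exact i.hom p.hom ∧ Function.Surjective p.hom := by
  obtain ⟨X, Y, Z, i', p', h, eA, eB, eC, hi, hp⟩ := h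
  obtain ⟨h1, h2⟩ := injective_exact_of_tate_isAdmissibleExact h
  have h3 := realization_map_surjective_of_tate_isAdmissibleExact h
  let a := eA.toContinuousLinearEquiv
  let b := eB.toContinuousLinearEquiv
  let c := eC.toContinuousLinearEquiv
  have hi' : ∀ x, i.hom (a x) = b (((realization k).map i').hom x) := fun x =>
    (ConcreteCategory.congr_hom hi x).symm
  have hp' : ∀ y, p.hom (b y) = c (((realization k).map p').hom y) := fun y =>
    (ConcreteCategory.congr_hom hp y).symm
  refine ⟨fun x y hxy => ?_, fun y => ?_, fun z => ?_⟩
  · obtain ⟨x, rfl⟩ := a.surjective x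
    obtain ⟨y, rfl⟩ := a.surjective y
    rw [hi', hi'] at hxy
    rw [h1 (b.injective hxy)]
  · obtain ⟨y, rfl⟩ := b.surjective y
    rw [hp', map_eq_zero_iff c c.injective, h2 y]
    constructor
    · rintro ⟨x, rfl⟩
      exact ⟨a x, hi' x⟩
    · rintro ⟨x, hx⟩
      obtain ⟨x, rfl⟩ := a.surjective x
      rw [hi'] at hx
      exact ⟨x, b.injective hx⟩
  · obtain ⟨z, rfl⟩ := c.surjective z
    obtain ⟨y, rfl⟩ := h3 z
    exact ⟨b y, hp' y⟩

/-- For an admissible monomorphism, the corestriction to the closed subspace `ker p` is a continuous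
bijection between spaces with lattice filtrations, hence a homeomorphism by the open mapping
theorem. Conversely, a closed embedding is completed by the quotient by its range. -/
theorem isAdmissibleMono_iff {A B : TopModuleCat.{u} k} (hA : IsCountableLLC k A)
    (hB : IsCountableLLC k B) (i : A ⟶ B) :
    IsAdmissibleMono i ↔ Topology.IsClosedEmbedding i.hom := by
  obtain ⟨F, hF⟩ := (exists_isLatticeFiltration_iff A).1 hA
  obtain ⟨G, hG⟩ := (exists_isLatticeFiltration_iff B).1 hB
  constructor
  · rintro ⟨C, p, h⟩
    have := h.isCountableLLC.2.2.t2Space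
    obtain ⟨inj, ex, -⟩ := h.exact
    let K : Submodule k B := LinearMap.ker p.hom.toLinearMap
    have hK : IsClosed (K : Set B) := isClosed_singleton.preimage p.hom.continuous
    have hKe : Topology.IsClosedEmbedding K.subtype := hK.isClosedEmbedding_subtypeVal
    let r : A →ₗ[k] K := i.hom.toLinearMap.codRestrict K fun x => ex.apply_apply_eq_zero x
    have hr : Continuous r := i.hom.continuous.subtype_mk _
    have hro : IsOpenMap r := hF.isOpenMap (hG.comap K.subtype hKe) r hr fun y => by
      obtain ⟨x, hx⟩ := (ex y).1 y.2
      exact ⟨x, Subtype.ext hx⟩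
    have hri : Function.Injective r := fun x y hxy => inj (congrArg Subtype.val hxy)
    have hrs : Function.Surjective r := fun y => by
      obtain ⟨x, hx⟩ := (ex y).1 y.2
      exact ⟨x, Subtype.ext hx⟩
    exact hKe.comp (IsHomeomorph.isClosedEmbedding ⟨hr, hro, hri, hrs⟩)
  · intro hi
    let R : Submodule k B := LinearMap.range i.hom.toLinearMap
    refine ⟨TopModuleCat.of k (B ⧸ R), ConcreteCategory.ofHom (C := TopModuleCat.{u} k) R.mkQL,
      isAdmissibleExact_of_exact hG hi R.isOpenQuotientMap_mkQ fun x => ?_⟩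
    exact Submodule.Quotient.mk_eq_zero R

/-- By the open mapping theorem surjectivity already makes `p` open, which is the homeomorphism
condition on the quotient. Conversely, the closed subspace `ker p` completes the sequence. -/
theorem isAdmissibleEpi_iff {B C : TopModuleCat.{u} k} (hB : IsCountableLLC k B)
    (hC : IsCountableLLC k C) (p : B ⟶ C) :
    IsAdmissibleEpi p ↔ Continuous p.hom ∧ Function.Surjective p.hom ∧
      IsHomeomorph (quotientKerMap p) := by
  obtain ⟨G, hG⟩ := (exists_isLatticeFiltration_iff B).1 hB
  obtain ⟨H, hH⟩ := (exists_isLatticeFiltration_iff C).1 hC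
  have := hC.t2Space
  constructor
  · rintro ⟨A, i, h⟩
    have hs := h.exact.2.2
    exact ⟨p.hom.continuous, hs, (isHomeomorph_quotientKerMap_iff p hs).2
      (hG.isOpenMap hH p.hom.toLinearMap p.hom.continuous hs)⟩
  · rintro ⟨-, hs, h⟩
    let K : Submodule k B := LinearMap.ker p.hom.toLinearMap
    have hK : IsClosed (K : Set B) := isClosed_singleton.preimage p.hom.continuous
    refine ⟨TopModuleCat.of k K, ConcreteCategory.ofHom (C := TopModuleCat.{u} k) K.subtypeL,
      isAdmissibleExact_of_exact hG hK.isClosedEmbedding_subtypeVal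
        ⟨hs, p.hom.continuous, (isHomeomorph_quotientKerMap_iff p hs).1 h⟩ fun x => ?_⟩
    exact ⟨fun hx => ⟨⟨x, hx⟩, rfl⟩, fun ⟨y, hy⟩ => hy ▸ y.2⟩

end

end TateSpaces

theorem mainTheorem9 (k : Type u) [Field k] [TopologicalSpace k] [DiscreteTopology k] :
    -- `Φ` identifies Tate spaces with locally linearly compact spaces of countable type
    ((TateSpaces.realization k).Full ∧ (TateSpaces.realization k).Faithful ∧
      ∀ V : TopModuleCat.{u} k,
        (TateSpaces.realization k).essImage V ↔ TateSpaces.IsCountableLLC k V) ∧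
    (∀ A B : TopModuleCat.{u} k, TateSpaces.IsCountableLLC k A → TateSpaces.IsCountableLLC k B →
      ∀ i : A ⟶ B, TateSpaces.IsAdmissibleMono i ↔ Topology.IsClosedEmbedding i.hom) ∧
    (∀ B C : TopModuleCat.{u} k, TateSpaces.IsCountableLLC k B → TateSpaces.IsCountableLLC k C →
      ∀ p : B ⟶ C, TateSpaces.IsAdmissibleEpi p ↔
        Continuous p.hom ∧ Function.Surjective p.hom ∧
          IsHomeomorph (TateSpaces.quotientKerMap p)) := by
  exact ⟨⟨TateSpaces.realization_full, TateSpaces.realization_faithful,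
      TateSpaces.realization_essImage_iff_isCountableLLC⟩,
    fun _ _ hA hB i => TateSpaces.isAdmissibleMono_iff hA hB i,
    fun _ _ hB hC p => TateSpaces.isAdmissibleEpi_iff hB hC p⟩
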